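/- **Setting.** Let $\mathcal D$ be a probability distribution on $\mathcal X\times\{\pm1\}$ with marginal $\mathcal D_X$ on $\mathcal X$, let $\mathcal H$ be a finite set of (measurable) classifiers $h:\mathcal X\to\{\pm1\}$, let $\mathrm{err}(h)=\Pr_{(X,Y)\sim\mathcal D}(h(X)\ne Y)$, and let $h^*\in\arg\min_{h\in\mathcal H}\mathrm{err}(h)$. For a finite multiset $S$ of triples $(x,y,w)$ put $\mathrm{err}(h,S)=\frac1{|S|}\sum_{(x,y,w)\in S}w\,\mathbf 1(h(x)\ne y)$ (which is $0$ if $S=\emptyset$) and $\mathrm{reg}(h,h',S)=\mathrm{err}(h,S)-\mathrm{err}(h',S)$. For $A\subseteq\mathcal H$ let $\mathrm{DIS}(A)=\{x:\exists h,h'\in A,\ h(x)\ne h'(x)\}$. **Inputs.** Let $M\ge1$, let $0=\tau_0<3=\tau_1<\tau_2<\dots<\tau_M\le n$ be integers with $\tau_{m+1}\le2\tau_m$ for $1\le m<M$, let $0<\delta<1/e$ with $|\mathcal H|/\delta>\sqrt{192}$, and put $\epsilon_m=32\,(\log(|\mathcal H|/\delta)+\log\tau_m)/\tau_m$. Let the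 real constants $\alpha,\beta,\gamma,\xi,\eta,c_1,c_2,c_3$ satisfy $$\alpha\ge1,\quad \eta\ge864,\quad \xi\le\frac1{8n\epsilon_M\log n},\quad \beta^2\le\frac{\eta}{864\,\gamma n\epsilon_M\log n},\quad \gamma\ge\frac\eta4,\quad c_1\ge2\alpha\sqrt6,\quad c_2\ge\frac{\eta c_1^2}4,\quad c_3\ge1 .$$ **Algorithm (Active Cover).** Labeled examples $(X_1,Y_1),(X_2,Y_2),\dots$ are drawn i.i.d. from $\mathcal D$; epoch $m$ consists of the examples $\tau_{m-1}<i\le\tau_m$. Start with $\tilde Z_0=\emptyset$ and $\Delta_0=c_1\sqrt{\epsilon_1}+c_2\epsilon_1\log3$. At the start of epoch $m+1$ ($m\ge0$), using only the information available after example $\tau_m$, let $$h_{m+1}\in\arg\min_{h\in\mathcal H}\mathrm{err}(h,\tilde Z_m),\qquad \Delta_m=c_1\sqrt{\epsilon_m\,\mathrm{err}(h_{m+1},\tilde Z_m)}+c_2\epsilon_m\log\tau_m\quad(m\ge1),$$ $$A_{m+1}=\{h\in\mathcal H:\mathrm{reg}(h,h_{m+1},\tilde Z_m)\le\gamma\Delta_m\},\qquad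 D_{m+1}=\mathrm{DIS}(A_{m+1}).$$ Ties are broken arbitrarily, and $h_1\in\mathcal H$ is arbitrary. Let $P_1\equiv1$, and for $2\le m\le M$ let $P_m$ be a minimizer of $\mathbb E_X[1/(1-P(X))]$ over (measurable) $P:\mathcal X\to[0,1]$ subject to $$\mathbb E_X\Big[\frac{\mathbf 1(h(X)\ne h_m(X)\wedge X\in D_m)}{P(X)}\Big]\le b_m(h)\quad\forall h\in\mathcal H,\qquad P(x)\ge P_{\min,m}\quad\forall x\in D_m,$$ where $$b_m(h)=2\alpha^2\,\mathbb E_X[\mathbf 1(h(X)\ne h_m(X)\wedge X\in D_m)]+2\beta^2\gamma\,\mathrm{reg}(h,h_m,\tilde Z_{m-1})\,\tau_{m-1}\Delta_{m-1}+\xi\,\tau_{m-1}\Delta_{m-1}^2,$$ $$P_{\min,m}=\min\Bigg(\frac{c_3}{\sqrt{\tau_{m-1}\,\mathrm{err}(h_m,\tilde Z_{m-1})/(n\epsilon_M)}+\log\tau_{m-1}},\ \frac12\Bigg).$$ For each example $i$ of epoch $m$: if $X_i\in D_m$, draw $Q_i\sim\mathrm{Bernoulli}(P_m(X_i))$, given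 the past and the example, and record $(X_i,Y_i,1/P_m(X_i))$ if $Q_i=1$, and $(X_i,1,0)$ if $Q_i=0$; if $X_i\notin D_m$, record $(X_i,h_m(X_i),1)$. Then $\tilde Z_m$ is $\tilde Z_{m-1}$ together with the triples recorded in epoch $m$. **Population quantities.** With $\mathbb E$ over a fresh $(X,Y)\sim\mathcal D$, let $$\overline{\mathrm{err}}_m(h)=\frac1{\tau_m}\sum_{j=1}^m(\tau_j-\tau_{j-1})\,\mathbb E[\mathbf 1(h(X)\ne Y\wedge X\in D_j)],$$ $$\overline{\mathrm{reg}}_m(h,h')=\frac1{\tau_m}\sum_{j=1}^m(\tau_j-\tau_{j-1})\Big(\mathbb E\big[(\mathbf 1(h(X)\ne h_j(X))-\mathbf 1(h'(X)\ne h_j(X)))\mathbf 1(X\notin D_j)\big]+\mathbb E\big[(\mathbf 1(h(X)\ne Y)-\mathbf 1(h'(X)\ne Y))\mathbf 1(X\in D_j)\big]\Big).$$ **Theorem.** With probability at least $1-\delta$, the following holds simultaneously for all epochs $m=1,\dots,M$ and all $h\in\mathcal H$: $$\big|\mathrm{reg}(h,h^*,\tilde Z_m)-\overline{\mathrm{reg}}_m(h,h^*)\big|\le\tfrac12\,\overline{\mathrm{reg}}_m(h,h^*)+\tfrac\eta4\Delta_m,$$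 $$\mathrm{reg}(h^*,h_{m+1},\tilde Z_m)\le\frac{\eta\Delta_m}4\quad\text{and}\quad h^*\in A_i\ \text{ for all } 1\le i\le m+1,$$ $$\big|\overline{\mathrm{err}}_m(h^*)-\mathrm{err}(h_{m+1},\tilde Z_m)\big|\le\frac{\overline{\mathrm{err}}_m(h^*)}2+\frac\eta2\Delta_m.$$ -/

import Mathlib

open MeasureTheory ProbabilityTheory

namespace ActiveCover

open Classical in
/-- The `0`-`1` indicator of a proposition. -/
noncomputable def ind (q : Prop) : ℝ := if q then 1 else 0

/-! ### Classifiers, errors, disagreement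

The two labels `±1` are the two elements of `Bool`; a classifier on `𝒳` is a map `𝒳 → Bool`. -/

section Basic

variable {𝒳 : Type*}

/-- `DIS(A)`, the points on which two classifiers of `A` disagree. -/
def disagreement (A : Set (𝒳 → Bool)) : Set 𝒳 :=
  {x | ∃ g ∈ A, ∃ g' ∈ A, g x ≠ g' x}

/-- `err(g, S)`, the importance weighted empirical error on a multiset of triples
(point, label, weight). It is `0` for the empty multiset. -/
noncomputable def empErr (g : 𝒳 → Bool) (S : Multiset (𝒳 × Bool × ℝ)) : ℝ :=
  (S.map fun z => z.2.2 * ind (g z.1 ≠ z.2.1)).sum / (Multiset.card S : ℝ)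

/-- `reg(g, g', S) = err(g, S) - err(g', S)`. -/
noncomputable def empReg (g g' : 𝒳 → Bool) (S : Multiset (𝒳 × Bool × ℝ)) : ℝ :=
  empErr g S - empErr g' S

/-- The classifiers of `H` whose empirical regret to `g` on `S` is at most `r`. -/
def goodSet (H : Finset (𝒳 → Bool)) (S : Multiset (𝒳 × Bool × ℝ)) (g : 𝒳 → Bool) (r : ℝ) :
    Set (𝒳 → Bool) :=
  {f | f ∈ H ∧ empReg f g S ≤ r}

variable [MeasurableSpace 𝒳]

/-- `err(g)`, the probability under the law `D` of a labeled example that `g` errs. -/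
noncomputable def err (D : Measure (𝒳 × Bool)) (g : 𝒳 → Bool) : ℝ :=
  D.real {z | g z.1 ≠ z.2}

/-- `g` is a minimizer of the expected error over `H`. -/
def IsBest (D : Measure (𝒳 × Bool)) (H : Finset (𝒳 → Bool)) (g : 𝒳 → Bool) : Prop :=
  g ∈ H ∧ ∀ f ∈ H, err D g ≤ err D f

end Basic

/-! ### The optimization problem for the query probability function -/

section OptimizationProblem

variable {𝒳 : Type*} [MeasurableSpace 𝒳]

/-- Feasibility of `P`: the variance constraints with right-hand sides `b`, and the bound
constraints, where `g` is the current classifier, `R` the current disagreement region and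
`pmin` the minimum query probability on `R`. -/
structure Feasible (DX : Measure 𝒳) (H : Finset (𝒳 → Bool)) (g : 𝒳 → Bool) (R : Set 𝒳)
    (b : (𝒳 → Bool) → ℝ) (pmin : ℝ) (P : 𝒳 → ℝ) : Prop where
  measurable : Measurable P
  variance : ∀ f ∈ H, ∫ x, ind (f x ≠ g x ∧ x ∈ R) / P x ∂DX ≤ b f
  bounds : ∀ x, 0 ≤ P x ∧ P x ≤ 1
  lower : ∀ x ∈ R, pmin ≤ P x

/-- The objective `E_X[1 / (1 - P(X))]`, with `1 / 0 = ∞`. -/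
noncomputable def objective (DX : Measure 𝒳) (P : 𝒳 → ℝ) : ENNReal :=
  ∫⁻ x, (ENNReal.ofReal (1 - P x))⁻¹ ∂DX

/-- `P` solves the optimization problem. -/
def IsSolution (DX : Measure 𝒳) (H : Finset (𝒳 → Bool)) (g : 𝒳 → Bool) (R : Set 𝒳)
    (b : (𝒳 → Bool) → ℝ) (pmin : ℝ) (P : 𝒳 → ℝ) : Prop :=
  Feasible DX H g R b pmin P ∧
    ∀ P' : 𝒳 → ℝ, Feasible DX H g R b pmin P' → objective DX P ≤ objective DX P'

end OptimizationProblem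

/-! ### Inputs of the algorithm -/

/-- The inputs of the algorithm: the constants, the confidence `δ`, the number `M` of epochs,
the epoch schedule `τ` and the number `n` of examples. Epoch `m` consists of the examples with
index `τ (m - 1) < i ≤ τ m`. -/
structure Params where
  (c₁ c₂ c₃ δ γ α β ξ η : ℝ)
  (M n : ℕ)
  (τ : ℕ → ℕ)

/-- `ε_m = 32 (log (N / δ) + log τ_m) / τ_m`, where `N` is the number of classifiers. -/
noncomputable def Params.eps (p : Params) (N m : ℕ) : ℝ :=
  32 * (Real.log (N / p.δ) + Real.log (p.τ m)) / p.τ m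

/-- The threshold `Δ_m` as a function of `e = err(h_{m+1}, Z̃_m)`. -/
noncomputable def Params.threshold (p : Params) (N m : ℕ) (e : ℝ) : ℝ :=
  if m = 0 then p.c₁ * √(p.eps N 1) + p.c₂ * p.eps N 1 * Real.log 3
  else p.c₁ * √(p.eps N m * e) + p.c₂ * p.eps N m * Real.log (p.τ m)

/-- The requirements on the epoch schedule and on the constants. -/
structure Params.Admissible (p : Params) (N : ℕ) : Prop where
  one_le_M : 1 ≤ p.M
  τ_zero : p.τ 0 = 0
  τ_one : p.τ 1 = 3
  τ_lt : ∀ m, m < p.M → p.τ m < p.τ (m + 1)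
  τ_le : ∀ m, 1 ≤ m → m < p.M → p.τ (m + 1) ≤ 2 * p.τ m
  τ_le_n : p.τ p.M ≤ p.n
  α_ge : 1 ≤ p.α
  η_ge : 864 ≤ p.η
  ξ_le : p.ξ ≤ 1 / (8 * p.n * p.eps N p.M * Real.log p.n)
  β_le : p.β ^ 2 ≤ p.η / (864 * p.γ * p.n * p.eps N p.M * Real.log p.n)
  γ_ge : p.η / 4 ≤ p.γ
  c₁_ge : 2 * p.α * √6 ≤ p.c₁
  c₂_ge : p.η * p.c₁ ^ 2 / 4 ≤ p.c₂
  c₃_ge : 1 ≤ p.c₃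

/-! ### Quantities computed along an execution -/

/-- The random quantities of an execution: the stream `(X i, Y i)`, `i = 1, 2, …`, the query
decisions `Q i`, and, for each epoch `m = 1, 2, …`, the classifier `h m` and the query probability
function `P m`. -/
structure Trace (Ω 𝒳 : Type*) where
  X : ℕ → Ω → 𝒳
  Y : ℕ → Ω → Bool
  Q : ℕ → Ω → Bool
  h : ℕ → Ω → 𝒳 → Bool
  P : ℕ → Ω → 𝒳 → ℝ

namespace Trace

variable {Ω 𝒳 : Type*} (T : Trace Ω 𝒳) (p : Params) (H : Finset (𝒳 → Bool))

open Classical in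
/-- The weighted example recorded for the index `i` of epoch `m`, when the disagreement region of
that epoch is `R`. -/
noncomputable def record (m : ℕ) (R : Set 𝒳) (ω : Ω) (i : ℕ) : 𝒳 × Bool × ℝ :=
  if T.X i ω ∈ R then
    if T.Q i ω = true then (T.X i ω, T.Y i ω, 1 / T.P m ω (T.X i ω)) else (T.X i ω, true, 0)
  else (T.X i ω, T.h m ω (T.X i ω), 1)

/-- The biased sample `Z̃_m`. The region used in epoch `m + 1` is `DIS(A_{m+1})`. -/
noncomputable def Z (ω : Ω) : ℕ → Multiset (𝒳 × Bool × ℝ)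
  | 0 => 0
  | m + 1 => Z ω m + (Finset.Ioc (p.τ m) (p.τ (m + 1))).val.map
      (T.record (m + 1)
        (disagreement (goodSet H (Z ω m) (T.h (m + 1) ω)
          (p.γ * p.threshold H.card m (empErr (T.h (m + 1) ω) (Z ω m))))) ω)

/-- `Δ_m`. -/
noncomputable def Delta (m : ℕ) (ω : Ω) : ℝ :=
  p.threshold H.card m (empErr (T.h (m + 1) ω) (T.Z p H ω m))

/-- `A_m`, for `m ≥ 1`: the classifiers of `H` with empirical regret to `h_m` at most
`γ Δ_{m-1}` on `Z̃_{m-1}`. -/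
noncomputable def A (m : ℕ) (ω : Ω) : Set (𝒳 → Bool) :=
  goodSet H (T.Z p H ω (m - 1)) (T.h m ω) (p.γ * T.Delta p H (m - 1) ω)

/-- `D_m = DIS(A_m)`, for `m ≥ 1`. -/
noncomputable def region (m : ℕ) (ω : Ω) : Set 𝒳 := disagreement (T.A p H m ω)

/-- The minimum query probability `P_{min,m}`, for `m ≥ 2`. -/
noncomputable def pMin (m : ℕ) (ω : Ω) : ℝ :=
  min (p.c₃ / (√(p.τ (m - 1) * empErr (T.h m ω) (T.Z p H ω (m - 1)) / (p.n * p.eps H.card p.M))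
    + Real.log (p.τ (m - 1)))) (1 / 2)

variable [MeasurableSpace 𝒳] (D : Measure (𝒳 × Bool))

/-- The right-hand side `b_m(f)` of the variance constraints, for `m ≥ 2`. -/
noncomputable def varBound (m : ℕ) (ω : Ω) (f : 𝒳 → Bool) : ℝ :=
  2 * p.α ^ 2 * ∫ x, ind (f x ≠ T.h m ω x ∧ x ∈ T.region p H m ω) ∂D.fst
    + 2 * p.β ^ 2 * p.γ * empReg f (T.h m ω) (T.Z p H ω (m - 1)) * p.τ (m - 1)
        * T.Delta p H (m - 1) ω
    + p.ξ * p.τ (m - 1) * T.Delta p H (m - 1) ω ^ 2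

/-- `err_m(f)`, the expected error of `f` restricted to `D_m`. -/
noncomputable def errEpoch (m : ℕ) (ω : Ω) (f : 𝒳 → Bool) : ℝ :=
  D.real {z | f z.1 ≠ z.2 ∧ z.1 ∈ T.region p H m ω}

/-- The average of `err_1(f), …, err_m(f)` with weights `(τ_j - τ_{j-1}) / τ_m`. -/
noncomputable def errBar (m : ℕ) (ω : Ω) (f : 𝒳 → Bool) : ℝ :=
  1 / (p.τ m : ℝ) * ∑ j ∈ Finset.Icc 1 m,
    ((p.τ j : ℝ) - (p.τ (j - 1) : ℝ)) * T.errEpoch p H D j ω f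

/-- The biased expected regret of `f` relative to `f'` in epoch `m`: labels are predicted by `h_m`
outside `D_m` and drawn from `D` inside. -/
noncomputable def regEpoch (m : ℕ) (ω : Ω) (f f' : 𝒳 → Bool) : ℝ :=
  (∫ x, (ind (f x ≠ T.h m ω x) - ind (f' x ≠ T.h m ω x)) * ind (x ∉ T.region p H m ω) ∂D.fst)
    + ∫ z, (ind (f z.1 ≠ z.2) - ind (f' z.1 ≠ z.2)) * ind (z.1 ∈ T.region p H m ω) ∂D

/-- The average of the biased expected regrets of epochs `1, …, m`
with weights `(τ_j - τ_{j-1}) / τ_m`. -/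
noncomputable def regBar (m : ℕ) (ω : Ω) (f f' : 𝒳 → Bool) : ℝ :=
  1 / (p.τ m : ℝ) * ∑ j ∈ Finset.Icc 1 m,
    ((p.τ j : ℝ) - (p.τ (j - 1) : ℝ)) * T.regEpoch p H D j ω f f'

end Trace

/-! ### Executions of the algorithm -/

/-- `T` is an execution of the algorithm with inputs `p` and `H` on a stream of i.i.d. labeled
examples with law `D`. The `σ`-algebra `ℱ i` is the information available after example `i`; it
contains the history of the first `i` examples, and possibly internal randomness of the learner
(used, for instance, to break ties). -/
structure IsRun {Ω 𝒳 : Type*} [mΩ : MeasurableSpace Ω] [m𝒳 : MeasurableSpace 𝒳]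
    (μ : Measure Ω) (ℱ : Filtration ℕ mΩ) (D : Measure (𝒳 × Bool)) (p : Params)
    (H : Finset (𝒳 → Bool)) (T : Trace Ω 𝒳) : Prop where
  X_adapted : ∀ i, i < p.n → Measurable[ℱ (i + 1)] (T.X (i + 1))
  Y_adapted : ∀ i, i < p.n → Measurable[ℱ (i + 1)] (T.Y (i + 1))
  Q_adapted : ∀ i, i < p.n → Measurable[ℱ (i + 1)] (T.Q (i + 1))
  /-- Each labeled example has law `D`. -/
  law : ∀ i, i < p.n → μ.map (fun ω => (T.X (i + 1) ω, T.Y (i + 1) ω)) = D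
  /-- Each labeled example is independent of the past. -/
  indep : ∀ i, i < p.n →
    Indep (MeasurableSpace.comap (fun ω => (T.X (i + 1) ω, T.Y (i + 1) ω)) inferInstance) (ℱ i) μ
  /-- For an example of epoch `m + 1` that falls in `D_{m+1}`, the decision to query is a
  Bernoulli variable of parameter `P_{m+1}(X)`, conditionally on the past and on the example. -/
  query : ∀ m, m < p.M → ∀ i, p.τ m ≤ i → i < p.τ (m + 1) →
    ∀ᵐ ω ∂μ, T.X (i + 1) ω ∈ T.region p H (m + 1) ω →
      (μ[fun ω' => ind (T.Q (i + 1) ω' = true) |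
        (ℱ i : MeasurableSpace Ω) ⊔
          MeasurableSpace.comap (fun ω' => (T.X (i + 1) ω', T.Y (i + 1) ω')) inferInstance]) ω
        = T.P (m + 1) ω (T.X (i + 1) ω)
  /-- `h_{m+1}` minimizes the empirical error on `Z̃_m` over `H`
  (and so `h_1` is any classifier in `H`). -/
  erm_mem : ∀ m, m ≤ p.M → ∀ ω, T.h (m + 1) ω ∈ H
  erm_le : ∀ m, m ≤ p.M → ∀ ω, ∀ f ∈ H,
    empErr (T.h (m + 1) ω) (T.Z p H ω m) ≤ empErr f (T.Z p H ω m)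
  /-- `h_{m+1}` is chosen at the end of epoch `m`. -/
  erm_measurable : ∀ m, m ≤ p.M → ∀ f ∈ H, MeasurableSet[ℱ (p.τ m)] {ω | T.h (m + 1) ω = f}
  /-- The labels of the first three examples are always queried. -/
  prob_one : ∀ ω x, T.P 1 ω x = 1
  /-- `P_m` solves the optimization problem of epoch `m`. -/
  prob_solution : ∀ m, 2 ≤ m → m ≤ p.M → ∀ ω,
    IsSolution D.fst H (T.h m ω) (T.region p H m ω) (T.varBound p H D m ω) (T.pMin p H m ω)
      (T.P m ω)
  /-- `P_{m+1}` is chosen at the end of epoch `m`, measurably. -/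
  prob_measurable : ∀ m, m < p.M →
    Measurable[(ℱ (p.τ m) : MeasurableSpace Ω).prod m𝒳] (fun z : Ω × 𝒳 => T.P (m + 1) z.1 z.2)

end ActiveCover

open MeasureTheory ProbabilityTheory

namespace ActiveCover

/-! Given the past, an example of epoch `j` contributes to the importance weighted sum of `s` with
mean `T.mean` and second moment `T.moment`. As long as a scale `l` is at most the query
probabilities, the exponential of `l` times the sum, minus the accumulated `l * mean + l ^ 2 *
moment`, is a supermartingale (`integral_mul_exp_contribution_le`, `exists_subUnit`), and Markov's
inequality gives a Bernstein bound (`deviation`). Variance and range are both random, so the best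
scale is random too. A union bound over epochs, test functions and all scales `1 / k` with `k ≤ τ m`
(`IsRun.good`) allows the scale to be chosen path by path (`exists_scale`, `abs_sub_le_of_good`).
All that remains is deterministic on the good event.

Range: the minimum query probability is governed by the least weighted number of errors, which never
decreases. Hence `maxWeight` bounds all weights so far, and `ε_m` times it is at most `Δ_m / 4`
(`eps_mul_maxWeight_le`).

Bias: while `h*` lies in `A_j`, it agrees with `h_j` off `D_j`, so the predicted labels are those of
`h*`. This can only favor `h*`: the biased regret to `h*` dominates the true one and is nonnegative.

Variance: the constraints of the optimization problem bound the second moment of a loss difference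
by a disagreement mass, past empirical regrets and past thresholds. By induction over epochs, the
conclusions for earlier epochs turn these into population regrets and thresholds (`sum_moment_le`).
Summing over epochs costs a factor `log τ_m`, which is absorbed by the term `c₂ ε_m log τ_m` of
`Δ_m` and by the factor `log n` in the constraints on `β` and `ξ`. With `r = reg(h*, h_{m+1})` on
the sample, the deviation of the regret of `f` is then at most `(regBar f + r) / 4 + η Δ_m / 10` up
to a small multiple of `Δ_m` (`sqrt_variance_le`). For `f = h_{m+1}`, of empirical regret `-r`, this
forces `r ≤ η Δ_m / 4`. Inserting this bound back gives the other estimates, and `γ ≥ η / 4` keeps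
`h*` in `A_{m+1}` (`conclusion_step`, `conclusion_of_good`). -/

/-- Fubini for a function of the past and of an independent observation. -/
lemma integral_comp_prodMk_of_indepFun {Ω Λ 𝒵 : Type*} [MeasurableSpace Ω] [MeasurableSpace Λ]
    [MeasurableSpace 𝒵] {μ : Measure Ω} [IsProbabilityMeasure μ] {D : Measure 𝒵}
    [IsProbabilityMeasure D] {U : Ω → Λ} {V : Ω → 𝒵} (hU : Measurable U) (hV : Measurable V)
    (hlaw : μ.map V = D) (hind : IndepFun U V μ) {Φ : Λ × 𝒵 → ℝ} (hΦ : Measurable Φ)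
    {C : ℝ} (hC : ∀ q, |Φ q| ≤ C) :
    ∫ ω, Φ (U ω, V ω) ∂μ = ∫ ω, ∫ z, Φ (U ω, z) ∂D ∂μ := by
  have h := (indepFun_iff_map_prod_eq_prod_map_map hU.aemeasurable hV.aemeasurable).1 hind
  have : IsProbabilityMeasure (μ.map U) := Measure.isProbabilityMeasure_map hU.aemeasurable
  rw [hlaw] at h
  have hint : Integrable Φ ((μ.map U).prod D) :=
    Integrable.of_bound hΦ.aestronglyMeasurable C (Filter.Eventually.of_forall hC)
  have h1 : ∫ ω, Φ (U ω, V ω) ∂μ = ∫ q, Φ q ∂(μ.map fun ω => (U ω, V ω)) :=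
    (integral_map (hU.prodMk hV).aemeasurable hΦ.aestronglyMeasurable).symm
  rw [h1, h, integral_prod _ hint, integral_map hU.aemeasurable]
  exact hΦ.stronglyMeasurable.integral_prod_right'.aestronglyMeasurable

/-- A factor measurable with respect to the conditioning `σ`-algebra allows to replace a random
variable by its conditional expectation. -/
lemma integral_mul_condExp_eq {Ω : Type*} {m mΩ : MeasurableSpace Ω} (hm : m ≤ mΩ)
    {μ : Measure Ω} [IsProbabilityMeasure μ] {B q : Ω → ℝ} (hB : Measurable[m] B)
    {C : ℝ} (hC : ∀ ω, |B ω| ≤ C) (hq : Integrable q μ) :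
    ∫ ω, B ω * q ω ∂μ = ∫ ω, B ω * (μ[q | m]) ω ∂μ := by
  have hBq : Integrable (B * q) μ :=
    hq.bdd_mul (c := C) (hB.mono hm le_rfl).aestronglyMeasurable (Filter.Eventually.of_forall hC)
  have h := condExp_mul_of_stronglyMeasurable_left (μ := μ) hB.stronglyMeasurable hBq hq
  have h2 := integral_condExp hm (μ := μ) (f := B * q)
  calc ∫ ω, B ω * q ω ∂μ = ∫ ω, (μ[B * q | m]) ω ∂μ := h2.symm
    _ = _ := integral_congr_ae h

lemma exp_le_one_add_add_sq {x : ℝ} (hx : |x| ≤ 1) : Real.exp x ≤ 1 + x + x ^ 2 := by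
  have := (abs_le.1 (Real.abs_exp_sub_one_sub_id_le hx)).2
  linarith

lemma ind_nonneg (q : Prop) : 0 ≤ ind q := by unfold ind; split_ifs <;> norm_num
lemma ind_le_one (q : Prop) : ind q ≤ 1 := by unfold ind; split_ifs <;> norm_num

/-! ### The exponential moment of one example -/

section OneStep

variable {Ω Λ 𝒳 : Type*}

open Classical in
/-- The mean contribution of an example `z` to the sum of `s`, when the query region is `R` and the
current classifier is `g`. -/
noncomputable def drift (s : 𝒳 × Bool → ℝ) (R : Set 𝒳) (g : 𝒳 → Bool) (z : 𝒳 × Bool) : ℝ :=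
  if z.1 ∈ R then s z else s (z.1, g z.1)

open Classical in
/-- The second moment of the contribution of an example `z` to the sum of `s`, when the query
region is `R`, the query probabilities are `P` and the current classifier is `g`. -/
noncomputable def spread (s : 𝒳 × Bool → ℝ) (R : Set 𝒳) (P : 𝒳 → ℝ) (g : 𝒳 → Bool)
    (z : 𝒳 × Bool) : ℝ :=
  if z.1 ∈ R then s z ^ 2 / P z.1 else s (z.1, g z.1) ^ 2

lemma abs_drift_le {s : 𝒳 × Bool → ℝ} (hs1 : ∀ z, |s z| ≤ 1) (R : Set 𝒳) (g : 𝒳 → Bool)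
    (z : 𝒳 × Bool) : |drift s R g z| ≤ 1 := by
  unfold drift; split_ifs <;> exact hs1 _

lemma spread_nonneg {s : 𝒳 × Bool → ℝ} {R : Set 𝒳} {P : 𝒳 → ℝ} (hP : ∀ x ∈ R, 0 ≤ P x)
    (g : 𝒳 → Bool) (z : 𝒳 × Bool) : 0 ≤ spread s R P g z := by
  unfold spread; split_ifs with h
  · exact div_nonneg (sq_nonneg _) (hP _ h)
  · positivity

lemma spread_le {s : 𝒳 × Bool → ℝ} (hs1 : ∀ z, |s z| ≤ 1) {R : Set 𝒳} {P : 𝒳 → ℝ} {B : ℝ}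
    (hB : 1 ≤ B) (hP : ∀ x ∈ R, 0 < P x ∧ 1 / P x ≤ B)
    (g : 𝒳 → Bool) (z : 𝒳 × Bool) : spread s R P g z ≤ B := by
  have hsq : ∀ z, s z ^ 2 ≤ 1 := fun z => (sq_le_one_iff_abs_le_one _).2 (hs1 z)
  unfold spread; split_ifs with h
  · exact (div_le_div_of_nonneg_right (hsq z) (hP _ h).1.le).trans (hP _ h).2
  · exact (hsq _).trans hB

/-- The left side is the exponential moment of `a / P` times a Bernoulli variable of parameter `P`.
The condition `l ≤ P` keeps the exponent in `[-1, 1]`, where the quadratic bound on `exp` holds; it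
is the only link between scale and query probability. -/
lemma exp_bernoulli_le {l a P : ℝ} (hl : 0 < l) (hP : l ≤ P) (ha : |a| ≤ 1) :
    1 + P * (Real.exp (l * (a / P)) - 1) ≤ 1 + l * a + l ^ 2 * (a ^ 2 / P) := by
  have hP0 : 0 < P := hl.trans_le hP
  have h1 : |l * (a / P)| ≤ 1 := by
    rw [abs_mul, abs_div, abs_of_pos hl, abs_of_pos hP0, ← mul_div_assoc, div_le_one hP0]
    nlinarith [abs_nonneg a]
  have h2 := mul_le_mul_of_nonneg_left (exp_le_one_add_add_sq h1) hP0.le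
  have h3 : P * (1 + l * (a / P) + (l * (a / P)) ^ 2) = P + l * a + l ^ 2 * (a ^ 2 / P) := by
    field_simp
  linarith

variable [mΩ : MeasurableSpace Ω] [mΛ : MeasurableSpace Λ] [MeasurableSpace 𝒳]

lemma measurable_drift {s : 𝒳 × Bool → ℝ} (hs : Measurable s) {R : Λ → Set 𝒳}
    (hR : MeasurableSet {q : Λ × 𝒳 | q.2 ∈ R q.1}) {g : Λ → 𝒳 → Bool}
    (hg : Measurable fun q : Λ × 𝒳 => g q.1 q.2) :
    Measurable fun q : Λ × (𝒳 × Bool) => drift s (R q.1) (g q.1) q.2 := by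
  have h1 : Measurable fun q : Λ × (𝒳 × Bool) => (q.1, q.2.1) := by fun_prop
  refine Measurable.ite (h1 hR) (by fun_prop) ?_
  exact hs.comp ((measurable_fst.comp measurable_snd).prodMk (hg.comp h1))

lemma measurable_spread {s : 𝒳 × Bool → ℝ} (hs : Measurable s) {R : Λ → Set 𝒳}
    (hR : MeasurableSet {q : Λ × 𝒳 | q.2 ∈ R q.1}) {g : Λ → 𝒳 → Bool}
    (hg : Measurable fun q : Λ × 𝒳 => g q.1 q.2) {P : Λ → 𝒳 → ℝ}
    (hP : Measurable fun q : Λ × 𝒳 => P q.1 q.2) :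
    Measurable fun q : Λ × (𝒳 × Bool) => spread s (R q.1) (P q.1) (g q.1) q.2 := by
  have h1 : Measurable fun q : Λ × (𝒳 × Bool) => (q.1, q.2.1) := by fun_prop
  have h2 : Measurable fun q : Λ × (𝒳 × Bool) => P q.1 q.2.1 := hP.comp h1
  refine Measurable.ite (h1 hR) (by fun_prop) ?_
  exact (hs.comp ((measurable_fst.comp measurable_snd).prodMk (hg.comp h1))).pow_const 2

open Classical in
/-- The exponential moment of the contribution of one example, conditionally on the past. The past
is described by the random variable `U`, the example is `V`, and `q` is the query decision. -/
theorem integral_mul_exp_contribution_le {μ : Measure Ω} [IsProbabilityMeasure μ]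
    {D : Measure (𝒳 × Bool)} [IsProbabilityMeasure D] {U : Ω → Λ} {V : Ω → 𝒳 × Bool} {q : Ω → Bool}
    (hU : Measurable U) (hV : Measurable V) (hq : Measurable q) (hlaw : μ.map V = D)
    (hind : IndepFun U V μ) {s : 𝒳 × Bool → ℝ} (hs : Measurable s) (hs1 : ∀ z, |s z| ≤ 1)
    {R : Λ → Set 𝒳} (hR : MeasurableSet {q : Λ × 𝒳 | q.2 ∈ R q.1}) {g : Λ → 𝒳 → Bool}
    (hg : Measurable fun q : Λ × 𝒳 => g q.1 q.2) {P : Λ → 𝒳 → ℝ}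
    (hP : Measurable fun q : Λ × 𝒳 => P q.1 q.2) {l : ℝ} (hl : 0 < l) (hl1 : l ≤ 1)
    {G : Λ → ℝ} (hG : Measurable G) (hG0 : ∀ a, 0 ≤ G a) {C : ℝ} (hGC : ∀ a, G a ≤ C)
    (hGP : ∀ a, G a ≠ 0 → ∀ x ∈ R a, l ≤ P a x)
    (hquery : ∀ᵐ ω ∂μ, (V ω).1 ∈ R (U ω) →
      (μ[fun ω' => ind (q ω' = true) | mΛ.comap U ⊔ MeasurableSpace.comap V inferInstance]) ω
        = P (U ω) (V ω).1) :
    ∫ ω, G (U ω) * Real.exp (l * (if (V ω).1 ∈ R (U ω) then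
        (if q ω = true then s (V ω) / P (U ω) (V ω).1 else 0)
        else s ((V ω).1, g (U ω) (V ω).1))) ∂μ
      ≤ ∫ ω, G (U ω) * Real.exp (l * (∫ z, drift s (R (U ω)) (g (U ω)) z ∂D)
          + l ^ 2 * ∫ z, spread s (R (U ω)) (P (U ω)) (g (U ω)) z ∂D) ∂μ := by
  have hmd := measurable_drift (Λ := Λ) hs hR hg
  have hms := measurable_spread (Λ := Λ) hs hR hg hP
  have hUV : Measurable fun ω => (U ω, V ω) := hU.prodMk hV
  obtain ⟨ω₀⟩ : Nonempty Ω := nonempty_of_isProbabilityMeasure μ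
  have hC0 : 0 ≤ C := (hG0 (U ω₀)).trans (hGC _)
  -- The integrand is affine in the query indicator, `A + B * ind (q = true)`, with `A` and `B`
  -- functions of the past and the example. Thus only the conditional mean of the indicator is
  -- needed.
  set A : Λ × (𝒳 × Bool) → ℝ := fun c =>
    G c.1 * (if c.2.1 ∈ R c.1 then 1 else Real.exp (l * s (c.2.1, g c.1 c.2.1))) with hA
  set B : Λ × (𝒳 × Bool) → ℝ := fun c =>
    G c.1 * (if c.2.1 ∈ R c.1 then Real.exp (l * (s c.2 / P c.1 c.2.1)) - 1 else 0) with hB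
  set Φ : Λ × (𝒳 × Bool) → ℝ := fun c =>
    G c.1 * (1 + l * drift s (R c.1) (g c.1) c.2 + l ^ 2 * spread s (R c.1) (P c.1) (g c.1) c.2)
    with hΦ
  have h1 : Measurable fun q : Λ × (𝒳 × Bool) => (q.1, q.2.1) := by fun_prop
  have hgm : Measurable fun q : Λ × (𝒳 × Bool) => s (q.2.1, g q.1 q.2.1) :=
    hs.comp ((measurable_fst.comp measurable_snd).prodMk (hg.comp h1))
  have hPm : Measurable fun q : Λ × (𝒳 × Bool) => P q.1 q.2.1 := hP.comp h1
  have hG' : Measurable fun q : Λ × (𝒳 × Bool) => G q.1 := hG.comp measurable_fst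
  have hAm : Measurable A :=
    hG'.mul (Measurable.ite (h1 hR) measurable_const (by fun_prop))
  have hBm : Measurable B :=
    hG'.mul (Measurable.ite (h1 hR) (by fun_prop) measurable_const)
  have hΦm : Measurable Φ := hG'.mul (by fun_prop)
  have hsmall : ∀ c : Λ × (𝒳 × Bool), G c.1 ≠ 0 → c.2.1 ∈ R c.1 → |l * (s c.2 / P c.1 c.2.1)| ≤ 1 := by
    intro c hc hcR
    have hp := hGP _ hc _ hcR
    have hP0 : 0 < P c.1 c.2.1 := hl.trans_le hp
    rw [abs_mul, abs_div, abs_of_pos hl, abs_of_pos hP0, ← mul_div_assoc, div_le_one hP0]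
    nlinarith [abs_nonneg (s c.2), hs1 c.2]
  have hsmall' : ∀ z, |l * s z| ≤ 1 := by
    intro z
    rw [abs_mul, abs_of_pos hl]
    nlinarith [abs_nonneg (s z), hs1 z]
  have hexp3 : ∀ x : ℝ, |x| ≤ 1 → Real.exp x ≤ 3 := fun x hx => by
    have := exp_le_one_add_add_sq hx
    nlinarith [abs_le.1 hx]
  have hAC : ∀ c, |A c| ≤ C * 3 := by
    intro c
    rw [hA]; simp only
    rw [abs_mul, abs_of_nonneg (hG0 _)]
    refine mul_le_mul (hGC _) ?_ (abs_nonneg _) hC0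
    split_ifs
    · norm_num
    · rw [abs_of_pos (Real.exp_pos _)]; exact hexp3 _ (hsmall' _)
  have hBC : ∀ c, |B c| ≤ C * 3 := by
    intro c
    rw [hB]; simp only
    by_cases h0 : G c.1 = 0
    · simp [h0, hC0]
    rw [abs_mul, abs_of_nonneg (hG0 _)]
    refine mul_le_mul (hGC _) ?_ (abs_nonneg _) hC0
    split_ifs with hc
    · have := hexp3 _ (hsmall c h0 hc)
      have := Real.exp_pos (l * (s c.2 / P c.1 c.2.1))
      rw [abs_le]; constructor <;> linarith
    · norm_num
  -- Where `G` does not vanish, `spread ≤ 1 / l`, so `l ^ 2 * spread ≤ l ≤ 1` and the second factor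
  -- of `Φ` has absolute value at most `3`.
  have hΦC : ∀ c, |Φ c| ≤ C * 3 := by
    intro c
    rw [hΦ]; simp only
    by_cases h0 : G c.1 = 0
    · simp [h0, hC0]
    rw [abs_mul, abs_of_nonneg (hG0 _)]
    refine mul_le_mul (hGC _) ?_ (abs_nonneg _) hC0
    have hd := abs_le.1 (abs_drift_le hs1 (R c.1) (g c.1) c.2)
    have hp : ∀ x ∈ R c.1, 0 < P c.1 x ∧ 1 / P c.1 x ≤ 1 / l := fun x hx =>
      ⟨hl.trans_le (hGP _ h0 x hx), one_div_le_one_div_of_le hl (hGP _ h0 x hx)⟩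
    have hs2 := spread_le hs1 (one_le_one_div hl hl1) hp (g c.1) c.2
    have hs3 := spread_nonneg (s := s) (fun x hx => (hp x hx).1.le) (g c.1) c.2
    have hl2 : l ^ 2 * spread s (R c.1) (P c.1) (g c.1) c.2 ≤ l := by
      calc _ ≤ l ^ 2 * (1 / l) := by gcongr
        _ = l := by field_simp
    have hl3 : 0 ≤ l ^ 2 * spread s (R c.1) (P c.1) (g c.1) c.2 := by positivity
    rw [abs_le]; constructor <;> nlinarith
  have hbdd : ∀ {f : Ω → ℝ}, Measurable f → (∀ ω, |f ω| ≤ C * 3) → Integrable f μ :=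
    fun hf h => Integrable.of_bound hf.aestronglyMeasurable (C * 3) (Filter.Eventually.of_forall h)
  have hAi : Integrable (fun ω => A (U ω, V ω)) μ := hbdd (hAm.comp hUV) fun ω => hAC _
  have hΦi : Integrable (fun ω => Φ (U ω, V ω)) μ := hbdd (hΦm.comp hUV) fun ω => hΦC _
  have hqm : Measurable fun ω => ind (q ω = true) :=
    Measurable.ite (hq (measurableSet_singleton true)) measurable_const measurable_const
  have hqi : Integrable (fun ω => ind (q ω = true)) μ :=
    Integrable.of_bound hqm.aestronglyMeasurable 1 (Filter.Eventually.of_forall fun ω => by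
      rw [Real.norm_eq_abs, abs_of_nonneg (ind_nonneg _)]; exact ind_le_one _)
  have hBqi : Integrable (fun ω => B (U ω, V ω) * ind (q ω = true)) μ :=
    hqi.bdd_mul (c := C * 3) (hBm.comp hUV).aestronglyMeasurable
      (Filter.Eventually.of_forall fun ω => hBC _)
  have hle : mΛ.comap U ⊔ MeasurableSpace.comap V inferInstance ≤ mΩ :=
    sup_le hU.comap_le hV.comap_le
  have hBG : Measurable[mΛ.comap U ⊔ MeasurableSpace.comap V inferInstance]
      fun ω => B (U ω, V ω) := by
    refine hBm.comp (Measurable.prodMk ?_ ?_)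
    · exact (comap_measurable U).mono le_sup_left le_rfl
    · exact (comap_measurable V).mono le_sup_right le_rfl
  have hcond := integral_mul_condExp_eq hle hBG (fun ω => hBC _) hqi
  have hBci : Integrable (fun ω => B (U ω, V ω) *
      (μ[fun ω' => ind (q ω' = true) | mΛ.comap U ⊔ MeasurableSpace.comap V inferInstance]) ω) μ :=
    integrable_condExp.bdd_mul (c := C * 3) (hBm.comp hUV).aestronglyMeasurable
      (Filter.Eventually.of_forall fun ω => hBC _)
  calc _ = ∫ ω, (A (U ω, V ω) + B (U ω, V ω) * ind (q ω = true)) ∂μ := by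
        refine integral_congr_ae (Filter.Eventually.of_forall fun ω => ?_)
        simp only [hA, hB, ind]
        split_ifs <;> (simp; try ring)
    _ = ∫ ω, (A (U ω, V ω) + B (U ω, V ω) *
      (μ[fun ω' => ind (q ω' = true) | mΛ.comap U ⊔ MeasurableSpace.comap V inferInstance]) ω) ∂μ := by
        rw [integral_add hAi hBqi, integral_add hAi hBci, hcond]
    _ ≤ ∫ ω, Φ (U ω, V ω) ∂μ := by
        refine integral_mono_ae (hAi.add hBci) hΦi ?_
        filter_upwards [hquery] with ω hω
        simp only [hA, hB, hΦ]
        by_cases h0 : G (U ω) = 0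
        · simp [h0]
        by_cases hR : (V ω).1 ∈ R (U ω)
        · rw [hω hR]
          have := exp_bernoulli_le hl (hGP _ h0 _ hR) (hs1 (V ω))
          simp only [if_pos hR, drift, spread]
          calc _ = G (U ω) * (1 + P (U ω) (V ω).1 *
                (Real.exp (l * (s (V ω) / P (U ω) (V ω).1)) - 1)) := by ring
            _ ≤ _ := mul_le_mul_of_nonneg_left this (hG0 _)
        · simp only [if_neg hR, drift, spread, mul_zero, zero_mul, add_zero]
          refine mul_le_mul_of_nonneg_left ?_ (hG0 _)
          have := exp_le_one_add_add_sq (hsmall' ((V ω).1, g (U ω) (V ω).1))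
          rwa [mul_pow] at this
    _ = ∫ ω, ∫ z, Φ (U ω, z) ∂D ∂μ :=
        integral_comp_prodMk_of_indepFun hU hV hlaw hind hΦm hΦC
    _ ≤ _ := by
        have hmd' : Measurable fun a : Λ => ∫ z, drift s (R a) (g a) z ∂D :=
          hmd.stronglyMeasurable.integral_prod_right'.measurable
        have hms' : Measurable fun a : Λ => ∫ z, spread s (R a) (P a) (g a) z ∂D :=
          hms.stronglyMeasurable.integral_prod_right'.measurable
        have hdi : ∀ a, Integrable (drift s (R a) (g a)) D := fun a =>
          Integrable.of_bound (hmd.comp measurable_prodMk_left).aestronglyMeasurable 1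
            (Filter.Eventually.of_forall (abs_drift_le hs1 _ _))
        have hp : ∀ a, G a ≠ 0 → ∀ x ∈ R a, 0 < P a x ∧ 1 / P a x ≤ 1 / l := fun a h0 x hx =>
          ⟨hl.trans_le (hGP _ h0 x hx), one_div_le_one_div_of_le hl (hGP _ h0 x hx)⟩
        have hsi : ∀ a, G a ≠ 0 → Integrable (spread s (R a) (P a) (g a)) D := fun a h0 =>
          Integrable.of_bound (hms.comp measurable_prodMk_left).aestronglyMeasurable (1 / l)
            (Filter.Eventually.of_forall fun z => by
              rw [Real.norm_eq_abs,
                abs_of_nonneg (spread_nonneg (fun x hx => (hp a h0 x hx).1.le) _ _)]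
              exact spread_le hs1 (one_le_one_div hl hl1) (hp a h0) _ _)
        have hval : ∀ a, ∫ z, Φ (a, z) ∂D = G a * (1 + l * (∫ z, drift s (R a) (g a) z ∂D)
          + l ^ 2 * ∫ z, spread s (R a) (P a) (g a) z ∂D) := by
          intro a
          simp only [hΦ]
          rw [integral_const_mul]
          by_cases h0 : G a = 0
          · simp [h0]
          congr 1
          rw [integral_add, integral_add, integral_const_mul, integral_const_mul]
          · simp
          · exact integrable_const _
          · exact (hdi a).const_mul _
          · exact (integrable_const _).add ((hdi a).const_mul _)
          · exact (hsi a h0).const_mul _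
        -- The inequality `1 + x ≤ exp x` is used only after averaging over the example, so that the
        -- exponent contains the mean and the second moment themselves.
        have hpt : ∀ a, G a * (1 + l * (∫ z, drift s (R a) (g a) z ∂D)
          + l ^ 2 * ∫ z, spread s (R a) (P a) (g a) z ∂D) ≤
          G a * Real.exp (l * (∫ z, drift s (R a) (g a) z ∂D)
          + l ^ 2 * ∫ z, spread s (R a) (P a) (g a) z ∂D) := by
          intro a
          refine mul_le_mul_of_nonneg_left ?_ (hG0 _)
          have := Real.add_one_le_exp (l * (∫ z, drift s (R a) (g a) z ∂D)
            + l ^ 2 * ∫ z, spread s (R a) (P a) (g a) z ∂D)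
          linarith
        have hd1 : ∀ a, ∫ z, drift s (R a) (g a) z ∂D ≤ 1 := fun a => by
          have := norm_integral_le_of_norm_le_const (μ := D) (f := drift s (R a) (g a)) (C := 1)
            (Filter.Eventually.of_forall (abs_drift_le hs1 _ _))
          exact (le_abs_self _).trans (by simpa using this)
        have hs1' : ∀ a, G a ≠ 0 → ∫ z, spread s (R a) (P a) (g a) z ∂D ≤ 1 / l := fun a h0 => by
          calc _ ≤ ∫ _, 1 / l ∂D := integral_mono (hsi a h0) (integrable_const _)
                (spread_le hs1 (one_le_one_div hl hl1) (hp a h0) _)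
            _ = 1 / l := by simp
        have hdU := hmd'.comp hU
        have hsU := hms'.comp hU
        have hGU := hG.comp hU
        simp_rw [hval]
        refine integral_mono ?_ ?_ fun ω => hpt (U ω)
        · refine Integrable.of_bound (C := C * 3) (Measurable.aestronglyMeasurable ?_)
            (Filter.Eventually.of_forall fun ω => ?_)
          · exact hGU.mul (((hdU.const_mul l).const_add 1).add (hsU.const_mul (l ^ 2)))
          · rw [← hval]
            simpa using norm_integral_le_of_norm_le_const (μ := D) (f := fun z => Φ (U ω, z))
              (C := C * 3) (Filter.Eventually.of_forall fun z => hΦC (U ω, z))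
        · refine Integrable.of_bound (C := C * Real.exp 2) (Measurable.aestronglyMeasurable ?_)
            (Filter.Eventually.of_forall fun ω => ?_)
          · exact hGU.mul ((hdU.const_mul l).add (hsU.const_mul (l ^ 2))).exp
          · rw [Real.norm_eq_abs, abs_of_nonneg (mul_nonneg (hG0 _) (Real.exp_pos _).le)]
            by_cases h0 : G (U ω) = 0
            · simp only [h0, zero_mul]; positivity
            refine mul_le_mul (hGC _) (Real.exp_le_exp.2 ?_) (Real.exp_pos _).le hC0
            have e1 : l * (∫ z, drift s (R (U ω)) (g (U ω)) z ∂D) ≤ 1 * 1 :=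
              (mul_le_mul_of_nonneg_left (hd1 _) hl.le).trans (by linarith)
            have e2 : l ^ 2 * (∫ z, spread s (R (U ω)) (P (U ω)) (g (U ω)) z ∂D) ≤ 1 :=
              (mul_le_mul_of_nonneg_left (hs1' _ h0) (by positivity)).trans (by
                rw [pow_two, mul_assoc, mul_one_div_cancel hl.ne']; linarith)
            linarith

end OneStep

/-! ### Weighted sums and contributions of single examples -/

section Totals

variable {Ω 𝒳 : Type*}

/-- The importance weighted sum of `s` over a multiset of triples (point, label, weight). -/
noncomputable def weightedSum (s : 𝒳 × Bool → ℝ) (S : Multiset (𝒳 × Bool × ℝ)) : ℝ :=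
  (S.map fun z => z.2.2 * s (z.1, z.2.1)).sum

/-- The indicator that `f` errs on a labeled example. -/
noncomputable def loss (f : 𝒳 → Bool) (z : 𝒳 × Bool) : ℝ := ind (f z.1 ≠ z.2)

lemma empErr_eq (f : 𝒳 → Bool) (S : Multiset (𝒳 × Bool × ℝ)) :
    empErr f S = weightedSum (loss f) S / (Multiset.card S : ℝ) := rfl

lemma weightedSum_sub (s s' : 𝒳 × Bool → ℝ) (S : Multiset (𝒳 × Bool × ℝ)) :
    weightedSum (fun z => s z - s' z) S = weightedSum s S - weightedSum s' S := by
  simp [weightedSum, mul_sub]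

lemma weightedSum_neg (s : 𝒳 × Bool → ℝ) (S : Multiset (𝒳 × Bool × ℝ)) :
    weightedSum (fun z => - s z) S = - weightedSum s S := by
  simp [weightedSum]

namespace Trace

variable (T : Trace Ω 𝒳) (p : Params) (H : Finset (𝒳 → Bool))

open Classical in
/-- The contribution of example `i`, in epoch `m`, to the weighted sum of `s`. -/
noncomputable def contribution (s : 𝒳 × Bool → ℝ) (m : ℕ) (ω : Ω) (i : ℕ) : ℝ :=
  if T.X i ω ∈ T.region p H m ω then
    (if T.Q i ω = true then s (T.X i ω, T.Y i ω) / T.P m ω (T.X i ω) else 0)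
  else s (T.X i ω, T.h m ω (T.X i ω))

lemma Z_succ (ω : Ω) (m : ℕ) : T.Z p H ω (m + 1) = T.Z p H ω m +
    (Finset.Ioc (p.τ m) (p.τ (m + 1))).val.map (T.record (m + 1) (T.region p H (m + 1) ω) ω) :=
  rfl

lemma weightedSum_Z_succ (s : 𝒳 × Bool → ℝ) (ω : Ω) (m : ℕ) :
    weightedSum s (T.Z p H ω (m + 1)) = weightedSum s (T.Z p H ω m) +
      ∑ i ∈ Finset.Ioc (p.τ m) (p.τ (m + 1)), T.contribution p H s (m + 1) ω i := by
  rw [Z_succ, weightedSum, Multiset.map_add, Multiset.sum_add, Multiset.map_map]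
  refine congrArg (_ + ·) ?_
  refine congrArg Multiset.sum (Multiset.map_congr rfl fun i _ => ?_)
  simp only [Function.comp, record, contribution]
  split_ifs
  · rw [one_div_mul_eq_div]
  · rw [zero_mul]
  · rw [one_mul]

/-- Examples that are not queried are recorded with weight zero instead of being dropped, so the
size of the sample is not random. -/
lemma card_Z (h0 : p.τ 0 = 0) (ω : Ω) : ∀ m, (∀ j < m, p.τ j ≤ p.τ (j + 1)) →
    Multiset.card (T.Z p H ω m) = p.τ m
  | 0, _ => by simp [Z, h0]
  | m + 1, h => by
    rw [Z_succ, Multiset.card_add, card_Z h0 ω m fun j hj => h j (by omega), Multiset.card_map]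
    have := h m (by omega)
    simp
    omega

/-- A lower bound for the query probabilities of epoch `m` on the disagreement region. -/
noncomputable def pLow (m : ℕ) (ω : Ω) : ℝ := if m ≤ 1 then 1 else T.pMin p H m ω

variable [MeasurableSpace 𝒳] (D : Measure (𝒳 × Bool))

/-- The mean of the contribution of an example of epoch `m` to the weighted sum of `s`. -/
noncomputable def mean (s : 𝒳 × Bool → ℝ) (m : ℕ) (ω : Ω) : ℝ :=
  ∫ z, drift s (T.region p H m ω) (T.h m ω) z ∂D

/-- The second moment of the contribution of an example of epoch `m` to the weighted sum of `s`. -/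
noncomputable def moment (s : 𝒳 × Bool → ℝ) (m : ℕ) (ω : Ω) : ℝ :=
  ∫ z, spread s (T.region p H m ω) (T.P m ω) (T.h m ω) z ∂D

end Trace

end Totals

lemma Params.Admissible.mono {p : Params} {N : ℕ} (hp : p.Admissible N) {i j : ℕ} (hij : i ≤ j)
    (hj : j ≤ p.M) : p.τ i ≤ p.τ j := by
  induction j, hij using Nat.le_induction with
  | base => exact le_rfl
  | succ k hk ih => exact (ih (by omega)).trans (hp.τ_lt k (by omega)).le

lemma Params.Admissible.lt_n {p : Params} {N : ℕ} (hp : p.Admissible N) {m i : ℕ} (hm : m < p.M)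
    (hi : i < p.τ (m + 1)) : i < p.n :=
  hi.trans_le ((hp.mono hm le_rfl).trans hp.τ_le_n)

lemma Params.Admissible.card_Z {Ω 𝒳 : Type*} {T : Trace Ω 𝒳} {p : Params} {H : Finset (𝒳 → Bool)}
    (hp : p.Admissible H.card) {m : ℕ} (hm : m ≤ p.M) (ω : Ω) :
    Multiset.card (T.Z p H ω m) = p.τ m :=
  T.card_Z p H hp.τ_zero ω m fun j hj => (hp.τ_lt j (by omega)).le

/-! ### Measurability with respect to the past -/

section Measurability

/-- A random element of a finite set with measurable level sets splits any quantity depending on it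
into a finite sum over its values. -/
lemma measurable_finset_cases {Λ F : Type*} {mΛ : MeasurableSpace Λ} {H : Finset F} {h : Λ → F}
    (hmem : ∀ a, h a ∈ H) (hmeas : ∀ f ∈ H, MeasurableSet {a | h a = f}) {φ : F → Λ → ℝ}
    (hφ : ∀ f ∈ H, Measurable (φ f)) : Measurable fun a => φ (h a) a := by
  classical
  have : (fun a => φ (h a) a) = fun a => ∑ f ∈ H, if h a = f then φ f a else 0 := by
    funext a
    rw [Finset.sum_ite_eq, if_pos (hmem a)]
  rw [this]
  exact Finset.measurable_fun_sum _ fun f hf => Measurable.ite (hmeas f hf) (hφ f hf) measurable_const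

lemma measurable_eval_finset {Λ 𝒳 : Type*} {mΛ : MeasurableSpace Λ} {m𝒳 : MeasurableSpace 𝒳}
    {H : Finset (𝒳 → Bool)} (hH : ∀ f ∈ H, Measurable f) {h : Λ → 𝒳 → Bool}
    (hmem : ∀ a, h a ∈ H) (hmeas : ∀ f ∈ H, MeasurableSet {a | h a = f}) :
    Measurable fun q : Λ × 𝒳 => h q.1 q.2 := by
  refine measurable_to_bool ?_
  have : (fun q : Λ × 𝒳 => h q.1 q.2) ⁻¹' {true} =
      ⋃ f ∈ H, {a | h a = f} ×ˢ (f ⁻¹' {true}) := by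
    ext ⟨a, x⟩
    simp only [Set.mem_preimage, Set.mem_singleton_iff, Set.mem_iUnion, Set.mem_prod,
      Set.mem_ofPred_eq, exists_prop]
    constructor
    · exact fun hx => ⟨h a, hmem a, rfl, hx⟩
    · rintro ⟨f, _, rfl, hx⟩
      exact hx
  rw [this]
  exact Finset.measurableSet_biUnion _ fun f hf =>
    (hmeas f hf).prod (hH f hf (measurableSet_singleton true))

lemma measurableSet_disagreement {Λ 𝒳 : Type*} {mΛ : MeasurableSpace Λ} {m𝒳 : MeasurableSpace 𝒳}
    {H : Finset (𝒳 → Bool)} (hH : ∀ f ∈ H, Measurable f) {A : Λ → Set (𝒳 → Bool)}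
    (hA : ∀ a, A a ⊆ H) (hmeas : ∀ f ∈ H, MeasurableSet {a | f ∈ A a}) :
    MeasurableSet {q : Λ × 𝒳 | q.2 ∈ disagreement (A q.1)} := by
  have : {q : Λ × 𝒳 | q.2 ∈ disagreement (A q.1)} =
      ⋃ f ∈ H, ⋃ f' ∈ H, ({a | f ∈ A a} ∩ {a | f' ∈ A a}) ×ˢ {x | f x ≠ f' x} := by
    ext ⟨a, x⟩
    simp only [disagreement, Set.mem_ofPred_eq, Set.mem_iUnion, Set.mem_prod, Set.mem_inter_iff,
      exists_prop]
    constructor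
    · rintro ⟨f, hf, f', hf', hx⟩
      exact ⟨f, hA a hf, f', hA a hf', ⟨hf, hf'⟩, hx⟩
    · rintro ⟨f, -, f', -, ⟨hf, hf'⟩, hx⟩
      exact ⟨f, hf, f', hf', hx⟩
  rw [this]
  refine Finset.measurableSet_biUnion _ fun f hf => Finset.measurableSet_biUnion _ fun f' hf' => ?_
  exact ((hmeas f hf).inter (hmeas f' hf')).prod
    (measurableSet_eq_fun (hH f hf) (hH f' hf')).compl

lemma measurable_integral_drift {Λ 𝒳 : Type*} {mΛ : MeasurableSpace Λ} {m𝒳 : MeasurableSpace 𝒳}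
    (D : Measure (𝒳 × Bool)) [SFinite D] {s : 𝒳 × Bool → ℝ} (hs : Measurable s) {R : Λ → Set 𝒳}
    (hR : MeasurableSet {q : Λ × 𝒳 | q.2 ∈ R q.1}) {g : Λ → 𝒳 → Bool}
    (hg : Measurable fun q : Λ × 𝒳 => g q.1 q.2) :
    Measurable fun a => ∫ z, drift s (R a) (g a) z ∂D :=
  (measurable_drift hs hR hg).stronglyMeasurable.integral_prod_right'.measurable

lemma measurable_integral_spread {Λ 𝒳 : Type*} {mΛ : MeasurableSpace Λ} {m𝒳 : MeasurableSpace 𝒳}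
    (D : Measure (𝒳 × Bool)) [SFinite D] {s : 𝒳 × Bool → ℝ} (hs : Measurable s) {R : Λ → Set 𝒳}
    (hR : MeasurableSet {q : Λ × 𝒳 | q.2 ∈ R q.1}) {g : Λ → 𝒳 → Bool}
    (hg : Measurable fun q : Λ × 𝒳 => g q.1 q.2) {P : Λ → 𝒳 → ℝ}
    (hP : Measurable fun q : Λ × 𝒳 => P q.1 q.2) :
    Measurable fun a => ∫ z, spread s (R a) (P a) (g a) z ∂D :=
  (measurable_spread hs hR hg hP).stronglyMeasurable.integral_prod_right'.measurable

lemma measurable_loss {𝒳 : Type*} [MeasurableSpace 𝒳] {f : 𝒳 → Bool} (hf : Measurable f) :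
    Measurable (loss f) :=
  Measurable.ite (measurableSet_eq_fun (hf.comp measurable_fst) measurable_snd).compl
    measurable_const measurable_const

lemma measurable_threshold (p : Params) (N m : ℕ) : Measurable (p.threshold N m) := by
  unfold Params.threshold
  split_ifs <;> fun_prop

lemma prod_mono_left {Λ 𝒳 : Type*} {m₁ m₂ : MeasurableSpace Λ} (m𝒳 : MeasurableSpace 𝒳)
    (h : m₁ ≤ m₂) : m₁.prod m𝒳 ≤ m₂.prod m𝒳 :=
  sup_le_sup_right (MeasurableSpace.comap_mono h) _

open Classical in
lemma measurable_contribution_aux {Λ 𝒳 : Type*} {mΛ : MeasurableSpace Λ} {m𝒳 : MeasurableSpace 𝒳}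
    {s : 𝒳 × Bool → ℝ} (hs : Measurable s) {X : Λ → 𝒳} {Y Q : Λ → Bool} (hX : Measurable X)
    (hY : Measurable Y) (hQ : Measurable Q)
    {R : Λ → Set 𝒳} (hR : MeasurableSet {q : Λ × 𝒳 | q.2 ∈ R q.1}) {g : Λ → 𝒳 → Bool}
    (hg : Measurable fun q : Λ × 𝒳 => g q.1 q.2) {P : Λ → 𝒳 → ℝ}
    (hP : Measurable fun q : Λ × 𝒳 => P q.1 q.2) :
    Measurable fun a => if X a ∈ R a then (if Q a = true then s (X a, Y a) / P a (X a) else 0)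
      else s (X a, g a (X a)) := by
  have hX' : Measurable fun a => (a, X a) := measurable_id.prodMk hX
  have hP' : Measurable fun a => P a (X a) := hP.comp hX'
  have hg' : Measurable fun a => g a (X a) := hg.comp hX'
  refine Measurable.ite (hX' hR) (Measurable.ite (hQ (measurableSet_singleton true)) ?_ ?_) ?_
  · fun_prop
  · fun_prop
  · fun_prop

variable {Ω 𝒳 : Type*} [mΩ : MeasurableSpace Ω] [m𝒳 : MeasurableSpace 𝒳]
  {μ : Measure Ω} {ℱ : Filtration ℕ mΩ} {D : Measure (𝒳 × Bool)} {p : Params}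
  {H : Finset (𝒳 → Bool)} {T : Trace Ω 𝒳}

namespace IsRun

lemma measurable_h (hT : IsRun μ ℱ D p H T) (hH : ∀ f ∈ H, Measurable f) {m : ℕ}
    (hm : m ≤ p.M) :
    Measurable[(ℱ (p.τ m) : MeasurableSpace Ω).prod m𝒳] fun q : Ω × 𝒳 => T.h (m + 1) q.1 q.2 :=
  measurable_eval_finset hH (hT.erm_mem m hm) (hT.erm_measurable m hm)

lemma measurable_empErr_h (hT : IsRun μ ℱ D p H T) {m : ℕ} (hm : m ≤ p.M)
    (hZ : ∀ f ∈ H, Measurable[ℱ (p.τ m)] fun ω => empErr f (T.Z p H ω m)) :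
    Measurable[ℱ (p.τ m)] fun ω => empErr (T.h (m + 1) ω) (T.Z p H ω m) :=
  measurable_finset_cases (φ := fun f ω => empErr f (T.Z p H ω m)) (hT.erm_mem m hm)
    (hT.erm_measurable m hm) hZ

lemma measurableSet_region_aux (hT : IsRun μ ℱ D p H T) (hH : ∀ f ∈ H, Measurable f) {m : ℕ}
    (hm : m ≤ p.M) (hZ : ∀ f ∈ H, Measurable[ℱ (p.τ m)] fun ω => empErr f (T.Z p H ω m)) :
    MeasurableSet[(ℱ (p.τ m) : MeasurableSpace Ω).prod m𝒳]
      {q : Ω × 𝒳 | q.2 ∈ T.region p H (m + 1) q.1} := by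
  refine measurableSet_disagreement hH (fun ω f hf => hf.1) fun f hf => ?_
  have h1 := hT.measurable_empErr_h hm hZ
  have h2 : Measurable[ℱ (p.τ m)] fun ω => T.Delta p H m ω :=
    (measurable_threshold p H.card m).comp h1
  have h3 : {ω | f ∈ T.A p H (m + 1) ω} = {ω | empErr f (T.Z p H ω m) -
      empErr (T.h (m + 1) ω) (T.Z p H ω m) ≤ p.γ * T.Delta p H m ω} := by
    ext ω
    exact and_iff_right hf
  rw [h3]
  exact @measurableSet_le _ _ _ _ _ (ℱ (p.τ m)) _ _ _ _ _ ((hZ f hf).sub h1) (h2.const_mul p.γ)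

lemma measurable_contribution (hT : IsRun μ ℱ D p H T) (hp : p.Admissible H.card)
    (hH : ∀ f ∈ H, Measurable f) {m : ℕ}
    (hm : m < p.M) (hZ : ∀ f ∈ H, Measurable[ℱ (p.τ m)] fun ω => empErr f (T.Z p H ω m))
    {s : 𝒳 × Bool → ℝ} (hs : Measurable s) {i : ℕ} (hi : p.τ m ≤ i) (hi' : i < p.τ (m + 1)) :
    Measurable[ℱ (i + 1)] fun ω => T.contribution p H s (m + 1) ω (i + 1) := by
  have hn := hp.lt_n hm hi'
  have hle := prod_mono_left m𝒳 (ℱ.mono (show p.τ m ≤ i + 1 by omega))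
  exact @measurable_contribution_aux _ _ (ℱ (i + 1)) _ s hs _ _ _ (hT.X_adapted i hn)
    (hT.Y_adapted i hn) (hT.Q_adapted i hn) _ (hle _ (hT.measurableSet_region_aux hH hm.le hZ)) _
    ((hT.measurable_h hH hm.le).mono hle le_rfl) _ ((hT.prob_measurable m hm).mono hle le_rfl)

lemma measurable_empErr_of_weightedSum (hp : p.Admissible H.card) (hH : ∀ f ∈ H, Measurable f)
    {m : ℕ} (hm : m ≤ p.M) (hZ : ∀ s : 𝒳 × Bool → ℝ, Measurable s →
      Measurable[ℱ (p.τ m)] fun ω => weightedSum s (T.Z p H ω m)) :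
    ∀ f ∈ H, Measurable[ℱ (p.τ m)] fun ω => empErr f (T.Z p H ω m) := by
  intro f hf
  simp_rw [empErr_eq, hp.card_Z hm]
  exact (hZ _ (measurable_loss (hH f hf))).div_const _

/-- The induction runs over all measurable `s` at once: the region of the next epoch depends on the
empirical errors of every classifier in `H`. -/
lemma measurable_weightedSum (hT : IsRun μ ℱ D p H T) (hp : p.Admissible H.card)
    (hH : ∀ f ∈ H, Measurable f) : ∀ m, m ≤ p.M → ∀ s : 𝒳 × Bool → ℝ, Measurable s →
      Measurable[ℱ (p.τ m)] fun ω => weightedSum s (T.Z p H ω m)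
  | 0, _, s, _ => by
    simp only [Trace.Z, weightedSum, Multiset.map_zero, Multiset.sum_zero]
    exact measurable_const
  | m + 1, hm, s, hs => by
    have ih := measurable_weightedSum hT hp hH m (by omega)
    simp_rw [Trace.weightedSum_Z_succ]
    refine ((ih s hs).mono (ℱ.mono (hp.mono m.le_succ hm)) le_rfl).add ?_
    refine Finset.measurable_fun_sum _ fun i hi => ?_
    obtain ⟨h1, h2⟩ := Finset.mem_Ioc.1 hi
    obtain ⟨k, rfl⟩ : ∃ k, i = k + 1 := ⟨i - 1, by omega⟩
    exact (hT.measurable_contribution hp hH (by omega)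
      (measurable_empErr_of_weightedSum hp hH (by omega) ih) hs (by omega) (by omega)).mono
        (ℱ.mono h2) le_rfl

lemma measurable_empErr (hT : IsRun μ ℱ D p H T) (hp : p.Admissible H.card)
    (hH : ∀ f ∈ H, Measurable f) {m : ℕ} (hm : m ≤ p.M) :
    ∀ f ∈ H, Measurable[ℱ (p.τ m)] fun ω => empErr f (T.Z p H ω m) :=
  measurable_empErr_of_weightedSum hp hH hm (hT.measurable_weightedSum hp hH m hm)

lemma measurableSet_region (hT : IsRun μ ℱ D p H T) (hp : p.Admissible H.card)
    (hH : ∀ f ∈ H, Measurable f) {m : ℕ} (hm : m ≤ p.M) :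
    MeasurableSet[(ℱ (p.τ m) : MeasurableSpace Ω).prod m𝒳]
      {q : Ω × 𝒳 | q.2 ∈ T.region p H (m + 1) q.1} :=
  hT.measurableSet_region_aux hH hm (hT.measurable_empErr hp hH hm)

lemma measurable_pLow (hT : IsRun μ ℱ D p H T) (hp : p.Admissible H.card)
    (hH : ∀ f ∈ H, Measurable f) {m : ℕ} (hm : m ≤ p.M) :
    Measurable[ℱ (p.τ m)] fun ω => T.pLow p H (m + 1) ω := by
  have h := hT.measurable_empErr_h hm (hT.measurable_empErr hp hH hm)
  unfold Trace.pLow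
  split_ifs
  · exact measurable_const
  · have h2 : Measurable fun e : ℝ => min (p.c₃ / (√(p.τ m * e / (p.n * p.eps H.card p.M))
      + Real.log (p.τ m))) (1 / 2) := by fun_prop
    exact h2.comp h

lemma measurable_mean (hT : IsRun μ ℱ D p H T) (hp : p.Admissible H.card)
    (hH : ∀ f ∈ H, Measurable f) [SFinite D] {m : ℕ} (hm : m ≤ p.M) {s : 𝒳 × Bool → ℝ}
    (hs : Measurable s) : Measurable[ℱ (p.τ m)] fun ω => T.mean p H D s (m + 1) ω :=
  measurable_integral_drift D hs (hT.measurableSet_region hp hH hm) (hT.measurable_h hH hm)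

lemma measurable_moment (hT : IsRun μ ℱ D p H T) (hp : p.Admissible H.card)
    (hH : ∀ f ∈ H, Measurable f) [SFinite D] {m : ℕ} (hm : m < p.M) {s : 𝒳 × Bool → ℝ}
    (hs : Measurable s) : Measurable[ℱ (p.τ m)] fun ω => T.moment p H D s (m + 1) ω :=
  measurable_integral_spread D hs (hT.measurableSet_region hp hH hm.le)
    (hT.measurable_h hH hm.le) (hT.prob_measurable m hm)

lemma pLow_le (hT : IsRun μ ℱ D p H T) {m : ℕ} (hm : m < p.M) (ω : Ω) (x : 𝒳)
    (hx : x ∈ T.region p H (m + 1) ω) : T.pLow p H (m + 1) ω ≤ T.P (m + 1) ω x := by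
  unfold Trace.pLow
  split_ifs with h
  · obtain rfl : m = 0 := by omega
    rw [hT.prob_one]
  · exact (hT.prob_solution (m + 1) (by omega) (by omega) ω).1.lower x hx

end IsRun

end Measurability

/-! ### The exponential supermartingale -/

section Supermartingale

/-- `F` is a nonnegative bounded random variable, measurable with respect to `m`, of mean at most
one. -/
structure SubUnit {Ω : Type*} [mΩ : MeasurableSpace Ω] (μ : Measure Ω) (m : MeasurableSpace Ω)
    (F : Ω → ℝ) : Prop where
  measurable : Measurable[m] F
  nonneg : ∀ ω, 0 ≤ F ω
  bounded : ∃ C, ∀ ω, F ω ≤ C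
  integral_le : ∫ ω, F ω ∂μ ≤ 1

lemma SubUnit.measure_exp_le {Ω : Type*} {m : MeasurableSpace Ω} [mΩ : MeasurableSpace Ω]
    {μ : Measure Ω} [IsProbabilityMeasure μ] (hm : m ≤ mΩ) {F : Ω → ℝ}
    (hF : SubUnit μ m F) (u : ℝ) : μ.real {ω | Real.exp u ≤ F ω} ≤ Real.exp (-u) := by
  obtain ⟨C, hC⟩ := hF.bounded
  have hi : Integrable F μ := Integrable.of_bound (hF.measurable.mono hm le_rfl).aestronglyMeasurable
    C (Filter.Eventually.of_forall fun ω => by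
      rw [Real.norm_eq_abs, abs_of_nonneg (hF.nonneg ω)]; exact hC ω)
  have h := mul_meas_ge_le_integral_of_nonneg (Filter.Eventually.of_forall hF.nonneg) hi (Real.exp u)
  rw [Real.exp_neg, ← one_div, le_div_iff₀ (Real.exp_pos u), mul_comm]
  exact h.trans hF.integral_le

lemma neg_one_le_mean {Ω 𝒳 : Type*} [MeasurableSpace 𝒳] {D : Measure (𝒳 × Bool)}
    [IsProbabilityMeasure D] {p : Params} {H : Finset (𝒳 → Bool)} {T : Trace Ω 𝒳}
    {s : 𝒳 × Bool → ℝ} (hs1 : ∀ z, |s z| ≤ 1)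
    (m : ℕ) (ω : Ω) :
    -1 ≤ T.mean p H D s m ω := by
  have := norm_integral_le_of_norm_le_const (μ := D)
    (f := drift s (T.region p H m ω) (T.h m ω)) (C := 1)
    (Filter.Eventually.of_forall (abs_drift_le hs1 _ _))
  rw [probReal_univ, mul_one] at this
  exact (abs_le.1 this).1

variable {Ω 𝒳 : Type*} [mΩ : MeasurableSpace Ω] [m𝒳 : MeasurableSpace 𝒳]
  {μ : Measure Ω} {ℱ : Filtration ℕ mΩ} {D : Measure (𝒳 × Bool)} {p : Params} {H : Finset (𝒳 → Bool)} {T : Trace Ω 𝒳}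

/-- The logarithmic compensator of one example of epoch `m`. -/
noncomputable def Trace.comp {Ω 𝒳 : Type*} (T : Trace Ω 𝒳) (p : Params) (H : Finset (𝒳 → Bool))
    [MeasurableSpace 𝒳] (D : Measure (𝒳 × Bool)) (s : 𝒳 × Bool → ℝ) (l : ℝ) (m : ℕ) (ω : Ω) : ℝ :=
  l * T.mean p H D s m ω + l ^ 2 * T.moment p H D s m ω

namespace IsRun

lemma moment_nonneg (hT : IsRun μ ℱ D p H T) (s : 𝒳 × Bool → ℝ) {m : ℕ} (hm : m < p.M) (ω : Ω) :
    0 ≤ T.moment p H D s (m + 1) ω := by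
  refine integral_nonneg fun z => spread_nonneg (fun x _ => ?_) _ _
  by_cases h : m = 0
  · subst h; rw [hT.prob_one]; exact zero_le_one
  · exact ((hT.prob_solution (m + 1) (by omega) (by omega) ω).1.bounds x).1

lemma abs_contribution_le (hT : IsRun μ ℱ D p H T) {s : 𝒳 × Bool → ℝ} (hs1 : ∀ z, |s z| ≤ 1)
    {l : ℝ} (hl : 0 < l) (hl1 : l ≤ 1) {m : ℕ} (hm : m < p.M) {ω : Ω}
    (hω : l ≤ T.pLow p H (m + 1) ω) (i : ℕ) : |l * T.contribution p H s (m + 1) ω i| ≤ 1 := by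
  unfold Trace.contribution
  split_ifs with h1 h2
  · have hp := hω.trans (hT.pLow_le hm ω _ h1)
    have hP0 := hl.trans_le hp
    rw [abs_mul, abs_div, abs_of_pos hl, abs_of_pos hP0, ← mul_div_assoc, div_le_one hP0]
    nlinarith [abs_nonneg (s (T.X i ω, T.Y i ω)), hs1 (T.X i ω, T.Y i ω)]
  · simp
  · rw [abs_mul, abs_of_pos hl]
    nlinarith [abs_nonneg (s (T.X i ω, T.h (m + 1) ω (T.X i ω))),
      hs1 (T.X i ω, T.h (m + 1) ω (T.X i ω))]

variable [IsProbabilityMeasure μ] [IsProbabilityMeasure D]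

/-- This is the supermartingale property for one example. By `hFl` the process has already been set
to zero wherever the scale exceeds the lower bound for the query probabilities, so the one-step
exponential bound applies everywhere else. -/
lemma subUnit_step (hT : IsRun μ ℱ D p H T) (hp : p.Admissible H.card)
    (hH : ∀ f ∈ H, Measurable f) {s : 𝒳 × Bool → ℝ} (hs : Measurable s) (hs1 : ∀ z, |s z| ≤ 1)
    {l : ℝ} (hl : 0 < l) (hl1 : l ≤ 1) {m : ℕ} (hm : m < p.M) {i : ℕ} (hi : p.τ m ≤ i)
    (hi' : i < p.τ (m + 1)) {F : Ω → ℝ} (hF : SubUnit μ (ℱ i) F)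
    (hFl : ∀ ω, F ω ≠ 0 → l ≤ T.pLow p H (m + 1) ω) :
    SubUnit μ (ℱ (i + 1)) fun ω => F ω *
      Real.exp (l * T.contribution p H s (m + 1) ω (i + 1) - T.comp p H D s l (m + 1) ω) := by
  have hn := hp.lt_n hm hi'
  have hcm : Measurable[ℱ (p.τ m)] fun ω => T.comp p H D s l (m + 1) ω :=
    ((hT.measurable_mean hp hH hm.le hs).const_mul l).add
      ((hT.measurable_moment hp hH hm hs).const_mul (l ^ 2))
  have hcm' : Measurable[ℱ i] fun ω => T.comp p H D s l (m + 1) ω := hcm.mono (ℱ.mono hi) le_rfl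
  have hc1 : ∀ ω, -1 ≤ T.comp p H D s l (m + 1) ω := fun ω => by
    have h1 := neg_one_le_mean (T := T) (p := p) (H := H) (D := D) hs1 (m + 1) ω
    have h2 := mul_nonneg (sq_nonneg l) (hT.moment_nonneg s hm ω)
    unfold Trace.comp
    nlinarith
  obtain ⟨C, hC⟩ := hF.bounded
  refine ⟨?_, fun ω => mul_nonneg (hF.nonneg ω) (Real.exp_pos _).le, ⟨C * Real.exp 2, fun ω => ?_⟩,
    ?_⟩
  · refine (hF.measurable.mono (ℱ.mono i.le_succ) le_rfl).mul (Measurable.exp (Measurable.sub ?_ ?_))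
    · exact (hT.measurable_contribution hp hH hm (hT.measurable_empErr hp hH hm.le) hs hi
        hi').const_mul l
    · exact hcm'.mono (ℱ.mono i.le_succ) le_rfl
  · by_cases h0 : F ω = 0
    · rw [h0, zero_mul]
      exact mul_nonneg ((hF.nonneg ω).trans (hC ω)) (Real.exp_pos _).le
    · refine mul_le_mul (hC ω) (Real.exp_le_exp.2 ?_) (Real.exp_pos _).le
        ((hF.nonneg ω).trans (hC ω))
      have := (abs_le.1 (hT.abs_contribution_le hs1 hl hl1 hm (hFl ω h0) (i + 1))).2
      linarith [hc1 ω]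
  · have hle := prod_mono_left m𝒳 (ℱ.mono hi)
    have hV : Measurable fun ω => (T.X (i + 1) ω, T.Y (i + 1) ω) :=
      ((hT.X_adapted i hn).mono (ℱ.le _) le_rfl).prodMk ((hT.Y_adapted i hn).mono (ℱ.le _) le_rfl)
    -- The past is represented by the identity of `Ω`, with `ℱ i` on the target, so that every `ℱ
    -- i`-measurable quantity is a function of it.
    have hind : @IndepFun Ω Ω (𝒳 × Bool) mΩ (ℱ i) _ id
        (fun ω => (T.X (i + 1) ω, T.Y (i + 1) ω)) μ := by
      refine (@IndepFun_iff_Indep Ω Ω (𝒳 × Bool) mΩ (ℱ i) _ _ _ μ).2 ?_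
      rw [MeasurableSpace.comap_id]
      exact (hT.indep i hn).symm
    have key := @integral_mul_exp_contribution_le Ω Ω 𝒳 mΩ (ℱ i) m𝒳 μ _ D _ id
      (fun ω => (T.X (i + 1) ω, T.Y (i + 1) ω)) (T.Q (i + 1)) (measurable_id'' (ℱ.le i)) hV
      ((hT.Q_adapted i hn).mono (ℱ.le _) le_rfl) (hT.law i hn) hind s hs hs1
      (T.region p H (m + 1)) (hle _ (hT.measurableSet_region hp hH hm.le))
      (T.h (m + 1)) ((hT.measurable_h hH hm.le).mono hle le_rfl)
      (T.P (m + 1)) ((hT.prob_measurable m hm).mono hle le_rfl) l hl hl1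
      -- The compensator is known before the example is drawn, so it can be moved into the weight,
      -- where it cancels the exponential bound exactly.
      (fun ω => F ω * Real.exp (-T.comp p H D s l (m + 1) ω))
      (hF.measurable.mul hcm'.neg.exp) (fun ω => mul_nonneg (hF.nonneg ω) (Real.exp_pos _).le)
      (C * Real.exp 1) (fun ω => mul_le_mul (hC ω) (Real.exp_le_exp.2 (by linarith [hc1 ω]))
        (Real.exp_pos _).le ((hF.nonneg ω).trans (hC ω)))
      (fun ω h0 x hx => (hFl ω (left_ne_zero_of_mul h0)).trans (hT.pLow_le hm ω x hx))
      (by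
        have := hT.query m hm i hi hi'
        rw [MeasurableSpace.comap_id]
        exact this)
    calc _ = _ := integral_congr_ae (Filter.Eventually.of_forall fun ω => ?_)
      _ ≤ _ := key
      _ = ∫ ω, F ω ∂μ := integral_congr_ae (Filter.Eventually.of_forall fun ω => ?_)
      _ ≤ 1 := hF.integral_le
    · simp only [id, Trace.contribution]
      rw [mul_assoc, ← Real.exp_add, neg_add_eq_sub]
    · simp only [id]
      rw [mul_assoc, ← Real.exp_add, Trace.comp, Trace.mean, Trace.moment, neg_add_cancel,
        Real.exp_zero, mul_one]

open Classical in
-- Whether `l ≤ pLow` holds is known when the epoch starts. Setting the process to zero when it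
-- fails does not increase the mean and makes `subUnit_step` applicable throughout the epoch; `k`
-- counts the examples processed so far.
lemma subUnit_epoch (hT : IsRun μ ℱ D p H T) (hp : p.Admissible H.card)
    (hH : ∀ f ∈ H, Measurable f) {s : 𝒳 × Bool → ℝ} (hs : Measurable s) (hs1 : ∀ z, |s z| ≤ 1)
    {l : ℝ} (hl : 0 < l) (hl1 : l ≤ 1) {m : ℕ} (hm : m < p.M) {F : Ω → ℝ}
    (hF : SubUnit μ (ℱ (p.τ m)) F) (k : ℕ) (hk : p.τ m + k ≤ p.τ (m + 1)) :
    SubUnit μ (ℱ (p.τ m + k)) fun ω => (if l ≤ T.pLow p H (m + 1) ω then F ω else 0) *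
      Real.exp (l * (∑ i ∈ Finset.Ioc (p.τ m) (p.τ m + k), T.contribution p H s (m + 1) ω i)
        - k * T.comp p H D s l (m + 1) ω) := by
  induction k with
  | zero =>
    obtain ⟨C, hC⟩ := hF.bounded
    have hm1 : Measurable[ℱ (p.τ m)] fun ω => if l ≤ T.pLow p H (m + 1) ω then F ω else 0 :=
      Measurable.ite (@measurableSet_le _ _ _ _ _ (ℱ (p.τ m)) _ _ _ _ _ measurable_const
        (hT.measurable_pLow hp hH hm.le)) hF.measurable measurable_const
    have hle : ∀ ω, (if l ≤ T.pLow p H (m + 1) ω then F ω else 0) ≤ F ω := fun ω => by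
      split_ifs
      · exact le_rfl
      · exact hF.nonneg ω
    have h0 : ∀ ω, 0 ≤ (if l ≤ T.pLow p H (m + 1) ω then F ω else 0) := fun ω => by
      split_ifs
      · exact hF.nonneg ω
      · exact le_rfl
    simp only [add_zero, Finset.Ioc_self, Finset.sum_empty, mul_zero, Nat.cast_zero, zero_mul,
      sub_zero, Real.exp_zero, mul_one]
    refine ⟨hm1, h0, ⟨C, fun ω => (hle ω).trans (hC ω)⟩, ?_⟩
    refine (integral_mono_of_nonneg (Filter.Eventually.of_forall h0) ?_
      (Filter.Eventually.of_forall hle)).trans hF.integral_le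
    exact Integrable.of_bound (hF.measurable.mono (ℱ.le _) le_rfl).aestronglyMeasurable
      C (Filter.Eventually.of_forall fun ω => by
        rw [Real.norm_eq_abs, abs_of_nonneg (hF.nonneg ω)]; exact hC ω)
  | succ k ih =>
    have h := hT.subUnit_step hp hH hs hs1 hl hl1 hm (Nat.le_add_right (p.τ m) k) (by omega)
      (ih (by omega)) fun ω h0 => by
        by_contra hcon
        rw [if_neg hcon, zero_mul] at h0
        exact h0 rfl
    rw [← add_assoc]
    convert h using 2 with ω
    rw [mul_assoc, ← Real.exp_add, Finset.sum_Ioc_succ_top (by omega)]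
    congr 2
    push_cast
    ring

open Classical in
-- The process is killed at the first epoch whose probability bound drops below `l`. Only its value
-- on surviving paths matters for the deviation bound, which is why the formula is asserted only
-- there.
lemma exists_subUnit (hT : IsRun μ ℱ D p H T) (hp : p.Admissible H.card)
    (hH : ∀ f ∈ H, Measurable f) {s : 𝒳 × Bool → ℝ} (hs : Measurable s) (hs1 : ∀ z, |s z| ≤ 1)
    {l : ℝ} (hl : 0 < l) (hl1 : l ≤ 1) {m : ℕ} (hm : m ≤ p.M) :
    ∃ F : Ω → ℝ, SubUnit μ (ℱ (p.τ m)) F ∧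
      ∀ ω, (∀ j, 1 ≤ j → j ≤ m → l ≤ T.pLow p H j ω) →
        F ω = Real.exp (l * weightedSum s (T.Z p H ω m) -
          ∑ j ∈ Finset.Icc 1 m, ((p.τ j : ℝ) - (p.τ (j - 1) : ℝ)) * T.comp p H D s l j ω) := by
  induction m with
  | zero =>
    refine ⟨fun _ => 1, ⟨measurable_const, fun _ => zero_le_one, ⟨1, fun _ => le_rfl⟩, by simp⟩,
      fun ω _ => ?_⟩
    simp [weightedSum, Trace.Z]
  | succ m ih =>
    obtain ⟨F, hF, hFe⟩ := ih (by omega)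
    have hlt := hp.τ_lt m (by omega)
    have h := hT.subUnit_epoch hp hH hs hs1 hl hl1 (by omega) hF (p.τ (m + 1) - p.τ m) (by omega)
    rw [Nat.add_sub_cancel' hlt.le] at h
    refine ⟨_, h, fun ω hω => ?_⟩
    rw [if_pos (hω (m + 1) (by omega) le_rfl), hFe ω fun j h1 h2 => hω j h1 (by omega),
      ← Real.exp_add, Trace.weightedSum_Z_succ, Finset.sum_Icc_succ_top (by omega),
      Nat.cast_sub hlt.le, Nat.add_sub_cancel]
    congr 1
    ring

/-- The one sided exponential deviation inequality for a fixed scale `l`. -/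
theorem deviation (hT : IsRun μ ℱ D p H T) (hp : p.Admissible H.card)
    (hH : ∀ f ∈ H, Measurable f) {s : 𝒳 × Bool → ℝ} (hs : Measurable s) (hs1 : ∀ z, |s z| ≤ 1)
    {l : ℝ} (hl : 0 < l) (hl1 : l ≤ 1) {m : ℕ} (hm : m ≤ p.M) (u : ℝ) :
    μ.real {ω | (∀ j, 1 ≤ j → j ≤ m → l ≤ T.pLow p H j ω) ∧
      (∑ j ∈ Finset.Icc 1 m, ((p.τ j : ℝ) - (p.τ (j - 1) : ℝ)) * T.comp p H D s l j ω) + u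
        ≤ l * weightedSum s (T.Z p H ω m)} ≤ Real.exp (-u) := by
  obtain ⟨F, hF, hFe⟩ := hT.exists_subUnit hp hH hs hs1 hl hl1 hm
  refine le_trans (measureReal_mono fun ω hω => ?_) (hF.measure_exp_le (ℱ.le _) u)
  obtain ⟨h1, h2⟩ := hω
  change Real.exp u ≤ F ω
  rw [hFe ω h1]
  exact Real.exp_le_exp.2 (by linarith)

end IsRun

end Supermartingale

/-! ### Elementary properties of the epoch schedule -/

lemma one_le_log_three : 1 ≤ Real.log 3 := by
  rw [Real.le_log_iff_exp_le (by norm_num)]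
  exact Real.exp_one_lt_three.le

namespace Params

variable {p : Params} {N : ℕ}

/-- The exponent of the failure probability of one deviation event of epoch `m`. -/
noncomputable def dev (p : Params) (N m : ℕ) : ℝ := 3 * (Real.log (N / p.δ) + Real.log (p.τ m))

namespace Admissible

lemma three_le (hp : p.Admissible N) {m : ℕ} (h1 : 1 ≤ m) (hm : m ≤ p.M) : (3 : ℝ) ≤ p.τ m := by
  have := hp.mono h1 hm
  rw [hp.τ_one] at this
  exact_mod_cast this

lemma add_two_le (hp : p.Admissible N) {m : ℕ} (h1 : 1 ≤ m) (hm : m ≤ p.M) : m + 2 ≤ p.τ m := by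
  induction m, h1 using Nat.le_induction with
  | base => rw [hp.τ_one]
  | succ k hk ih =>
    have := hp.τ_lt k (by omega)
    have := ih (by omega)
    omega

lemma one_le_log (hp : p.Admissible N) {m : ℕ} (h1 : 1 ≤ m) (hm : m ≤ p.M) :
    1 ≤ Real.log (p.τ m) :=
  one_le_log_three.trans (Real.log_le_log (by norm_num) (hp.three_le h1 hm))

lemma tau_mul_eps (hp : p.Admissible N) {m : ℕ} (h1 : 1 ≤ m) (hm : m ≤ p.M) :
    p.τ m * p.eps N m = 32 * (Real.log (N / p.δ) + Real.log (p.τ m)) := by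
  have := hp.three_le h1 hm
  unfold Params.eps
  field_simp

/-- Since `τ m ≥ m + 2`, the terms are dominated by the telescoping series of `1 / (m (m + 1))`. -/
lemma sum_inv_sq_le (hp : p.Admissible N) :
    ∑ m ∈ Finset.Icc 1 p.M, 1 / (p.τ m : ℝ) ^ 2 ≤ 1 := by
  have key : ∀ k, k ≤ p.M →
      ∑ m ∈ Finset.Icc 1 k, 1 / (p.τ m : ℝ) ^ 2 ≤ 1 - 1 / ((k : ℝ) + 1) := by
    intro k
    induction k with
    | zero => simp
    | succ k ih =>
      intro hk
      rw [Finset.sum_Icc_succ_top (by omega)]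
      have h1 : ((k : ℝ) + 1) + 2 ≤ p.τ (k + 1) := by
        exact_mod_cast hp.add_two_le (by omega : 1 ≤ k + 1) hk
      have h2 : 1 / (p.τ (k + 1) : ℝ) ^ 2 ≤ 1 / (((k : ℝ) + 1) * (k + 1 + 1)) := by
        apply one_div_le_one_div_of_le (by positivity)
        nlinarith
      have h3 : 1 / (((k : ℝ) + 1) * (k + 1 + 1)) = 1 / ((k : ℝ) + 1) - 1 / ((k : ℝ) + 1 + 1) := by
        field_simp
        ring
      have := ih (by omega)
      push_cast
      linarith
  have := key p.M le_rfl
  have : (0 : ℝ) ≤ 1 / ((p.M : ℝ) + 1) := by positivity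
  linarith

end Admissible

end Params

lemma one_le_log_div {N : ℕ} (hN : 1 ≤ N) {δ : ℝ} (hδ : 0 < δ) (hδ1 : δ < 1 / Real.exp 1) :
    1 ≤ Real.log (N / δ) := by
  have hN' : (1 : ℝ) ≤ N := by exact_mod_cast hN
  rw [Real.le_log_iff_exp_le (by positivity), le_div_iff₀ hδ]
  rw [lt_div_iff₀ (Real.exp_pos 1)] at hδ1
  linarith

/-! ### The good event and the union bound -/

section GoodEvent

variable {Ω 𝒳 : Type*}

/-- The functions whose weighted sums are controlled: signed losses and loss differences. -/
noncomputable def testFun (g f : 𝒳 → Bool) (sign diff : Bool) (z : 𝒳 × Bool) : ℝ :=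
  (if sign then 1 else -1) * (loss f z - if diff then loss g z else 0)

lemma loss_nonneg (f : 𝒳 → Bool) (z : 𝒳 × Bool) : 0 ≤ loss f z := ind_nonneg _

lemma loss_le_one (f : 𝒳 → Bool) (z : 𝒳 × Bool) : loss f z ≤ 1 := ind_le_one _

lemma abs_testFun_le (g f : 𝒳 → Bool) (a b : Bool) (z : 𝒳 × Bool) : |testFun g f a b z| ≤ 1 := by
  have h1 := loss_nonneg f z
  have h2 := loss_le_one f z
  have h3 := loss_nonneg g z
  have h4 := loss_le_one g z
  unfold testFun
  rw [abs_le]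
  cases a <;> cases b <;> simp <;> constructor <;> linarith

/-- Simultaneous control, along the execution `ω`, of the weighted sums of all test functions. -/
def Trace.Good (T : Trace Ω 𝒳) (p : Params) (H : Finset (𝒳 → Bool)) [MeasurableSpace 𝒳]
    (D : Measure (𝒳 × Bool)) (g : 𝒳 → Bool) (ω : Ω) : Prop :=
  ∀ m ∈ Finset.Icc 1 p.M, ∀ k ∈ Finset.Icc 1 (p.τ m), ∀ i ∈ H ×ˢ (Finset.univ : Finset (Bool × Bool)),
    (∀ j, 1 ≤ j → j ≤ m → 1 / (k : ℝ) ≤ T.pLow p H j ω) →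
    1 / (k : ℝ) * weightedSum (testFun g i.1 i.2.1 i.2.2) (T.Z p H ω m) <
      (∑ j ∈ Finset.Icc 1 m, ((p.τ j : ℝ) - (p.τ (j - 1) : ℝ)) *
        T.comp p H D (testFun g i.1 i.2.1 i.2.2) (1 / (k : ℝ)) j ω) + p.dev H.card m

lemma measurable_testFun [MeasurableSpace 𝒳] {g f : 𝒳 → Bool} (hg : Measurable g)
    (hf : Measurable f) (a b : Bool) : Measurable (testFun g f a b) := by
  have h1 := measurable_loss hg
  have h2 := measurable_loss hf
  unfold testFun
  cases a <;> cases b <;> simp only [if_true, if_false, Bool.false_eq_true] <;> fun_prop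

lemma exp_neg_dev {p : Params} {N m : ℕ} (hN : 1 ≤ N) (hδ : 0 < p.δ) (hτ : (0 : ℝ) < p.τ m) :
    Real.exp (-p.dev N m) = (p.δ / N) ^ 3 / (p.τ m : ℝ) ^ 3 := by
  have hN' : (0 : ℝ) < N := by exact_mod_cast hN
  unfold Params.dev
  rw [← Real.log_mul (by positivity) (by positivity)]
  rw [show -(3 * Real.log (N / p.δ * p.τ m)) = ((3 : ℕ) : ℝ) * (-Real.log (N / p.δ * p.τ m)) by
    push_cast; ring, Real.exp_nat_mul, Real.exp_neg, Real.exp_log (by positivity)]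
  field_simp

/-- In epoch `m` there are `τ m` scales and `4 |H|` test functions, each failing with probability at
most `(δ / |H|) ^ 3 / τ_m ^ 3`. The sum is `4 δ (δ / |H|) ^ 2 ∑ 1 / τ_m ^ 2`, and `|H| / δ ≥ 2`
suffices to make it at most `δ`. -/
theorem IsRun.good [mΩ : MeasurableSpace Ω] [MeasurableSpace 𝒳]
    {μ : Measure Ω} [IsProbabilityMeasure μ] {ℱ : Filtration ℕ mΩ}
    {D : Measure (𝒳 × Bool)} [IsProbabilityMeasure D] {p : Params} {H : Finset (𝒳 → Bool)}
    {T : Trace Ω 𝒳} (hT : IsRun μ ℱ D p H T) (hp : p.Admissible H.card)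
    (hH : ∀ f ∈ H, Measurable f) (hδ : 0 < p.δ) (hδ_card : √192 < (H.card : ℝ) / p.δ)
    {g : 𝒳 → Bool} (hg : g ∈ H) : 1 - p.δ ≤ μ.real {ω | T.Good p H D g ω} := by
  have hN : 1 ≤ H.card := Finset.card_pos.2 ⟨g, hg⟩
  have hN' : (0 : ℝ) < H.card := by exact_mod_cast hN
  set bad : ℕ → ℕ → (𝒳 → Bool) × Bool × Bool → Set Ω := fun m k i =>
    {ω | (∀ j, 1 ≤ j → j ≤ m → 1 / (k : ℝ) ≤ T.pLow p H j ω) ∧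
      (∑ j ∈ Finset.Icc 1 m, ((p.τ j : ℝ) - (p.τ (j - 1) : ℝ)) *
        T.comp p H D (testFun g i.1 i.2.1 i.2.2) (1 / (k : ℝ)) j ω) + p.dev H.card m ≤
      1 / (k : ℝ) * weightedSum (testFun g i.1 i.2.1 i.2.2) (T.Z p H ω m)} with hbad
  have hsub : {ω | T.Good p H D g ω}ᶜ ⊆ ⋃ m ∈ Finset.Icc 1 p.M, ⋃ k ∈ Finset.Icc 1 (p.τ m),
      ⋃ i ∈ H ×ˢ (Finset.univ : Finset (Bool × Bool)), bad m k i := by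
    intro ω hω
    simp only [Set.mem_compl_iff, Set.mem_ofPred_eq, Trace.Good] at hω
    push Not at hω
    obtain ⟨m, hm, k, hk, i, hi, h1, h2⟩ := hω
    simp only [Set.mem_iUnion]
    exact ⟨m, hm, k, hk, i, hi, h1, h2⟩
  have hle : μ.real {ω | T.Good p H D g ω}ᶜ ≤ p.δ := by
    calc _ ≤ μ.real (⋃ m ∈ Finset.Icc 1 p.M, ⋃ k ∈ Finset.Icc 1 (p.τ m),
          ⋃ i ∈ H ×ˢ (Finset.univ : Finset (Bool × Bool)), bad m k i) := 
          measureReal_mono hsub (measure_ne_top _ _)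
      _ ≤ ∑ m ∈ Finset.Icc 1 p.M, ∑ k ∈ Finset.Icc 1 (p.τ m),
          ∑ i ∈ H ×ˢ (Finset.univ : Finset (Bool × Bool)), Real.exp (-p.dev H.card m) := by
        refine (measureReal_biUnion_finset_le _ _).trans (Finset.sum_le_sum fun m hm => ?_)
        refine (measureReal_biUnion_finset_le _ _).trans (Finset.sum_le_sum fun k hk => ?_)
        refine (measureReal_biUnion_finset_le _ _).trans (Finset.sum_le_sum fun i hi => ?_)
        have hk1 : (1 : ℝ) ≤ k := by exact_mod_cast (Finset.mem_Icc.1 hk).1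
        exact hT.deviation hp hH (measurable_testFun (hH _ hg) (hH _ (Finset.mem_product.1 hi).1) _ _)
          (abs_testFun_le _ _ _ _) (by positivity) ((div_le_one (by positivity)).2 hk1)
          (Finset.mem_Icc.1 hm).2 _
      _ = ∑ m ∈ Finset.Icc 1 p.M, 4 * p.δ * (p.δ / H.card) ^ 2 * (1 / (p.τ m : ℝ) ^ 2) := by
        refine Finset.sum_congr rfl fun m hm => ?_
        have hτ := hp.three_le (Finset.mem_Icc.1 hm).1 (Finset.mem_Icc.1 hm).2
        simp only [Finset.sum_const, nsmul_eq_mul, Nat.card_Icc, Finset.card_product,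
          Finset.card_univ, Fintype.card_prod, Fintype.card_bool, Nat.add_sub_cancel]
        rw [exp_neg_dev hN hδ (by linarith)]
        push_cast
        field_simp
      _ ≤ 4 * p.δ * (p.δ / H.card) ^ 2 * 1 := by
        rw [← Finset.mul_sum]
        exact mul_le_mul_of_nonneg_left hp.sum_inv_sq_le (by positivity)
      _ ≤ p.δ := by
        have h1 : (2 : ℝ) ≤ √192 := Real.le_sqrt_of_sq_le (by norm_num)
        have h2 : p.δ / H.card ≤ 1 / 2 := by
          rw [div_le_div_iff₀ hN' (by norm_num)]
          have := (lt_div_iff₀ hδ).1 (h1.trans_lt hδ_card)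
          linarith
        have h3 : (p.δ / H.card) ^ 2 ≤ (1 / 2) ^ 2 := by gcongr
        nlinarith
  -- Subadditivity is enough here, so the good event need not be shown measurable.
  have huniv : (1 : ℝ) ≤ μ.real {ω | T.Good p H D g ω} + μ.real {ω | T.Good p H D g ω}ᶜ := by
    rw [← probReal_univ (μ := μ), ← Set.union_compl_self {ω | T.Good p H D g ω}]
    exact measureReal_union_le _ _
  linarith

end GoodEvent

/-- The expression `V / k + k u` is smallest at `k = √(V / u)`. The witness is the maximum of this
value and `R`, rounded up; rounding costs at most `u ≤ u R`. The hypotheses `V ≤ u t ^ 2` and `R ≤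
t` keep it inside the grid of scales. -/
lemma exists_scale {u V R : ℝ} {t : ℕ} (hu : 1 ≤ u) (hV : 0 ≤ V) (hVt : V ≤ u * (t : ℝ) ^ 2)
    (hR : 1 ≤ R) (hRt : R ≤ t) :
    ∃ k : ℕ, 1 ≤ k ∧ k ≤ t ∧ R ≤ k ∧ 1 / (k : ℝ) * V + k * u ≤ 2 * √(u * V) + 2 * u * R := by
  have hu0 : 0 < u := by linarith
  set x := √(V / u) with hx
  have hx0 : 0 ≤ x := Real.sqrt_nonneg _
  have hxV : V = u * x ^ 2 := by
    rw [hx, Real.sq_sqrt (by positivity)]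
    field_simp
  have hsq : √(u * V) = u * x := by
    rw [hxV, show u * (u * x ^ 2) = (u * x) ^ 2 by ring, Real.sqrt_sq (by positivity)]
  have hxt : x ≤ t := Real.sqrt_le_iff.2 ⟨by positivity, by
    rw [div_le_iff₀ hu0]; linarith⟩
  refine ⟨⌈max R x⌉₊, ?_, ?_, ?_, ?_⟩
  · exact Nat.one_le_ceil_iff.2 (lt_max_of_lt_left (by linarith))
  · exact Nat.ceil_le.2 (max_le hRt hxt)
  · exact (le_max_left _ _).trans (Nat.le_ceil _)
  · have h1 : x ≤ (⌈max R x⌉₊ : ℝ) := (le_max_right _ _).trans (Nat.le_ceil _)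
    have h2 : R ≤ (⌈max R x⌉₊ : ℝ) := (le_max_left _ _).trans (Nat.le_ceil _)
    have h3 : (⌈max R x⌉₊ : ℝ) < max R x + 1 := Nat.ceil_lt_add_one (by positivity)
    have h4 : max R x ≤ R + x := max_le (by linarith) (by linarith)
    generalize (⌈max R x⌉₊ : ℝ) = k at *
    have hk : 0 < k := by linarith
    have h5 : 1 / k * V ≤ u * x := by
      rw [hxV, one_div, inv_mul_le_iff₀ hk]
      nlinarith [mul_nonneg hu0.le hx0]
    rw [hsq]
    nlinarith

lemma testFun_false {𝒳 : Type*} (g f : 𝒳 → Bool) (b : Bool) :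
    testFun g f false b = fun z => - testFun g f true b z := by
  funext z
  simp [testFun]

lemma drift_neg {𝒳 : Type*} (s : 𝒳 × Bool → ℝ) (R : Set 𝒳) (g : 𝒳 → Bool) (z : 𝒳 × Bool) :
    drift (fun z => - s z) R g z = - drift s R g z := by
  unfold drift; split_ifs <;> rfl

lemma spread_neg {𝒳 : Type*} (s : 𝒳 × Bool → ℝ) (R : Set 𝒳) (P : 𝒳 → ℝ) (g : 𝒳 → Bool)
    (z : 𝒳 × Bool) : spread (fun z => - s z) R P g z = spread s R P g z := by
  unfold spread; split_ifs <;> simp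

namespace Params.Admissible

variable {p : Params} {N : ℕ}

lemma sum_width (hp : p.Admissible N) (m : ℕ) :
    ∑ j ∈ Finset.Icc 1 m, ((p.τ j : ℝ) - (p.τ (j - 1) : ℝ)) = p.τ m := by
  induction m with
  | zero => simp [hp.τ_zero]
  | succ m ih =>
    rw [Finset.sum_Icc_succ_top (by omega), ih]
    simp

lemma width_nonneg (hp : p.Admissible N) {j : ℕ} (hj : j ≤ p.M) :
    0 ≤ (p.τ j : ℝ) - (p.τ (j - 1) : ℝ) := by
  have : p.τ (j - 1) ≤ p.τ j := hp.mono (by omega) hj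
  rw [sub_nonneg]
  exact_mod_cast this

lemma tau_mul_eps_le (hp : p.Admissible N) (hL : 1 ≤ Real.log (N / p.δ)) {m : ℕ} (h1 : 1 ≤ m)
    (hm : m ≤ p.M) : p.τ m * p.eps N m ≤ p.n * p.eps N p.M := by
  have h3 := hp.three_le h1 hm
  have hM := hp.three_le hp.one_le_M le_rfl
  have hlog : Real.log (p.τ m) ≤ Real.log (p.τ p.M) :=
    Real.log_le_log (by linarith) (by exact_mod_cast hp.mono hm le_rfl)
  have hM1 := hp.one_le_log hp.one_le_M le_rfl
  have hn : (p.τ p.M : ℝ) ≤ p.n := by exact_mod_cast hp.τ_le_n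
  have he : 0 ≤ p.eps N p.M := by
    unfold Params.eps
    positivity
  calc _ ≤ p.τ p.M * p.eps N p.M := by
        rw [hp.tau_mul_eps h1 hm, hp.tau_mul_eps hp.one_le_M le_rfl]
        linarith
    _ ≤ _ := by gcongr

lemma le_n_mul_eps (hp : p.Admissible N) (hL : 1 ≤ Real.log (N / p.δ)) :
    64 ≤ p.n * p.eps N p.M := by
  have := hp.tau_mul_eps_le hL hp.one_le_M le_rfl
  rw [hp.tau_mul_eps hp.one_le_M le_rfl] at this
  have := hp.one_le_log hp.one_le_M le_rfl
  linarith

end Params.Admissible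

/-! ### Importance weights and deviations along a path -/

section Pathwise

variable {Ω 𝒳 : Type*}

/-- The least weighted number of errors on `Z̃_m`. -/
noncomputable def Trace.minSum (T : Trace Ω 𝒳) (p : Params) (H : Finset (𝒳 → Bool)) (m : ℕ)
    (ω : Ω) : ℝ := weightedSum (loss (T.h (m + 1) ω)) (T.Z p H ω m)

/-- An upper bound for the importance weights of the first `m + 1` epochs. -/
noncomputable def Trace.maxWeight (T : Trace Ω 𝒳) (p : Params) (H : Finset (𝒳 → Bool)) (m : ℕ)
    (ω : Ω) : ℝ := √(T.minSum p H m ω / (p.n * p.eps H.card p.M)) + 2 * Real.log (p.τ m)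

variable [mΩ : MeasurableSpace Ω] [m𝒳 : MeasurableSpace 𝒳]
  {μ : Measure Ω} {ℱ : Filtration ℕ mΩ} {D : Measure (𝒳 × Bool)} {p : Params}
  {H : Finset (𝒳 → Bool)} {T : Trace Ω 𝒳}

namespace IsRun

omit mΩ m𝒳 in
lemma empErr_eq_div (hp : p.Admissible H.card) {m : ℕ} (hm : m ≤ p.M) (ω : Ω) (f : 𝒳 → Bool) :
    empErr f (T.Z p H ω m) = weightedSum (loss f) (T.Z p H ω m) / p.τ m := by
  rw [empErr_eq, hp.card_Z hm]

lemma P_nonneg (hT : IsRun μ ℱ D p H T) {m : ℕ} (hm : m < p.M) (ω : Ω) (x : 𝒳) :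
    0 ≤ T.P (m + 1) ω x := by
  by_cases h : m = 0
  · subst h; rw [hT.prob_one]; exact zero_le_one
  · exact ((hT.prob_solution (m + 1) (by omega) (by omega) ω).1.bounds x).1

lemma contribution_nonneg (hT : IsRun μ ℱ D p H T) {s : 𝒳 × Bool → ℝ} (hs : ∀ z, 0 ≤ s z) {m : ℕ}
    (hm : m < p.M) (ω : Ω) (i : ℕ) : 0 ≤ T.contribution p H s (m + 1) ω i := by
  unfold Trace.contribution
  split_ifs
  · exact div_nonneg (hs _) (hT.P_nonneg hm ω _)
  · exact le_rfl
  · exact hs _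

lemma weightedSum_mono (hT : IsRun μ ℱ D p H T) {s : 𝒳 × Bool → ℝ} (hs : ∀ z, 0 ≤ s z) {m m' : ℕ}
    (h : m ≤ m') (hm : m' ≤ p.M) (ω : Ω) :
    weightedSum s (T.Z p H ω m) ≤ weightedSum s (T.Z p H ω m') := by
  induction m', h using Nat.le_induction with
  | base => exact le_rfl
  | succ k hk ih =>
    rw [Trace.weightedSum_Z_succ]
    have := Finset.sum_nonneg fun i (_ : i ∈ Finset.Ioc (p.τ k) (p.τ (k + 1))) =>
      hT.contribution_nonneg hs (by omega : k < p.M) ω i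
    linarith [ih (by omega)]

lemma weightedSum_nonneg (hT : IsRun μ ℱ D p H T) {s : 𝒳 × Bool → ℝ} (hs : ∀ z, 0 ≤ s z) {m : ℕ}
    (hm : m ≤ p.M) (ω : Ω) : 0 ≤ weightedSum s (T.Z p H ω m) := by
  have := hT.weightedSum_mono hs (Nat.zero_le m) hm ω
  simpa [Trace.Z, weightedSum] using this

lemma minSum_nonneg (hT : IsRun μ ℱ D p H T) {m : ℕ} (hm : m ≤ p.M) (ω : Ω) :
    0 ≤ T.minSum p H m ω :=
  hT.weightedSum_nonneg (loss_nonneg _) hm ω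

lemma minSum_le (hT : IsRun μ ℱ D p H T) (hp : p.Admissible H.card) {m : ℕ} (h1 : 1 ≤ m)
    (hm : m ≤ p.M) (ω : Ω) {f : 𝒳 → Bool} (hf : f ∈ H) :
    T.minSum p H m ω ≤ weightedSum (loss f) (T.Z p H ω m) := by
  have h := hT.erm_le m hm ω f hf
  have h3 := hp.three_le h1 hm
  rw [empErr_eq_div hp hm, empErr_eq_div hp hm, div_le_div_iff_of_pos_right (by linarith)] at h
  exact h

/-- On the shorter sample the later minimizer does no better than the earlier one, and new
contributions are nonnegative. This makes a single weight bound valid for all past epochs. -/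
lemma minSum_mono (hT : IsRun μ ℱ D p H T) (hp : p.Admissible H.card) {m m' : ℕ} (h1 : 1 ≤ m)
    (h : m ≤ m') (hm : m' ≤ p.M) (ω : Ω) : T.minSum p H m ω ≤ T.minSum p H m' ω :=
  (hT.minSum_le hp h1 (h.trans hm) ω (hT.erm_mem m' hm ω)).trans
    (hT.weightedSum_mono (loss_nonneg _) h hm ω)

omit mΩ m𝒳 in
lemma tau_mul_empErr_h (hp : p.Admissible H.card) {m : ℕ} (h1 : 1 ≤ m) (hm : m ≤ p.M) (ω : Ω) :
    p.τ m * empErr (T.h (m + 1) ω) (T.Z p H ω m) = T.minSum p H m ω := by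
  have h3 := hp.three_le h1 hm
  rw [empErr_eq_div hp hm, mul_div_cancel₀ _ (by linarith)]
  rfl

omit mΩ m𝒳 in
lemma two_le_maxWeight (hp : p.Admissible H.card) {m : ℕ} (h1 : 1 ≤ m) (hm : m ≤ p.M) (ω : Ω) :
    2 ≤ T.maxWeight p H m ω := by
  have := hp.one_le_log h1 hm
  have := Real.sqrt_nonneg (T.minSum p H m ω / (p.n * p.eps H.card p.M))
  unfold Trace.maxWeight
  linarith

/-- The denominator in `pMin` is built from `minSum` and `log τ`, both nondecreasing over epochs,
and `c₃ ≥ 1`. The alternative value `1 / 2` in `pMin` is covered by `maxWeight ≥ 2`, the reason for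
the factor `2` before the logarithm in `maxWeight`. The product form presupposes nothing about the
sign of `pLow`. -/
lemma one_le_maxWeight_mul_pLow (hT : IsRun μ ℱ D p H T) (hp : p.Admissible H.card)
    (hL : 1 ≤ Real.log (H.card / p.δ)) {m j : ℕ} (h1 : 1 ≤ m) (hm : m ≤ p.M) (hj : j ≤ m + 1)
    (ω : Ω) : 1 ≤ T.maxWeight p H m ω * T.pLow p H j ω := by
  have h2 := two_le_maxWeight (T := T) hp h1 hm ω
  unfold Trace.pLow
  split_ifs with hj1
  · linarith
  obtain ⟨i, rfl⟩ : ∃ i, j = i + 1 := ⟨j - 1, by omega⟩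
  have hi1 : 1 ≤ i := by omega
  have him : i ≤ m := by omega
  have hlog := hp.one_le_log hi1 (him.trans hm)
  unfold Trace.pMin
  rw [Nat.add_sub_cancel, tau_mul_empErr_h hp hi1 (him.trans hm), mul_min_of_nonneg _ _ (by linarith)]
  have hsq := Real.sqrt_nonneg (T.minSum p H i ω / (p.n * p.eps H.card p.M))
  refine le_min ?_ (by linarith)
  rw [← mul_div_assoc, one_le_div (by linarith)]
  have hle : √(T.minSum p H i ω / (p.n * p.eps H.card p.M)) + Real.log (p.τ i) ≤
      T.maxWeight p H m ω := by
    unfold Trace.maxWeight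
    have hn := hp.le_n_mul_eps hL
    have h3 := hp.three_le hi1 (him.trans hm)
    have e1 : √(T.minSum p H i ω / (p.n * p.eps H.card p.M)) ≤
        √(T.minSum p H m ω / (p.n * p.eps H.card p.M)) :=
      Real.sqrt_le_sqrt (div_le_div_of_nonneg_right (hT.minSum_mono hp hi1 him hm ω) (by linarith))
    have e2 : Real.log (p.τ i) ≤ Real.log (p.τ m) :=
      Real.log_le_log (by linarith) (by exact_mod_cast hp.mono him hm)
    linarith
  nlinarith [hp.c₃_ge]

lemma inv_P_le (hT : IsRun μ ℱ D p H T) {m : ℕ} (hm : m < p.M) {ω : Ω} {B : ℝ} (hB : 0 ≤ B)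
    (h : 1 ≤ B * T.pLow p H (m + 1) ω) (x : 𝒳) (hx : x ∈ T.region p H (m + 1) ω) :
    0 < T.P (m + 1) ω x ∧ 1 / T.P (m + 1) ω x ≤ B := by
  have h1 := hT.pLow_le hm ω x hx
  have h2 : 1 ≤ B * T.P (m + 1) ω x := h.trans (mul_le_mul_of_nonneg_left h1 hB)
  have h3 : 0 < T.P (m + 1) ω x :=
    lt_of_le_of_ne (hT.P_nonneg hm ω x) fun h0 => by rw [← h0] at h2; linarith
  exact ⟨h3, by rwa [div_le_iff₀ h3]⟩

lemma contribution_le (hT : IsRun μ ℱ D p H T) {s : 𝒳 × Bool → ℝ} (hs1 : ∀ z, s z ≤ 1) {m : ℕ} (hm : m < p.M) {ω : Ω} {B : ℝ} (hB : 1 ≤ B)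
    (h : 1 ≤ B * T.pLow p H (m + 1) ω) (i : ℕ) : T.contribution p H s (m + 1) ω i ≤ B := by
  unfold Trace.contribution
  split_ifs with h1 h2
  · obtain ⟨h3, h4⟩ := hT.inv_P_le hm (by linarith) h _ h1
    exact (div_le_div_of_nonneg_right (hs1 _) h3.le).trans h4
  · linarith
  · exact (hs1 _).trans hB

omit mΩ m𝒳 in
lemma maxWeight_le (hp : p.Admissible H.card)
    (hL : 1 ≤ Real.log (H.card / p.δ)) {m : ℕ} (h1 : 1 ≤ m) (hm : m ≤ p.M) (ω : Ω)
    (hw : T.minSum p H m ω ≤ (p.τ m : ℝ) ^ 2) : T.maxWeight p H m ω ≤ p.τ m := by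
  have h3 := hp.three_le h1 hm
  have hn := hp.le_n_mul_eps hL
  have e1 : √(T.minSum p H m ω / (p.n * p.eps H.card p.M)) ≤ p.τ m / 8 := by
    refine Real.sqrt_le_iff.2 ⟨by positivity, ?_⟩
    rw [div_le_iff₀ (by linarith)]
    nlinarith [sq_nonneg (p.τ m : ℝ)]
  -- This is `log x ≤ x / e` with `e > 8 / 3`. Together with `nε_M ≥ 64` in `e1`, the total is at
  -- most `(1 / 8 + 3 / 4) τ_m`.
  have e2 : Real.log (p.τ m) ≤ p.τ m * (3 / 8) := by
    have hexp := Real.exp_one_gt_d9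
    have hlog := Real.add_one_le_exp (Real.log (p.τ m) - 1)
    rw [Real.exp_sub, Real.exp_log (by linarith), sub_add_cancel] at hlog
    refine hlog.trans ?_
    rw [div_le_iff₀ (by positivity)]
    nlinarith
  unfold Trace.maxWeight
  linarith

/-- This crude bound, valid on every path, only serves to show `maxWeight ≤ τ m`, so that the scale
required later belongs to the grid. The bound for earlier epochs limits the weights of the next one
to `τ (m + 1)`, and `t ^ 2 + (t' - t) t' ≤ t' ^ 2` for `0 ≤ t ≤ t'`. -/
lemma weightedSum_le (hT : IsRun μ ℱ D p H T) (hp : p.Admissible H.card)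
    (hL : 1 ≤ Real.log (H.card / p.δ)) (ω : Ω) : ∀ m, m ≤ p.M → ∀ s : 𝒳 × Bool → ℝ,
      (∀ z, 0 ≤ s z) → (∀ z, s z ≤ 1) → weightedSum s (T.Z p H ω m) ≤ (p.τ m : ℝ) ^ 2
  | 0, _, s, _, _ => by
    simp only [Trace.Z, weightedSum, Multiset.map_zero, Multiset.sum_zero]
    positivity
  | m + 1, hm, s, hs0, hs1 => by
    have ih := weightedSum_le hT hp hL ω m (by omega)
    have hlt := hp.τ_lt m (by omega)
    have hB : 1 ≤ (p.τ (m + 1) : ℝ) * T.pLow p H (m + 1) ω := by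
      by_cases h0 : m = 0
      · subst h0
        simp [Trace.pLow, hp.τ_one]
      · have h1 : 1 ≤ m := by omega
        have e1 := hT.one_le_maxWeight_mul_pLow hp hL h1 (by omega : m ≤ p.M) le_rfl ω
        have e2 := maxWeight_le hp hL h1 (by omega) ω
          (ih _ (loss_nonneg (T.h (m + 1) ω)) (loss_le_one _))
        have e3 : (p.τ m : ℝ) ≤ p.τ (m + 1) := by exact_mod_cast hlt.le
        have e4 := two_le_maxWeight (T := T) hp h1 (by omega) ω
        have e5 : 0 ≤ T.pLow p H (m + 1) ω := by
          by_contra hneg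
          nlinarith
        nlinarith
    have h3 := hp.three_le (by omega : 1 ≤ m + 1) hm
    rw [Trace.weightedSum_Z_succ]
    have hsum : ∑ i ∈ Finset.Ioc (p.τ m) (p.τ (m + 1)), T.contribution p H s (m + 1) ω i ≤
        ((p.τ (m + 1) : ℝ) - p.τ m) * p.τ (m + 1) := by
      refine (Finset.sum_le_sum fun i _ =>
        hT.contribution_le hs1 (by omega) (by linarith) hB i).trans ?_
      rw [Finset.sum_const, Nat.card_Ioc, nsmul_eq_mul, Nat.cast_sub hlt.le]
    have h5 := ih s hs0 hs1
    have h6 : (p.τ m : ℝ) ≤ p.τ (m + 1) := by exact_mod_cast hlt.le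
    nlinarith [(p.τ m).cast_nonneg (α := ℝ)]

lemma maxWeight_le_tau (hT : IsRun μ ℱ D p H T) (hp : p.Admissible H.card)
    (hL : 1 ≤ Real.log (H.card / p.δ)) {m : ℕ} (h1 : 1 ≤ m) (hm : m ≤ p.M) (ω : Ω) :
    T.maxWeight p H m ω ≤ p.τ m :=
  maxWeight_le hp hL h1 hm ω (hT.weightedSum_le hp hL ω m hm _ (loss_nonneg _) (loss_le_one _))

lemma moment_le [IsProbabilityMeasure D] (hT : IsRun μ ℱ D p H T) {s : 𝒳 × Bool → ℝ}
    (hs1 : ∀ z, |s z| ≤ 1) {m : ℕ} (hm : m < p.M) {ω : Ω} {B : ℝ} (hB : 1 ≤ B)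
    (h : 1 ≤ B * T.pLow p H (m + 1) ω) : T.moment p H D s (m + 1) ω ≤ B := by
  have hP := hT.inv_P_le hm (by linarith) h
  calc _ ≤ ∫ _, B ∂D := integral_mono_of_nonneg
        (Filter.Eventually.of_forall fun z => spread_nonneg (fun x hx => (hP x hx).1.le) _ _)
        (integrable_const _) (Filter.Eventually.of_forall fun z => spread_le hs1 hB hP _ z)
    _ = B := by simp

/-- The deviation bound on the good event, with data dependent variance and range. -/
theorem abs_sub_le_of_good [IsProbabilityMeasure D] (hT : IsRun μ ℱ D p H T)
    (hp : p.Admissible H.card) (hL : 1 ≤ Real.log (H.card / p.δ)) {g : 𝒳 → Bool} {ω : Ω}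
    (hgood : T.Good p H D g ω) {m : ℕ} (h1 : 1 ≤ m) (hm : m ≤ p.M) {f : 𝒳 → Bool} (hf : f ∈ H)
    (b : Bool) :
    |weightedSum (testFun g f true b) (T.Z p H ω m) - ∑ j ∈ Finset.Icc 1 m,
      ((p.τ j : ℝ) - (p.τ (j - 1) : ℝ)) * T.mean p H D (testFun g f true b) j ω| ≤
    2 * √(p.dev H.card m * ∑ j ∈ Finset.Icc 1 m,
      ((p.τ j : ℝ) - (p.τ (j - 1) : ℝ)) * T.moment p H D (testFun g f true b) j ω)
      + 2 * p.dev H.card m * T.maxWeight p H m ω := by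
  set V := ∑ j ∈ Finset.Icc 1 m,
      ((p.τ j : ℝ) - (p.τ (j - 1) : ℝ)) * T.moment p H D (testFun g f true b) j ω with hV
  have hu : 1 ≤ p.dev H.card m := by
    have := hp.one_le_log h1 hm
    unfold Params.dev
    linarith
  have hR2 := two_le_maxWeight (T := T) hp h1 hm ω
  have hRt := hT.maxWeight_le_tau hp hL h1 hm ω
  have hV0 : 0 ≤ V := Finset.sum_nonneg fun j hj => by
    obtain ⟨hj1, hj2⟩ := Finset.mem_Icc.1 hj
    obtain ⟨i, rfl⟩ : ∃ i, j = i + 1 := ⟨j - 1, by omega⟩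
    exact mul_nonneg (hp.width_nonneg (hj2.trans hm)) (hT.moment_nonneg _ (by omega) ω)
  -- Each second moment is at most the largest weight, and the epoch lengths add up to `τ m`.
  have hVR : V ≤ p.τ m * T.maxWeight p H m ω := by
    rw [← hp.sum_width m, Finset.sum_mul]
    refine Finset.sum_le_sum fun j hj => ?_
    obtain ⟨hj1, hj2⟩ := Finset.mem_Icc.1 hj
    refine mul_le_mul_of_nonneg_left ?_ (hp.width_nonneg (hj2.trans hm))
    obtain ⟨i, rfl⟩ : ∃ i, j = i + 1 := ⟨j - 1, by omega⟩
    exact hT.moment_le (abs_testFun_le _ _ _ _) (by omega) (by linarith)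
      (hT.one_le_maxWeight_mul_pLow hp hL h1 hm (by omega) ω)
  have hVt : V ≤ p.dev H.card m * (p.τ m : ℝ) ^ 2 := by
    have h3 := hp.three_le h1 hm
    have : (p.τ m : ℝ) * T.maxWeight p H m ω ≤ (p.τ m : ℝ) ^ 2 := by
      rw [sq]; exact mul_le_mul_of_nonneg_left hRt (by linarith)
    nlinarith [sq_nonneg (p.τ m : ℝ)]
  -- The scale depends on the path through `V` and `maxWeight`; this is legitimate because the good
  -- event covers every `k ≤ τ m`.
  obtain ⟨k, hk1, hkt, hRk, hk⟩ := exists_scale hu hV0 hVt (by linarith : 1 ≤ T.maxWeight p H m ω) hRt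
  have hk0 : (0 : ℝ) < k := by exact_mod_cast hk1
  have hlow : ∀ j, 1 ≤ j → j ≤ m → 1 / (k : ℝ) ≤ T.pLow p H j ω := by
    intro j hj1 hj2
    have h := hT.one_le_maxWeight_mul_pLow hp hL h1 hm (by omega : j ≤ m + 1) ω
    have hpos : 0 ≤ T.pLow p H j ω := by
      by_contra hneg
      nlinarith
    rw [div_le_iff₀ hk0]
    nlinarith
  have key : ∀ a, weightedSum (testFun g f a b) (T.Z p H ω m) ≤ (∑ j ∈ Finset.Icc 1 m,
      ((p.τ j : ℝ) - (p.τ (j - 1) : ℝ)) * T.mean p H D (testFun g f a b) j ω) +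
      1 / (k : ℝ) * (∑ j ∈ Finset.Icc 1 m, ((p.τ j : ℝ) - (p.τ (j - 1) : ℝ)) *
        T.moment p H D (testFun g f a b) j ω) + k * p.dev H.card m := by
    intro a
    have h := hgood m (Finset.mem_Icc.2 ⟨h1, hm⟩) k (Finset.mem_Icc.2 ⟨hk1, hkt⟩) (f, a, b)
      (Finset.mem_product.2 ⟨hf, Finset.mem_univ _⟩) hlow
    have hsum : ∑ j ∈ Finset.Icc 1 m, ((p.τ j : ℝ) - (p.τ (j - 1) : ℝ)) *
        T.comp p H D (testFun g f a b) (1 / (k : ℝ)) j ω = 1 / (k : ℝ) * (∑ j ∈ Finset.Icc 1 m,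
      ((p.τ j : ℝ) - (p.τ (j - 1) : ℝ)) * T.mean p H D (testFun g f a b) j ω) +
      (1 / (k : ℝ)) ^ 2 * (∑ j ∈ Finset.Icc 1 m, ((p.τ j : ℝ) - (p.τ (j - 1) : ℝ)) *
        T.moment p H D (testFun g f a b) j ω) := by
      rw [Finset.mul_sum, Finset.mul_sum, ← Finset.sum_add_distrib]
      refine Finset.sum_congr rfl fun j _ => ?_
      unfold Trace.comp
      ring
    simp only at h
    rw [hsum] at h
    have h' := mul_le_mul_of_nonneg_left h.le hk0.le
    have e1 : ∀ x : ℝ, (k : ℝ) * (1 / (k : ℝ) * x) = x := fun x => by field_simp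
    have e2 : ∀ x : ℝ, (k : ℝ) * ((1 / (k : ℝ)) ^ 2 * x) = 1 / (k : ℝ) * x := fun x => by field_simp
    rwa [mul_add, mul_add, e1, e1, e2] at h'
  -- The two signs give the two sides of the absolute value: changing sign negates the means and
  -- leaves the second moments unchanged.
  have hpos := key true
  have hneg := key false
  have em : ∀ j, T.moment p H D (testFun g f false b) j ω =
      T.moment p H D (testFun g f true b) j ω := fun j => by
    unfold Trace.moment
    simp_rw [testFun_false, spread_neg]
  have ed : ∀ j, T.mean p H D (testFun g f false b) j ω =
      - T.mean p H D (testFun g f true b) j ω := fun j => by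
    unfold Trace.mean
    simp_rw [testFun_false, drift_neg, integral_neg]
  simp_rw [em, ed, testFun_false, weightedSum_neg, mul_neg, Finset.sum_neg_distrib] at hneg
  rw [abs_le]
  constructor <;> linarith

end IsRun

end Pathwise

/-! ### Population means and second moments of one example -/

section Population

variable {𝒳 : Type*} [m𝒳 : MeasurableSpace 𝒳] {D : Measure (𝒳 × Bool)}

lemma integral_ind {α : Type*} [MeasurableSpace α] (μ : Measure α) {q : α → Prop}
    (hq : MeasurableSet {a | q a}) : ∫ a, ind (q a) ∂μ = μ.real {a | q a} := by
  have : (fun a => ind (q a)) = Set.indicator {a | q a} (fun _ => (1 : ℝ)) := by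
    funext a
    by_cases h : q a <;> simp [ind, h]
  rw [this, integral_indicator_const _ hq, smul_eq_mul, mul_one]

lemma measurable_ind {α : Type*} [MeasurableSpace α] {q : α → Prop}
    (hq : MeasurableSet {a | q a}) : Measurable fun a => ind (q a) :=
  Measurable.ite hq measurable_const measurable_const

lemma integrable_ind {α : Type*} [MeasurableSpace α] {μ : Measure α} [IsFiniteMeasure μ]
    {q : α → Prop} (hq : MeasurableSet {a | q a}) : Integrable (fun a => ind (q a)) μ :=
  Integrable.of_bound (measurable_ind hq).aestronglyMeasurable 1
    (Filter.Eventually.of_forall fun a => by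
      rw [Real.norm_eq_abs, abs_of_nonneg (ind_nonneg _)]; exact ind_le_one _)

lemma integral_fst_eq {φ : 𝒳 → ℝ} (hφ : Measurable φ) : ∫ x, φ x ∂D.fst = ∫ z, φ z.1 ∂D :=
  integral_map measurable_fst.aemeasurable hφ.aestronglyMeasurable

/-- The probability of `f ≠ g` outside of `R`. -/
noncomputable def disOff (D : Measure (𝒳 × Bool)) (R : Set 𝒳) (f g : 𝒳 → Bool) : ℝ :=
  D.real {z | f z.1 ≠ g z.1 ∧ z.1 ∉ R}

/-- The probability that `f` errs inside of `R`. -/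
noncomputable def errOn (D : Measure (𝒳 × Bool)) (R : Set 𝒳) (f : 𝒳 → Bool) : ℝ :=
  D.real {z | f z.1 ≠ z.2 ∧ z.1 ∈ R}

variable {R : Set 𝒳} {f g k : 𝒳 → Bool}

lemma measurableSet_ne_fst (hf : Measurable f) (hg : Measurable g) :
    MeasurableSet {z : 𝒳 × Bool | f z.1 ≠ g z.1} :=
  (measurableSet_eq_fun (hf.comp measurable_fst) (hg.comp measurable_fst)).compl

lemma measurableSet_err (hf : Measurable f) : MeasurableSet {z : 𝒳 × Bool | f z.1 ≠ z.2} :=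
  (measurableSet_eq_fun (hf.comp measurable_fst) measurable_snd).compl

lemma measurableSet_disOff (hR : MeasurableSet R) (hf : Measurable f) (hg : Measurable g) :
    MeasurableSet {z : 𝒳 × Bool | f z.1 ≠ g z.1 ∧ z.1 ∉ R} :=
  (measurableSet_ne_fst hf hg).inter (measurable_fst hR).compl

lemma measurableSet_disOn (hR : MeasurableSet R) (hf : Measurable f) (hg : Measurable g) :
    MeasurableSet {z : 𝒳 × Bool | f z.1 ≠ g z.1 ∧ z.1 ∈ R} :=
  (measurableSet_ne_fst hf hg).inter (measurable_fst hR)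

lemma measurableSet_errOn (hR : MeasurableSet R) (hf : Measurable f) :
    MeasurableSet {z : 𝒳 × Bool | f z.1 ≠ z.2 ∧ z.1 ∈ R} :=
  (measurableSet_err hf).inter (measurable_fst hR)

variable [IsProbabilityMeasure D]

lemma integral_comb_eq {q₁ q₂ q₃ : 𝒳 × Bool → Prop} (h₁ : MeasurableSet {a | q₁ a})
    (h₂ : MeasurableSet {a | q₂ a}) (h₃ : MeasurableSet {a | q₃ a}) :
    ∫ z, (ind (q₁ z) + ind (q₂ z) - ind (q₃ z)) ∂D =
      D.real {a | q₁ a} + D.real {a | q₂ a} - D.real {a | q₃ a} := by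
  have h₁₂ : Integrable (fun z => ind (q₁ z) + ind (q₂ z)) D :=
    (integrable_ind h₁).add (integrable_ind h₂)
  rw [integral_sub h₁₂ (integrable_ind h₃), integral_add (integrable_ind h₁) (integrable_ind h₂), integral_ind D h₁, integral_ind D h₂,
    integral_ind D h₃]

/-- The mean contribution of a loss difference, when the current classifier `k` agrees with the
reference `g` outside of the query region. -/
lemma integral_drift_diff (hR : MeasurableSet R) (hf : Measurable f) (hg : Measurable g)
    (hk : ∀ x, x ∉ R → k x = g x) :
    ∫ z, drift (testFun g f true true) R k z ∂D = disOff D R f g + errOn D R f - errOn D R g := by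
  rw [disOff, errOn, errOn, ← integral_comb_eq (measurableSet_disOff hR hf hg)
    (measurableSet_errOn hR hf) (measurableSet_errOn hR hg)]
  refine integral_congr_ae (Filter.Eventually.of_forall fun z => ?_)
  by_cases hz : z.1 ∈ R
  · simp only [drift, testFun, loss, ind, hz, if_true]
    generalize f z.1 = a
    generalize g z.1 = b
    generalize z.2 = y
    cases a <;> cases b <;> cases y <;> simp
  · simp [drift, testFun, loss, ind, hz, hk z.1 hz]

omit [IsProbabilityMeasure D] in
lemma integral_drift_loss (hR : MeasurableSet R) (hg : Measurable g)
    (hk : ∀ x, x ∉ R → k x = g x) :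
    ∫ z, drift (testFun g g true false) R k z ∂D = errOn D R g := by
  rw [errOn, ← integral_ind D (measurableSet_errOn hR hg)]
  refine integral_congr_ae (Filter.Eventually.of_forall fun z => ?_)
  by_cases hz : z.1 ∈ R
  · simp [drift, testFun, loss, ind, hz]
  · simp [drift, testFun, loss, ind, hz, hk z.1 hz]

/-- Off `R` the recorded label is that of `g`, so nothing is contributed. On `R` the squared loss is
the loss, so the variance is at most the range times the mean. -/
lemma integral_spread_loss_le (hR : MeasurableSet R) (hg : Measurable g)
    (hk : ∀ x, x ∉ R → k x = g x) {P : 𝒳 → ℝ} {B : ℝ}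
    (hP : ∀ x ∈ R, 0 < P x ∧ 1 / P x ≤ B) :
    ∫ z, spread (testFun g g true false) R P k z ∂D ≤ B * errOn D R g := by
  rw [errOn, ← integral_ind D (measurableSet_errOn hR hg), ← integral_const_mul]
  refine integral_mono_of_nonneg (Filter.Eventually.of_forall fun z =>
    spread_nonneg (fun x hx => (hP x hx).1.le) _ _)
    ((integrable_ind (measurableSet_errOn hR hg)).const_mul B)
    (Filter.Eventually.of_forall fun z => ?_)
  by_cases hz : z.1 ∈ R
  · by_cases hy : g z.1 = z.2
    · simp [spread, testFun, loss, ind, hz, hy]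
    · simpa [spread, testFun, loss, ind, hz, hy] using (hP _ hz).2
  · simp [spread, testFun, loss, ind, hz, hk z.1 hz]

/-- Off `R`, replacing the true label by the one predicted by `g` raises the loss difference to its
largest possible value, the indicator of `f ≠ g`. The bias of the sample therefore favors `g`. -/
lemma err_sub_err_le (hR : MeasurableSet R) (hf : Measurable f) (hg : Measurable g) :
    err D f - err D g ≤ disOff D R f g + errOn D R f - errOn D R g := by
  rw [err, err, disOff, errOn, errOn, ← integral_comb_eq (measurableSet_disOff hR hf hg)
    (measurableSet_errOn hR hf) (measurableSet_errOn hR hg),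
    ← integral_ind D (measurableSet_err hf), ← integral_ind D (measurableSet_err hg),
    ← integral_sub (integrable_ind (measurableSet_err hf)) (integrable_ind (measurableSet_err hg))]
  refine integral_mono ((integrable_ind (measurableSet_err hf)).sub
    (integrable_ind (measurableSet_err hg))) (((integrable_ind (measurableSet_disOff hR hf hg)).add
    (integrable_ind (measurableSet_errOn hR hf))).sub (integrable_ind (measurableSet_errOn hR hg)))
    fun z => ?_
  by_cases hz : z.1 ∈ R
  · simp only [ind, hz]
    generalize f z.1 = a
    generalize g z.1 = b
    generalize z.2 = y
    cases a <;> cases b <;> cases y <;> simp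
  · simp only [ind, hz]
    generalize f z.1 = a
    generalize g z.1 = b
    generalize z.2 = y
    cases a <;> cases b <;> cases y <;> simp

lemma err_sub_err_eq (hR : MeasurableSet R) (hf : Measurable f) (hg : Measurable g)
    (hfg : ∀ x, x ∉ R → f x = g x) : err D f - err D g = errOn D R f - errOn D R g := by
  rw [err, err, errOn, errOn,
    ← integral_ind D (measurableSet_errOn hR hf), ← integral_ind D (measurableSet_errOn hR hg),
    ← integral_ind D (measurableSet_err hf), ← integral_ind D (measurableSet_err hg),
    ← integral_sub (integrable_ind (measurableSet_err hf)) (integrable_ind (measurableSet_err hg)),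
    ← integral_sub (integrable_ind (measurableSet_errOn hR hf))
      (integrable_ind (measurableSet_errOn hR hg))]
  refine integral_congr_ae (Filter.Eventually.of_forall fun z => ?_)
  by_cases hz : z.1 ∈ R
  · simp only [ind, hz]
    generalize f z.1 = a
    generalize g z.1 = b
    generalize z.2 = y
    cases a <;> cases b <;> cases y <;> simp
  · simp only [ind, hz, hfg z.1 hz]
    generalize g z.1 = b
    generalize z.2 = y
    cases b <;> cases y <;> simp

/-- Where `f` and `k` differ, one of them errs whatever the label is. -/
lemma disagreement_mass_le (hR : MeasurableSet R) (hf : Measurable f) (hk : Measurable k) :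
    ∫ x, ind (f x ≠ k x ∧ x ∈ R) ∂D.fst ≤ errOn D R f + errOn D R k := by
  have hm : MeasurableSet {x | f x ≠ k x ∧ x ∈ R} := (measurableSet_eq_fun hf hk).compl.inter hR
  rw [integral_fst_eq (measurable_ind hm), errOn, errOn,
    ← integral_ind D (measurableSet_errOn hR hf), ← integral_ind D (measurableSet_errOn hR hk),
    ← integral_add (integrable_ind (measurableSet_errOn hR hf))
      (integrable_ind (measurableSet_errOn hR hk))]
  refine integral_mono (integrable_ind (measurableSet_disOn hR hf hk))
    ((integrable_ind (measurableSet_errOn hR hf)).add (integrable_ind (measurableSet_errOn hR hk)))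
    fun z => ?_
  by_cases hz : z.1 ∈ R
  · simp only [ind, hz]
    generalize f z.1 = a
    generalize k z.1 = b
    generalize z.2 = y
    cases a <;> cases b <;> cases y <;> simp
  · simp [ind, hz]

/-- The second moment of the contribution of a loss difference in terms of the quantities that the
optimization problem constrains. -/
lemma integral_spread_diff_le (hR : MeasurableSet R) (hf : Measurable f) (hg : Measurable g)
    (hkm : Measurable k) (hk : ∀ x, x ∉ R → k x = g x) {P : 𝒳 → ℝ} (hPm : Measurable P) {B : ℝ}
    (hP : ∀ x ∈ R, 0 < P x ∧ 1 / P x ≤ B) :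
    ∫ z, spread (testFun g f true true) R P k z ∂D ≤ disOff D R f g +
      ∫ x, ind (f x ≠ k x ∧ x ∈ R) / P x ∂D.fst + ∫ x, ind (g x ≠ k x ∧ x ∈ R) / P x ∂D.fst := by
  have hm : ∀ {f : 𝒳 → Bool}, Measurable f → Measurable fun x => ind (f x ≠ k x ∧ x ∈ R) / P x :=
    fun hf => (measurable_ind ((measurableSet_eq_fun hf hkm).compl.inter hR)).div hPm
  have hi : ∀ {f : 𝒳 → Bool}, Measurable f →
      Integrable (fun z : 𝒳 × Bool => ind (f z.1 ≠ k z.1 ∧ z.1 ∈ R) / P z.1) D := fun {f} hf =>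
    Integrable.of_bound ((hm hf).comp measurable_fst).aestronglyMeasurable (max B 0)
      (Filter.Eventually.of_forall fun z => by
        by_cases hz : z.1 ∈ R
        · obtain ⟨h1, h2⟩ := hP _ hz
          rw [Real.norm_eq_abs, abs_of_nonneg (div_nonneg (ind_nonneg _) h1.le)]
          exact ((div_le_div_of_nonneg_right (ind_le_one _) h1.le).trans h2).trans (le_max_left _ _)
        · simp [ind, hz])
  have hd := integrable_ind (μ := D) (measurableSet_disOff hR hf hg)
  have hdf : Integrable (fun z : 𝒳 × Bool => ind (f z.1 ≠ g z.1 ∧ z.1 ∉ R) +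
      ind (f z.1 ≠ k z.1 ∧ z.1 ∈ R) / P z.1) D := hd.add (hi hf)
  rw [integral_fst_eq (hm hf), integral_fst_eq (hm hg), disOff,
    ← integral_ind D (measurableSet_disOff hR hf hg), ← integral_add hd (hi hf),
    ← integral_add hdf (hi hg)]
  refine integral_mono_of_nonneg (Filter.Eventually.of_forall fun z =>
    spread_nonneg (fun x hx => (hP x hx).1.le) _ _) (hdf.add (hi hg))
    (Filter.Eventually.of_forall fun z => ?_)
  -- On `R`, the squared loss difference is the indicator of `f ≠ g`, and `f ≠ g` forces `f ≠ k` or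
  -- `g ≠ k`.
  by_cases hz : z.1 ∈ R
  · have hp := (hP _ hz).1
    simp only [spread, testFun, loss, ind, hz, if_true]
    generalize f z.1 = a
    generalize g z.1 = b
    generalize k z.1 = c
    generalize z.2 = y
    cases a <;> cases b <;> cases c <;> cases y <;> simp <;> positivity
  · simp only [spread, testFun, loss, ind, hz, if_false, hk z.1 hz]
    generalize f z.1 = a
    generalize g z.1 = b
    cases a <;> cases b <;> simp

/-- The first epoch has no variance constraint; with query probability one, the bound `(a - b) ^ 2 ≤
a + b` for `a, b ∈ {0, 1}` replaces it. -/
lemma integral_spread_diff_le_of_eq_one (hR : MeasurableSet R) (hf : Measurable f)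
    (hg : Measurable g) (hk : ∀ x, x ∉ R → k x = g x) {P : 𝒳 → ℝ} (hP : ∀ x, P x = 1) :
    ∫ z, spread (testFun g f true true) R P k z ∂D ≤
      disOff D R f g + errOn D R f + errOn D R g := by
  have h₁ := integrable_ind (μ := D) (measurableSet_disOff hR hf hg)
  have h₂ := integrable_ind (μ := D) (measurableSet_errOn hR hf)
  have h₃ := integrable_ind (μ := D) (measurableSet_errOn hR hg)
  have h₁₂ : Integrable (fun z : 𝒳 × Bool => ind (f z.1 ≠ g z.1 ∧ z.1 ∉ R) +
      ind (f z.1 ≠ z.2 ∧ z.1 ∈ R)) D := h₁.add h₂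
  rw [disOff, errOn, errOn, ← integral_ind D (measurableSet_disOff hR hf hg),
    ← integral_ind D (measurableSet_errOn hR hf), ← integral_ind D (measurableSet_errOn hR hg),
    ← integral_add h₁ h₂, ← integral_add h₁₂ h₃]
  refine integral_mono_of_nonneg (Filter.Eventually.of_forall fun z =>
    spread_nonneg (fun x hx => by rw [hP]; exact zero_le_one) _ _) (h₁₂.add h₃)
    (Filter.Eventually.of_forall fun z => ?_)
  by_cases hz : z.1 ∈ R
  · simp only [spread, testFun, loss, ind, hz, if_true, hP]
    generalize f z.1 = a
    generalize g z.1 = b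
    generalize z.2 = y
    cases a <;> cases b <;> cases y <;> simp
  · simp only [spread, testFun, loss, ind, hz, if_false, hk z.1 hz]
    generalize f z.1 = a
    generalize g z.1 = b
    cases a <;> cases b <;> simp

/-- The mean contribution of a loss difference as a sum of two expectations. -/
lemma integral_drift_eq_add (hR : MeasurableSet R) (hf : Measurable f) (hg : Measurable g)
    (hkm : Measurable k) :
    ∫ z, drift (testFun g f true true) R k z ∂D =
      (∫ x, (ind (f x ≠ k x) - ind (g x ≠ k x)) * ind (x ∉ R) ∂D.fst)
    + ∫ z, (ind (f z.1 ≠ z.2) - ind (g z.1 ≠ z.2)) * ind (z.1 ∈ R) ∂D := by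
  have hb : ∀ {a b c : Prop}, ‖(ind a - ind b) * ind c‖ ≤ 1 := fun {a b c} => by
    by_cases ha : a <;> by_cases hb : b <;> by_cases hc : c <;> simp [ind, ha, hb, hc]
  have hm1 : Measurable fun x => (ind (f x ≠ k x) - ind (g x ≠ k x)) * ind (x ∉ R) :=
    ((measurable_ind (measurableSet_eq_fun hf hkm).compl).sub
      (measurable_ind (measurableSet_eq_fun hg hkm).compl)).mul (measurable_ind hR.compl)
  have hm2 : Measurable fun z : 𝒳 × Bool =>
      (ind (f z.1 ≠ z.2) - ind (g z.1 ≠ z.2)) * ind (z.1 ∈ R) :=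
    ((measurable_ind (measurableSet_err hf)).sub (measurable_ind (measurableSet_err hg))).mul
      (measurable_ind (measurable_fst hR))
  have hi1 : Integrable (fun z : 𝒳 × Bool =>
      (ind (f z.1 ≠ k z.1) - ind (g z.1 ≠ k z.1)) * ind (z.1 ∉ R)) D :=
    Integrable.of_bound (hm1.comp measurable_fst).aestronglyMeasurable 1
      (Filter.Eventually.of_forall fun _ => hb)
  rw [integral_fst_eq hm1, ← integral_add hi1
    (Integrable.of_bound hm2.aestronglyMeasurable 1 (Filter.Eventually.of_forall fun _ => hb))]
  refine integral_congr_ae (Filter.Eventually.of_forall fun z => ?_)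
  by_cases hz : z.1 ∈ R
  · simp only [drift, testFun, loss, ind, hz, if_true]
    generalize f z.1 = a
    generalize g z.1 = b
    generalize z.2 = y
    cases a <;> cases b <;> cases y <;> simp
  · simp only [drift, testFun, loss, ind, hz]
    generalize f z.1 = a
    generalize g z.1 = b
    generalize k z.1 = y
    cases a <;> cases b <;> cases y <;> simp

end Population

/-! ### Consequences of the constraints on the inputs -/

namespace Params.Admissible

variable {p : Params} {N : ℕ}

/-- The weights with which the thresholds of past epochs enter the second moments. -/
lemma sum_ratio_le (hp : p.Admissible N) {m : ℕ} (h1 : 1 ≤ m) (hm : m ≤ p.M) :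
    ∑ j ∈ Finset.Icc 1 m, ((p.τ j : ℝ) - (p.τ (j - 1) : ℝ)) *
      (if j ≤ 1 then 0 else 1 / (p.τ (j - 1) : ℝ)) ≤ 2 * Real.log (p.τ m) := by
  induction m, h1 using Nat.le_induction with
  | base =>
    have := hp.one_le_log le_rfl hm
    simp only [Finset.Icc_self, Finset.sum_singleton, le_refl, if_true, mul_zero]
    linarith
  | succ k hk ih =>
    rw [Finset.sum_Icc_succ_top (by omega), if_neg (by omega), Nat.add_sub_cancel]
    have h3 := hp.three_le hk (by omega)
    have h4 := hp.three_le (by omega : 1 ≤ k + 1) hm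
    have h5 : (p.τ k : ℝ) ≤ p.τ (k + 1) := by exact_mod_cast (hp.τ_lt k (by omega)).le
    have h6 : (p.τ (k + 1) : ℝ) ≤ 2 * p.τ k := by exact_mod_cast hp.τ_le k hk (by omega)
    have h7 := Real.one_sub_inv_le_log_of_pos
      (div_pos (by linarith : (0 : ℝ) < p.τ (k + 1)) (by linarith : (0 : ℝ) < p.τ k))
    rw [Real.log_div (by linarith) (by linarith), inv_div] at h7
    -- The doubling condition replaces the denominator `τ k` by `τ (k + 1)` at the cost of a factor
    -- `2`; then `1 - 1 / x ≤ log x` makes the sum telescope.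
    have h8 : ((p.τ (k + 1) : ℝ) - p.τ k) * (1 / p.τ k) ≤ 2 * (1 - p.τ k / p.τ (k + 1)) := by
      have e1 : 1 - (p.τ k : ℝ) / p.τ (k + 1) = (p.τ (k + 1) - p.τ k) / p.τ (k + 1) := by
        field_simp
      rw [e1, mul_one_div, ← mul_div_assoc, div_le_div_iff₀ (by linarith) (by linarith)]
      nlinarith
    linarith [ih (by omega)]

lemma eps_pos (hp : p.Admissible N) (hL : 1 ≤ Real.log (N / p.δ)) {m : ℕ} (h1 : 1 ≤ m)
    (hm : m ≤ p.M) : 0 < p.eps N m := by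
  have := hp.three_le h1 hm
  have := hp.one_le_log h1 hm
  unfold Params.eps
  positivity

lemma four_mul_le_c₁ (hp : p.Admissible N) : 4 * p.α ≤ p.c₁ := by
  have h1 : (2 : ℝ) ≤ √6 := Real.le_sqrt_of_sq_le (by norm_num)
  nlinarith [hp.c₁_ge, hp.α_ge]

lemma sq_c₁_ge (hp : p.Admissible N) : 24 * p.α ^ 2 ≤ p.c₁ ^ 2 := by
  have h1 : √6 ^ 2 = 6 := Real.sq_sqrt (by norm_num)
  have h2 : (2 * p.α * √6) ^ 2 ≤ p.c₁ ^ 2 :=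
    pow_le_pow_left₀ (by have := hp.α_ge; positivity) hp.c₁_ge 2
  nlinarith

lemma c₂_ge' (hp : p.Admissible N) : 6 * p.η * p.α ^ 2 ≤ p.c₂ := by
  nlinarith [hp.c₂_ge, hp.sq_c₁_ge, hp.η_ge]

lemma log_tau_le_log_n (hp : p.Admissible N) {m : ℕ} (h1 : 1 ≤ m) (hm : m ≤ p.M) :
    Real.log (p.τ m) ≤ Real.log p.n := by
  have := hp.three_le h1 hm
  exact Real.log_le_log (by linarith) (by exact_mod_cast (hp.mono hm le_rfl).trans hp.τ_le_n)

/-- The product `n ε_M log n`, which dominates `τ_m ε_m log τ_m`. -/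
lemma tau_eps_log_le (hp : p.Admissible N) (hL : 1 ≤ Real.log (N / p.δ)) {m : ℕ} (h1 : 1 ≤ m)
    (hm : m ≤ p.M) :
    p.τ m * p.eps N m * Real.log (p.τ m) ≤ p.n * p.eps N p.M * Real.log p.n := by
  have := hp.le_n_mul_eps hL
  have := hp.one_le_log h1 hm
  exact mul_le_mul (hp.tau_mul_eps_le hL h1 hm) (hp.log_tau_le_log_n h1 hm) (by linarith) (by linarith)

lemma scale_pos (hp : p.Admissible N) (hL : 1 ≤ Real.log (N / p.δ)) :
    0 < p.n * p.eps N p.M * Real.log p.n := by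
  have h1 := hp.tau_eps_log_le hL hp.one_le_M le_rfl
  have h2 := hp.one_le_log hp.one_le_M le_rfl
  have h3 := hp.eps_pos hL hp.one_le_M le_rfl
  have h4 := hp.three_le hp.one_le_M le_rfl
  refine lt_of_lt_of_le ?_ h1
  positivity

lemma γ_pos (hp : p.Admissible N) : 0 < p.γ := by linarith [hp.γ_ge, hp.η_ge]

/-- Only the product of `β ^ 2` and `γ` enters the second moments, and the `γ` in the constraint on
`β` cancels. -/
lemma βγ_le (hp : p.Admissible N) (hL : 1 ≤ Real.log (N / p.δ)) :
    p.β ^ 2 * p.γ ≤ p.η / (864 * (p.n * p.eps N p.M * Real.log p.n)) := by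
  have hX := hp.scale_pos hL
  have hγ := hp.γ_pos
  have h := mul_le_mul_of_nonneg_right hp.β_le hγ.le
  refine h.trans_eq ?_
  rw [show 864 * p.γ * p.n * p.eps N p.M * Real.log p.n =
    p.γ * (864 * (p.n * p.eps N p.M * Real.log p.n)) by ring]
  field_simp

lemma ξ_le' (hp : p.Admissible N) :
    p.ξ ≤ 1 / (8 * (p.n * p.eps N p.M * Real.log p.n)) := by
  refine hp.ξ_le.trans_eq ?_
  ring_nf

end Params.Admissible

/-! ### Thresholds, biased regrets and second moments along a path -/

section Pathwise

variable {Ω 𝒳 : Type*} [mΩ : MeasurableSpace Ω] [m𝒳 : MeasurableSpace 𝒳]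
  {μ : Measure Ω} {ℱ : Filtration ℕ mΩ} {D : Measure (𝒳 × Bool)} {p : Params}
  {H : Finset (𝒳 → Bool)} {T : Trace Ω 𝒳} {ω : Ω} {g f : 𝒳 → Bool}

namespace IsRun

lemma empErr_nonneg (hT : IsRun μ ℱ D p H T) (hp : p.Admissible H.card) {m : ℕ} (hm : m ≤ p.M) :
    0 ≤ empErr f (T.Z p H ω m) := by
  rw [empErr_eq_div hp hm]
  exact div_nonneg (hT.weightedSum_nonneg (loss_nonneg f) hm ω) (Nat.cast_nonneg _)

omit mΩ m𝒳 in
lemma Delta_eq {m : ℕ} (h1 : 1 ≤ m) (ω : Ω) : T.Delta p H m ω =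
    p.c₁ * √(p.eps H.card m * empErr (T.h (m + 1) ω) (T.Z p H ω m)) +
      p.c₂ * p.eps H.card m * Real.log (p.τ m) :=
  if_neg (by omega)

omit mΩ m𝒳 in
lemma Delta_nonneg (hp : p.Admissible H.card) (hL : 1 ≤ Real.log (H.card / p.δ)) {m : ℕ}
    (hm : m ≤ p.M) (ω : Ω) : 0 ≤ T.Delta p H m ω := by
  have hc1 := hp.four_mul_le_c₁
  have hc2 := hp.c₂_ge'
  have hα := hp.α_ge
  have hη := hp.η_ge
  have hc1' : 0 ≤ p.c₁ := by linarith
  have hc2' : 0 ≤ p.c₂ := le_trans (by positivity) hc2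
  by_cases h0 : m = 0
  · subst h0
    have h1 := hp.eps_pos hL le_rfl hp.one_le_M
    have h2 := one_le_log_three
    simp only [Trace.Delta, Params.threshold, if_true]
    positivity
  · have h1 : 1 ≤ m := by omega
    have h2 := hp.eps_pos hL h1 hm
    have h3 := hp.one_le_log h1 hm
    rw [Delta_eq h1]
    positivity

omit mΩ m𝒳 in
lemma tau_mul_Delta (hp : p.Admissible H.card) {m : ℕ} (h1 : 1 ≤ m) (hm : m ≤ p.M) (ω : Ω) :
    p.τ m * T.Delta p H m ω = p.c₁ * √(p.τ m * p.eps H.card m * T.minSum p H m ω) +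
      p.c₂ * (p.τ m * p.eps H.card m) * Real.log (p.τ m) := by
  have h3 := hp.three_le h1 hm
  rw [Delta_eq h1, ← tau_mul_empErr_h hp h1 hm, show (p.τ m : ℝ) * p.eps H.card m *
    (p.τ m * empErr (T.h (m + 1) ω) (T.Z p H ω m)) =
    (p.τ m : ℝ) ^ 2 * (p.eps H.card m * empErr (T.h (m + 1) ω) (T.Z p H ω m)) by ring,
    Real.sqrt_mul (sq_nonneg _), Real.sqrt_sq (by linarith)]
  ring

/-- After multiplication by `τ`, the threshold is built from `τ ε`, `minSum` and `log τ`, all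
nondecreasing. Past thresholds are thus controlled by the current one. -/
lemma tau_mul_Delta_mono (hT : IsRun μ ℱ D p H T) (hp : p.Admissible H.card)
    (hL : 1 ≤ Real.log (H.card / p.δ)) {i m : ℕ} (h1 : 1 ≤ i) (hi : i ≤ m) (hm : m ≤ p.M) (ω : Ω) :
    p.τ i * T.Delta p H i ω ≤ p.τ m * T.Delta p H m ω := by
  rw [tau_mul_Delta hp h1 (hi.trans hm), tau_mul_Delta hp (h1.trans hi) hm]
  have hc1 := hp.four_mul_le_c₁
  have hc2 := hp.c₂_ge'
  have hα := hp.α_ge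
  have hη := hp.η_ge
  have hc1' : 0 ≤ p.c₁ := by linarith
  have hc2' : 0 ≤ p.c₂ := le_trans (by positivity) hc2
  have h3 := hp.three_le h1 (hi.trans hm)
  have hlog : Real.log (p.τ i) ≤ Real.log (p.τ m) :=
    Real.log_le_log (by linarith) (by exact_mod_cast hp.mono hi hm)
  have hlog1 := hp.one_le_log h1 (hi.trans hm)
  have he : p.τ i * p.eps H.card i ≤ p.τ m * p.eps H.card m := by
    rw [hp.tau_mul_eps h1 (hi.trans hm), hp.tau_mul_eps (h1.trans hi) hm]
    linarith
  have he0 : 0 ≤ p.τ i * p.eps H.card i :=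
    mul_nonneg (by linarith) (hp.eps_pos hL h1 (hi.trans hm)).le
  have hs := hT.minSum_mono hp h1 hi hm ω
  have hs0 := hT.minSum_nonneg (hi.trans hm) ω
  have he1 := he0.trans he
  have hce := mul_nonneg hc2' he1
  gcongr

lemma measurable_h_apply (hT : IsRun μ ℱ D p H T) (hH : ∀ f ∈ H, Measurable f) {m : ℕ}
    (hm : m ≤ p.M) : Measurable (T.h (m + 1) ω) := hH _ (hT.erm_mem m hm ω)

omit mΩ in
-- For fixed `ω` this is the joint measurability statement over a one-point parameter space.
lemma measurableSet_region_apply (hH : ∀ f ∈ H, Measurable f) (m : ℕ) (ω : Ω) :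
    MeasurableSet (T.region p H m ω) := by
  classical
  have h := measurableSet_disagreement (Λ := Unit) (mΛ := ⊤) hH (A := fun _ => T.A p H m ω)
    (fun _ f hf => hf.1) (fun f _ => MeasurableSpace.measurableSet_top)
  exact (@measurable_prodMk_left Unit 𝒳 ⊤ _ ()) h

lemma h_mem_A (hT : IsRun μ ℱ D p H T) (hp : p.Admissible H.card)
    (hL : 1 ≤ Real.log (H.card / p.δ)) {m : ℕ} (hm : m ≤ p.M) (ω : Ω) :
    T.h (m + 1) ω ∈ T.A p H (m + 1) ω := by
  refine ⟨hT.erm_mem m hm ω, ?_⟩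
  rw [empReg, sub_self]
  exact mul_nonneg hp.γ_pos.le (Delta_nonneg hp hL hm ω)

/-- Both classifiers lie in `A`, hence agree off its disagreement region. For `g = h*` this says
that predicted labels are those of `h*`. -/
lemma h_eq_of_mem_A (hT : IsRun μ ℱ D p H T) (hp : p.Admissible H.card)
    (hL : 1 ≤ Real.log (H.card / p.δ)) {m : ℕ} (hm : m ≤ p.M) (hg : g ∈ T.A p H (m + 1) ω) :
    ∀ x, x ∉ T.region p H (m + 1) ω → T.h (m + 1) ω x = g x := by
  intro x hx
  by_contra hne
  exact hx ⟨_, hT.h_mem_A hp hL hm ω, g, hg, hne⟩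

omit mΩ m𝒳 in
-- The initial sample is empty, so all empirical regrets vanish.
lemma mem_A_one (hp : p.Admissible H.card) (hL : 1 ≤ Real.log (H.card / p.δ)) (hg : g ∈ H) (ω : Ω) :
    g ∈ T.A p H 1 ω := by
  refine ⟨hg, ?_⟩
  have h : empReg g (T.h 1 ω) (T.Z p H ω (1 - 1)) = 0 := by
    simp [empReg, empErr, Trace.Z]
  rw [h]
  exact mul_nonneg hp.γ_pos.le (Delta_nonneg hp hL (Nat.zero_le _) ω)

variable [IsProbabilityMeasure D]

lemma mean_diff (hT : IsRun μ ℱ D p H T) (hH : ∀ f ∈ H, Measurable f) (hg : g ∈ H) (hf : f ∈ H)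
    {m : ℕ} (hm : m ≤ p.M) :
    T.mean p H D (testFun g f true true) (m + 1) ω = T.regEpoch p H D (m + 1) ω f g :=
  integral_drift_eq_add (measurableSet_region_apply hH _ _) (hH f hf) (hH g hg)
    (hT.measurable_h_apply hH hm)

lemma regEpoch_eq (hT : IsRun μ ℱ D p H T) (hp : p.Admissible H.card)
    (hL : 1 ≤ Real.log (H.card / p.δ)) (hH : ∀ f ∈ H, Measurable f) (hf : f ∈ H)
    {m : ℕ} (hm : m ≤ p.M) (hg : g ∈ T.A p H (m + 1) ω) :
    T.regEpoch p H D (m + 1) ω f g = disOff D (T.region p H (m + 1) ω) f g +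
      T.errEpoch p H D (m + 1) ω f - T.errEpoch p H D (m + 1) ω g := by
  rw [← hT.mean_diff hH hg.1 hf hm]
  exact integral_drift_diff (measurableSet_region_apply hH _ _) (hH f hf) (hH g hg.1)
    (hT.h_eq_of_mem_A hp hL hm hg)

omit [IsProbabilityMeasure D] in
lemma mean_loss (hT : IsRun μ ℱ D p H T) (hp : p.Admissible H.card)
    (hL : 1 ≤ Real.log (H.card / p.δ)) (hH : ∀ f ∈ H, Measurable f)
    {m : ℕ} (hm : m ≤ p.M) (hg : g ∈ T.A p H (m + 1) ω) :
    T.mean p H D (testFun g g true false) (m + 1) ω = T.errEpoch p H D (m + 1) ω g :=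
  integral_drift_loss (measurableSet_region_apply hH _ _) (hH g hg.1)
    (hT.h_eq_of_mem_A hp hL hm hg)

lemma err_sub_le_regEpoch (hT : IsRun μ ℱ D p H T) (hp : p.Admissible H.card)
    (hL : 1 ≤ Real.log (H.card / p.δ)) (hH : ∀ f ∈ H, Measurable f) (hf : f ∈ H)
    {m : ℕ} (hm : m ≤ p.M) (hg : g ∈ T.A p H (m + 1) ω) :
    err D f - err D g ≤ T.regEpoch p H D (m + 1) ω f g := by
  rw [hT.regEpoch_eq hp hL hH hf hm hg]
  exact err_sub_err_le (measurableSet_region_apply hH _ _) (hH f hf) (hH g hg.1)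

omit mΩ [IsProbabilityMeasure D] in
lemma errEpoch_nonneg (m : ℕ) (f : 𝒳 → Bool) : 0 ≤ T.errEpoch p H D m ω f := measureReal_nonneg

omit mΩ [IsProbabilityMeasure D] in
lemma tau_mul_regBar (hp : p.Admissible H.card) {m : ℕ} (h1 : 1 ≤ m) (hm : m ≤ p.M)
    (f g : 𝒳 → Bool) : p.τ m * T.regBar p H D m ω f g = ∑ j ∈ Finset.Icc 1 m,
      ((p.τ j : ℝ) - (p.τ (j - 1) : ℝ)) * T.regEpoch p H D j ω f g := by
  have h3 := hp.three_le h1 hm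
  unfold Trace.regBar
  field_simp

omit mΩ [IsProbabilityMeasure D] in
lemma tau_mul_errBar (hp : p.Admissible H.card) {m : ℕ} (h1 : 1 ≤ m) (hm : m ≤ p.M)
    (f : 𝒳 → Bool) : p.τ m * T.errBar p H D m ω f = ∑ j ∈ Finset.Icc 1 m,
      ((p.τ j : ℝ) - (p.τ (j - 1) : ℝ)) * T.errEpoch p H D j ω f := by
  have h3 := hp.three_le h1 hm
  unfold Trace.errBar
  field_simp

lemma regEpoch_nonneg (hT : IsRun μ ℱ D p H T) (hp : p.Admissible H.card)
    (hL : 1 ≤ Real.log (H.card / p.δ)) (hH : ∀ f ∈ H, Measurable f) (hbest : IsBest D H g)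
    (hf : f ∈ H) {j : ℕ} (hj1 : 1 ≤ j) (hj : j ≤ p.M) (hg : g ∈ T.A p H j ω) :
    0 ≤ T.regEpoch p H D j ω f g := by
  obtain ⟨i, rfl⟩ : ∃ i, j = i + 1 := ⟨j - 1, by omega⟩
  have := hT.err_sub_le_regEpoch hp hL hH hf (by omega : i ≤ p.M) hg
  linarith [hbest.2 f hf]

/-- Optimality of `g` makes every summand nonnegative, so the partial sums increase. -/
lemma tau_mul_regBar_mono (hT : IsRun μ ℱ D p H T) (hp : p.Admissible H.card)
    (hL : 1 ≤ Real.log (H.card / p.δ)) (hH : ∀ f ∈ H, Measurable f) (hbest : IsBest D H g)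
    (hf : f ∈ H) {i m : ℕ} (h1 : 1 ≤ i) (hi : i ≤ m) (hm : m ≤ p.M)
    (hg : ∀ j, 1 ≤ j → j ≤ m → g ∈ T.A p H j ω) :
    p.τ i * T.regBar p H D i ω f g ≤ p.τ m * T.regBar p H D m ω f g := by
  rw [tau_mul_regBar hp h1 (hi.trans hm), tau_mul_regBar hp (h1.trans hi) hm]
  refine Finset.sum_le_sum_of_subset_of_nonneg (Finset.Icc_subset_Icc_right hi) fun j hj _ => ?_
  obtain ⟨hj1, hj2⟩ := Finset.mem_Icc.1 hj
  exact mul_nonneg (hp.width_nonneg (hj2.trans hm))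
    (hT.regEpoch_nonneg hp hL hH hbest hf hj1 (hj2.trans hm) (hg j hj1 hj2))

lemma err_sub_le_regBar (hT : IsRun μ ℱ D p H T) (hp : p.Admissible H.card)
    (hL : 1 ≤ Real.log (H.card / p.δ)) (hH : ∀ f ∈ H, Measurable f)
    (hf : f ∈ H) {m : ℕ} (h1 : 1 ≤ m) (hm : m ≤ p.M)
    (hg : ∀ j, 1 ≤ j → j ≤ m → g ∈ T.A p H j ω) :
    err D f - err D g ≤ T.regBar p H D m ω f g := by
  have h3 := hp.three_le h1 hm
  refine le_of_mul_le_mul_left ?_ (by linarith : (0 : ℝ) < p.τ m)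
  rw [tau_mul_regBar hp h1 hm, ← hp.sum_width m, Finset.sum_mul]
  refine Finset.sum_le_sum fun j hj => ?_
  obtain ⟨hj1, hj2⟩ := Finset.mem_Icc.1 hj
  refine mul_le_mul_of_nonneg_left ?_ (hp.width_nonneg (hj2.trans hm))
  obtain ⟨i, rfl⟩ : ∃ i, j = i + 1 := ⟨j - 1, by omega⟩
  exact hT.err_sub_le_regEpoch hp hL hH hf (by omega) (hg _ hj1 hj2)

/-- The second moment of the loss differences in the first epoch. -/
lemma moment_diff_one_le (hT : IsRun μ ℱ D p H T) (hp : p.Admissible H.card)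
    (hL : 1 ≤ Real.log (H.card / p.δ)) (hH : ∀ f ∈ H, Measurable f) (hf : f ∈ H) (hg : g ∈ H) :
    T.moment p H D (testFun g f true true) 1 ω ≤
      T.regEpoch p H D 1 ω f g + 2 * T.errEpoch p H D 1 ω g := by
  have hA := mem_A_one (T := T) hp hL hg ω
  have h := integral_spread_diff_le_of_eq_one (D := D)
    (measurableSet_region_apply (T := T) (p := p) hH 1 ω) (hH f hf) (hH g hg)
    (hT.h_eq_of_mem_A hp hL (Nat.zero_le _) hA) (hT.prob_one ω)
  rw [hT.regEpoch_eq hp hL hH hf (Nat.zero_le _) hA]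
  refine h.trans_eq ?_
  unfold Trace.errEpoch errOn
  ring

/-- The second moment of the loss differences in a later epoch. -/
lemma moment_diff_le (hT : IsRun μ ℱ D p H T) (hp : p.Admissible H.card)
    (hL : 1 ≤ Real.log (H.card / p.δ)) (hH : ∀ f ∈ H, Measurable f) (hf : f ∈ H)
    {i : ℕ} (h1 : 1 ≤ i) (hi : i < p.M) (hg : g ∈ T.A p H (i + 1) ω) :
    T.moment p H D (testFun g f true true) (i + 1) ω ≤
      2 * p.α ^ 2 * (T.regEpoch p H D (i + 1) ω f g +
        2 * (err D (T.h (i + 1) ω) - err D g) + 4 * T.errEpoch p H D (i + 1) ω g) +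
      2 * (p.β ^ 2 * p.γ) * (empReg f (T.h (i + 1) ω) (T.Z p H ω i) +
        empReg g (T.h (i + 1) ω) (T.Z p H ω i)) * (p.τ i * T.Delta p H i ω) +
      2 * p.ξ * (p.τ i * T.Delta p H i ω ^ 2) := by
  have hR := measurableSet_region_apply (T := T) (p := p) hH (i + 1) ω
  have hk := hT.h_eq_of_mem_A hp hL hi.le hg
  have hkm := hT.measurable_h_apply (ω := ω) hH hi.le
  have hfeas := (hT.prob_solution (i + 1) (by omega) (by omega) ω).1
  have hw := two_le_maxWeight (T := T) hp h1 hi.le ω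
  have h := integral_spread_diff_le (D := D) hR (hH f hf) (hH g hg.1) hkm hk hfeas.measurable
    (hT.inv_P_le hi (by linarith) (hT.one_le_maxWeight_mul_pLow hp hL h1 hi.le le_rfl ω))
  have hvf := hfeas.variance f hf
  have hvg := hfeas.variance g hg.1
  have hmf := disagreement_mass_le (D := D) hR (hH f hf) hkm
  have hmg := disagreement_mass_le (D := D) hR (hH g hg.1) hkm
  -- Since `h_{i+1}` and `g` agree off the region, the error of `h_{i+1}` inside it is that of `g`
  -- plus the true excess error; hence the coefficients `2` and `4` in the statement.
  have heq := err_sub_err_eq (D := D) hR hkm (hH g hg.1) hk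
  unfold Trace.varBound at hvf hvg
  rw [Nat.add_sub_cancel] at hvf hvg
  rw [hT.regEpoch_eq hp hL hH hf hi.le hg, heq]
  have hd : 0 ≤ disOff D (T.region p H (i + 1) ω) f g := measureReal_nonneg
  have hα : 1 ≤ p.α ^ 2 := one_le_pow₀ hp.α_ge
  have e1 := mul_le_mul_of_nonneg_left hmf (by positivity : 0 ≤ 2 * p.α ^ 2)
  have e2 := mul_le_mul_of_nonneg_left hmg (by positivity : 0 ≤ 2 * p.α ^ 2)
  have e3 : disOff D (T.region p H (i + 1) ω) f g ≤
      2 * p.α ^ 2 * disOff D (T.region p H (i + 1) ω) f g := by nlinarith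
  have eF : T.errEpoch p H D (i + 1) ω f = errOn D (T.region p H (i + 1) ω) f := rfl
  have eG : T.errEpoch p H D (i + 1) ω g = errOn D (T.region p H (i + 1) ω) g := rfl
  rw [eF, eG]
  refine h.trans ?_
  linarith

end IsRun

end Pathwise

/-! ### Real inequalities that absorb the variance -/

/-- The contribution of one epoch to the second moment, in terms of the current threshold. -/
lemma epoch_moment_le {α η b ξ X a E eG q t d rb Tm B : ℝ} (hX : 0 < X) (hη : 0 ≤ η)
    (hb0 : 0 ≤ b) (hb : b ≤ η / (864 * X)) (hξ : ξ ≤ 1 / (8 * X)) (ht : 0 < t) (hd : 0 ≤ d)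
    (hrb : 0 ≤ rb) (hq : q ≤ 3 / 2 * rb + 3 / 4 * η * d) (hE : E ≤ η / 2 * d) (hT : t * d ≤ Tm)
    (hB : t * rb ≤ B) :
    2 * α ^ 2 * (a + 2 * E + 4 * eG) + 2 * b * q * (t * d) + 2 * ξ * (t * d ^ 2) ≤
      2 * α ^ 2 * (a + 4 * eG) + 1 / t * (2 * α ^ 2 * η * Tm + η / (288 * X) * B * Tm +
        η ^ 2 / (576 * X) * Tm ^ 2 + 1 / (4 * X) * Tm ^ 2) := by
  -- Here `t`, `d`, `rb` are the size, threshold and population regret of the past epoch. Each term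
  -- is rewritten as `1 / t` times products of `t * d` and `t * rb`, the combinations that are
  -- monotone over epochs.
  have htd : 0 ≤ t * d := by positivity
  have hTm : 0 ≤ Tm := htd.trans hT
  have hB0 : 0 ≤ B := le_trans (by positivity) hB
  have h1 : 2 * α ^ 2 * (2 * E) ≤ 1 / t * (2 * α ^ 2 * η * Tm) := by
    calc 2 * α ^ 2 * (2 * E) ≤ 2 * α ^ 2 * (2 * (η / 2 * d)) := by gcongr
      _ = 1 / t * (2 * α ^ 2 * η * (t * d)) := by field_simp
      _ ≤ _ := by gcongr
  have h2 : 2 * b * q * (t * d) ≤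
      1 / t * (η / (288 * X) * B * Tm + η ^ 2 / (576 * X) * Tm ^ 2) := by
    calc 2 * b * q * (t * d) ≤ 2 * b * (3 / 2 * rb + 3 / 4 * η * d) * (t * d) := by gcongr
      _ ≤ 2 * (η / (864 * X)) * (3 / 2 * rb + 3 / 4 * η * d) * (t * d) := by gcongr
      _ = 1 / t * (η / (288 * X) * (t * rb) * (t * d) + η ^ 2 / (576 * X) * (t * d) ^ 2) := by
        field_simp
        ring
      _ ≤ _ := by gcongr
  have h3 : 2 * ξ * (t * d ^ 2) ≤ 1 / t * (1 / (4 * X) * Tm ^ 2) := by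
    calc 2 * ξ * (t * d ^ 2) ≤ 2 * (1 / (8 * X)) * (t * d ^ 2) := by gcongr
      _ = 1 / t * (1 / (4 * X) * (t * d) ^ 2) := by
        field_simp
        ring
      _ ≤ _ := by gcongr
  linarith

lemma sqrt_deviation {τ ε V u R : ℝ} (hτ : 0 < τ) (hu : u = 3 / 32 * (τ * ε)) :
    2 * √(u * V) + 2 * u * R = τ * (√(3 / 8 * (ε * (V / τ))) + 3 / 16 * (ε * R)) := by
  have h : √(3 / 8 * (ε * (V / τ))) = √((2 / τ) ^ 2 * (u * V)) := by
    congr 1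
    rw [hu]
    field_simp
    ring
  rw [h, Real.sqrt_mul (sq_nonneg _), Real.sqrt_sq (by positivity), hu]
  field_simp
  ring

/-- Used with `X = n ε_M`, this bounds the square root part of `ε_m * maxWeight` by the square root
part of the threshold. -/
lemma mul_sqrt_div_le {ε τ e X : ℝ} (hε : 0 < ε) (hτ : 0 < τ) (he : 0 ≤ e) (hX : τ * ε ≤ X) :
    ε * √(τ * e / X) ≤ √(ε * e) := by
  have hτε : 0 < τ * ε := by positivity
  refine Real.le_sqrt_of_sq_le ?_
  rw [mul_pow, Real.sq_sqrt (div_nonneg (by positivity) (hτε.le.trans hX))]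
  calc ε ^ 2 * (τ * e / X) ≤ ε ^ 2 * (τ * e / (τ * ε)) := by gcongr
    _ = ε * e := by field_simp

/-- The variance term of the deviation bound is absorbed by the regret and the threshold. -/
lemma sqrt_variance_le {α η ε ℓ c₁ c₂ e Δ τ X V rb r eb R : ℝ} (hα : 1 ≤ α) (hη : 864 ≤ η)
    (hε : 0 < ε) (hℓ : 1 ≤ ℓ) (hc₁ : 0 ≤ c₁) (hc₁' : 24 * α ^ 2 ≤ c₁ ^ 2)
    (hc₂ : 6 * η * α ^ 2 ≤ c₂) (he : 0 ≤ e) (hΔ : Δ = c₁ * √(ε * e) + c₂ * ε * ℓ) (hτ : 0 < τ)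
    (hX : τ * ε * ℓ ≤ X) (hrb : 0 ≤ rb) (hr : 0 ≤ r)
    (hR : ε * R ≤ Δ / 4) (heb : eb ≤ 2 * (e + r) + 3 / 4 * (ε * R))
    (hV : V ≤ 2 * α ^ 2 * (τ * rb + 4 * (τ * eb)) + 2 * ℓ * (2 * α ^ 2 * η * (τ * Δ) +
      η / (288 * X) * (τ * rb) * (τ * Δ) + η ^ 2 / (576 * X) * (τ * Δ) ^ 2 +
      1 / (4 * X) * (τ * Δ) ^ 2)) :
    √(3 / 8 * (ε * (V / τ))) ≤ (rb + r) / 4 + η * Δ / 10 := by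
  have hX0 : 0 < X := lt_of_lt_of_le (by positivity) hX
  have hc₂0 : 0 ≤ c₂ := le_trans (by positivity) hc₂
  have hs : 0 ≤ c₁ * √(ε * e) := by positivity
  have hΔ2 : c₂ * (ε * ℓ) ≤ Δ := by rw [hΔ]; linarith
  have hΔ0 : 0 ≤ Δ := le_trans (by positivity) hΔ2
  -- The `c₂` part of the threshold absorbs `η α² ε log τ`; the `c₁` part, in `n3`, absorbs `α² ε
  -- e`.
  have n1 : 6 * η * (α ^ 2 * (ε * ℓ)) ≤ Δ := by
    refine le_trans ?_ hΔ2
    calc 6 * η * (α ^ 2 * (ε * ℓ)) = 6 * η * α ^ 2 * (ε * ℓ) := by ring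
      _ ≤ _ := by gcongr
  have n1' : 6 * η * (α ^ 2 * ε) ≤ Δ := by
    refine le_trans ?_ n1
    have : ε ≤ ε * ℓ := by nlinarith
    gcongr
  have n3 : 24 * (α ^ 2 * (ε * e)) ≤ Δ ^ 2 := by
    have h1 : (c₁ * √(ε * e)) ^ 2 ≤ Δ ^ 2 := by
      gcongr
      rw [hΔ]
      have : 0 ≤ c₂ * ε * ℓ := by positivity
      linarith
    rw [mul_pow, Real.sq_sqrt (by positivity)] at h1
    have h2 : 24 * α ^ 2 * (ε * e) ≤ c₁ ^ 2 * (ε * e) := by gcongr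
    linarith
  -- The factor `log τ_m` from summing over epochs is paid for by `X`, which stands for `n ε_M log
  -- n`.
  have hy : τ * ε * ℓ / X ≤ 1 := (div_le_one hX0).2 hX
  have hV2 : ε * (V / τ) ≤ 2 * (α ^ 2 * ε) * rb + 8 * (α ^ 2 * ε) * eb +
      4 * η * (α ^ 2 * (ε * ℓ)) * Δ + τ * ε * ℓ / X *
        (η / 144 * (rb * Δ) + η ^ 2 / 288 * Δ ^ 2 + 1 / 2 * Δ ^ 2) := by
    calc ε * (V / τ) ≤ ε * ((2 * α ^ 2 * (τ * rb + 4 * (τ * eb)) + 2 * ℓ *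
          (2 * α ^ 2 * η * (τ * Δ) + η / (288 * X) * (τ * rb) * (τ * Δ) +
          η ^ 2 / (576 * X) * (τ * Δ) ^ 2 + 1 / (4 * X) * (τ * Δ) ^ 2)) / τ) := by gcongr
      _ = _ := by
        field_simp
        ring
  have n4 : τ * ε * ℓ / X * (η / 144 * (rb * Δ) + η ^ 2 / 288 * Δ ^ 2 + 1 / 2 * Δ ^ 2) ≤
      η / 144 * (rb * Δ) + η ^ 2 / 288 * Δ ^ 2 + 1 / 2 * Δ ^ 2 := by
    refine (mul_le_mul_of_nonneg_right hy ?_).trans_eq (one_mul _)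
    positivity
  have hαε : 0 ≤ α ^ 2 * ε := by positivity
  have n5 : α ^ 2 * ε ≤ Δ / 5184 := by nlinarith
  -- The three terms come from `e`, `r` and the range term: `16 / 24`, `16 / 5184` and `(3 / 2) /
  -- 5184`, where `5184 = 6 * 864`.
  have n6 : 8 * (α ^ 2 * ε) * eb ≤ 2 / 3 * Δ ^ 2 + Δ / 324 * r + Δ ^ 2 / 3456 := by
    have h1 : 8 * (α ^ 2 * ε) * eb ≤ 8 * (α ^ 2 * ε) * (2 * (e + r) + 3 / 4 * (Δ / 4)) := by
      gcongr
      linarith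
    have h2 : α ^ 2 * ε * r ≤ Δ / 5184 * r := by gcongr
    have h3 : α ^ 2 * ε * Δ ≤ Δ / 5184 * Δ := by gcongr
    nlinarith
  have n7 : α ^ 2 * ε * rb ≤ Δ / 5184 * rb := by gcongr
  have n8 : 4 * η * (α ^ 2 * (ε * ℓ)) * Δ ≤ 2 / 3 * Δ * Δ :=
    mul_le_mul_of_nonneg_right (by linarith) hΔ0
  have hrbΔ : 0 ≤ rb * Δ := by positivity
  have hrΔ : 0 ≤ r * Δ := by positivity
  have hΔΔ : 0 ≤ Δ ^ 2 := by positivity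
  have n9 : ε * (V / τ) ≤ η * ((rb + r) * Δ) / 140 + η ^ 2 * Δ ^ 2 / 280 := by
    have m1 : 864 * (rb * Δ) ≤ η * (rb * Δ) := by gcongr
    have m2 : 864 * (r * Δ) ≤ η * (r * Δ) := by gcongr
    have m3 : 864 ^ 2 * Δ ^ 2 ≤ η ^ 2 * Δ ^ 2 := by gcongr
    linarith
  refine Real.sqrt_le_iff.2 ⟨by positivity, ?_⟩
  have hηΔ : 0 ≤ η * ((rb + r) * Δ) := by positivity
  have hηΔ2 : 0 ≤ η ^ 2 * Δ ^ 2 := by positivity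
  -- The cross term and the last square already dominate `3 / 8` times the bound `n9`; the square of
  -- `rb + r` is only discarded.
  have hsq : ((rb + r) / 4 + η * Δ / 10) ^ 2 =
      (rb + r) ^ 2 / 16 + η * ((rb + r) * Δ) / 20 + η ^ 2 * Δ ^ 2 / 100 := by ring
  rw [hsq]
  linarith [sq_nonneg (rb + r)]

/-! ### The induction over epochs -/

section Pathwise

variable {Ω 𝒳 : Type*} [mΩ : MeasurableSpace Ω] [m𝒳 : MeasurableSpace 𝒳]
  {μ : Measure Ω} {ℱ : Filtration ℕ mΩ} {D : Measure (𝒳 × Bool)} [IsProbabilityMeasure D]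
  {p : Params} {H : Finset (𝒳 → Bool)} {T : Trace Ω 𝒳} {ω : Ω} {g f : 𝒳 → Bool}

namespace IsRun

omit mΩ m𝒳 in
lemma weightedSum_diff (hp : p.Admissible H.card) {m : ℕ} (h1 : 1 ≤ m) (hm : m ≤ p.M) (ω : Ω)
    (f g : 𝒳 → Bool) : weightedSum (testFun g f true true) (T.Z p H ω m) =
      p.τ m * empReg f g (T.Z p H ω m) := by
  have h3 := hp.three_le h1 hm
  have : testFun g f true true = fun z => loss f z - loss g z := by
    funext z
    simp [testFun]
  rw [this, weightedSum_sub, empReg, empErr_eq_div hp hm, empErr_eq_div hp hm]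
  field_simp

omit mΩ m𝒳 in
lemma weightedSum_loss (hp : p.Admissible H.card) {m : ℕ} (h1 : 1 ≤ m) (hm : m ≤ p.M) (ω : Ω)
    (g : 𝒳 → Bool) : weightedSum (testFun g g true false) (T.Z p H ω m) =
      p.τ m * empErr g (T.Z p H ω m) := by
  have h3 := hp.three_le h1 hm
  have : testFun g g true false = loss g := by
    funext z
    simp [testFun]
  rw [this, empErr_eq_div hp hm]
  field_simp

omit m𝒳 in
lemma dev_eq (hp : p.Admissible H.card) {m : ℕ} (h1 : 1 ≤ m) (hm : m ≤ p.M) :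
    p.dev H.card m = 3 / 32 * (p.τ m * p.eps H.card m) := by
  rw [hp.tau_mul_eps h1 hm, Params.dev]
  ring

/-- The deviation of empirical regrets on the good event. -/
lemma abs_empReg_sub_le (hT : IsRun μ ℱ D p H T) (hp : p.Admissible H.card)
    (hL : 1 ≤ Real.log (H.card / p.δ)) (hH : ∀ f ∈ H, Measurable f) (hgood : T.Good p H D g ω)
    (hg : g ∈ H) (hf : f ∈ H) {m : ℕ} (h1 : 1 ≤ m) (hm : m ≤ p.M) :
    |empReg f g (T.Z p H ω m) - T.regBar p H D m ω f g| ≤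
      √(3 / 8 * (p.eps H.card m * ((∑ j ∈ Finset.Icc 1 m, ((p.τ j : ℝ) - (p.τ (j - 1) : ℝ)) *
        T.moment p H D (testFun g f true true) j ω) / p.τ m))) +
      3 / 16 * (p.eps H.card m * T.maxWeight p H m ω) := by
  have h3 := hp.three_le h1 hm
  have h0 : (0 : ℝ) < p.τ m := by linarith
  have h := hT.abs_sub_le_of_good hp hL hgood h1 hm hf true
  have hmean : ∑ j ∈ Finset.Icc 1 m, ((p.τ j : ℝ) - (p.τ (j - 1) : ℝ)) *
      T.mean p H D (testFun g f true true) j ω = p.τ m * T.regBar p H D m ω f g := by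
    rw [tau_mul_regBar hp h1 hm]
    refine Finset.sum_congr rfl fun j hj => ?_
    obtain ⟨hj1, hj2⟩ := Finset.mem_Icc.1 hj
    obtain ⟨i, rfl⟩ : ∃ i, j = i + 1 := ⟨j - 1, by omega⟩
    rw [hT.mean_diff hH hg hf (by omega)]
  rw [hmean, weightedSum_diff hp h1 hm, ← mul_sub, abs_mul, abs_of_pos h0,
    sqrt_deviation h0 (dev_eq hp h1 hm)] at h
  exact le_of_mul_le_mul_left h h0

/-- The deviation of the empirical error of the reference classifier on the good event. -/
lemma abs_empErr_sub_le (hT : IsRun μ ℱ D p H T) (hp : p.Admissible H.card)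
    (hL : 1 ≤ Real.log (H.card / p.δ)) (hH : ∀ f ∈ H, Measurable f) (hgood : T.Good p H D g ω)
    {m : ℕ} (h1 : 1 ≤ m) (hm : m ≤ p.M) (hA : ∀ j, 1 ≤ j → j ≤ m → g ∈ T.A p H j ω) :
    |empErr g (T.Z p H ω m) - T.errBar p H D m ω g| ≤ 1 / 2 * T.errBar p H D m ω g +
      3 / 8 * (p.eps H.card m * T.maxWeight p H m ω) := by
  have h3 := hp.three_le h1 hm
  have h0 : (0 : ℝ) < p.τ m := by linarith
  have hg : g ∈ H := (hA 1 le_rfl h1).1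
  have hR := two_le_maxWeight (T := T) hp h1 hm ω
  have hε := hp.eps_pos hL h1 hm
  have h := hT.abs_sub_le_of_good hp hL hgood h1 hm hg false
  have hmean : ∑ j ∈ Finset.Icc 1 m, ((p.τ j : ℝ) - (p.τ (j - 1) : ℝ)) *
      T.mean p H D (testFun g g true false) j ω = p.τ m * T.errBar p H D m ω g := by
    rw [tau_mul_errBar hp h1 hm]
    refine Finset.sum_congr rfl fun j hj => ?_
    obtain ⟨hj1, hj2⟩ := Finset.mem_Icc.1 hj
    obtain ⟨i, rfl⟩ : ∃ i, j = i + 1 := ⟨j - 1, by omega⟩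
    rw [hT.mean_loss hp hL hH (by omega) (hA _ hj1 hj2)]
  rw [hmean, weightedSum_loss hp h1 hm, ← mul_sub, abs_mul, abs_of_pos h0,
    sqrt_deviation h0 (dev_eq hp h1 hm)] at h
  have hV : (∑ j ∈ Finset.Icc 1 m, ((p.τ j : ℝ) - (p.τ (j - 1) : ℝ)) *
      T.moment p H D (testFun g g true false) j ω) / p.τ m ≤
      T.maxWeight p H m ω * T.errBar p H D m ω g := by
    rw [div_le_iff₀ h0, mul_assoc, mul_comm _ (p.τ m : ℝ), tau_mul_errBar hp h1 hm, Finset.mul_sum]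
    refine Finset.sum_le_sum fun j hj => ?_
    obtain ⟨hj1, hj2⟩ := Finset.mem_Icc.1 hj
    obtain ⟨i, rfl⟩ : ∃ i, j = i + 1 := ⟨j - 1, by omega⟩
    rw [mul_left_comm]
    refine mul_le_mul_of_nonneg_left ?_ (hp.width_nonneg (hj2.trans hm))
    exact integral_spread_loss_le (measurableSet_region_apply hH _ _) (hH g hg)
      (hT.h_eq_of_mem_A hp hL (by omega) (hA _ hj1 hj2))
      (hT.inv_P_le (by omega) (by linarith) (hT.one_le_maxWeight_mul_pLow hp hL h1 hm (by omega) ω))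
  refine (le_of_mul_le_mul_left h h0).trans ?_
  have heb : 0 ≤ T.errBar p H D m ω g := by
    refine nonneg_of_mul_nonneg_right ?_ h0
    rw [tau_mul_errBar hp h1 hm]
    exact Finset.sum_nonneg fun j hj => mul_nonneg
      (hp.width_nonneg ((Finset.mem_Icc.1 hj).2.trans hm)) (errEpoch_nonneg _ _)
  have hεR : 0 ≤ p.eps H.card m * T.maxWeight p H m ω := mul_nonneg hε.le (by linarith)
  have hsq : √(3 / 8 * (p.eps H.card m * ((∑ j ∈ Finset.Icc 1 m,
      ((p.τ j : ℝ) - (p.τ (j - 1) : ℝ)) * T.moment p H D (testFun g g true false) j ω) / p.τ m))) ≤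
      1 / 2 * T.errBar p H D m ω g + 3 / 16 * (p.eps H.card m * T.maxWeight p H m ω) := by
    -- This is the inequality between arithmetic and geometric means, `4 a b ≤ (a + b) ^ 2`, with `4
    -- * (1 / 2) * (3 / 16) = 3 / 8`.
    refine Real.sqrt_le_iff.2 ⟨by positivity, ?_⟩
    have := mul_le_mul_of_nonneg_left hV hε.le
    nlinarith [sq_nonneg (1 / 2 * T.errBar p H D m ω g -
      3 / 16 * (p.eps H.card m * T.maxWeight p H m ω))]
  linarith

/-- The conclusions about epoch `m`, apart from the membership in the good sets. -/
def Conclusion (T : Trace Ω 𝒳) (p : Params) (H : Finset (𝒳 → Bool)) (D : Measure (𝒳 × Bool))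
    (g : 𝒳 → Bool) (ω : Ω) (m : ℕ) : Prop :=
  (∀ f ∈ H, |empReg f g (T.Z p H ω m) - T.regBar p H D m ω f g|
    ≤ 1 / 2 * T.regBar p H D m ω f g + p.η / 4 * T.Delta p H m ω) ∧
  empReg g (T.h (m + 1) ω) (T.Z p H ω m) ≤ p.η * T.Delta p H m ω / 4 ∧
  |T.errBar p H D m ω g - empErr (T.h (m + 1) ω) (T.Z p H ω m)|
    ≤ T.errBar p H D m ω g / 2 + p.η / 2 * T.Delta p H m ω

/-- The second moment in epoch `i + 1` involves empirical regrets on the sample after epoch `i` and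
the excess error of `h_{i+1}`; the induction hypothesis for epoch `i` controls both. -/
lemma sum_moment_le (hT : IsRun μ ℱ D p H T) (hp : p.Admissible H.card)
    (hL : 1 ≤ Real.log (H.card / p.δ)) (hH : ∀ f ∈ H, Measurable f) (hbest : IsBest D H g)
    (hf : f ∈ H) {m : ℕ} (h1 : 1 ≤ m) (hm : m ≤ p.M)
    (hA : ∀ j, 1 ≤ j → j ≤ m → g ∈ T.A p H j ω)
    (ih : ∀ i, 1 ≤ i → i < m → Conclusion T p H D g ω i) {X : ℝ}
    (hX : X = p.n * p.eps H.card p.M * Real.log p.n) :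
    ∑ j ∈ Finset.Icc 1 m, ((p.τ j : ℝ) - (p.τ (j - 1) : ℝ)) *
        T.moment p H D (testFun g f true true) j ω ≤
      2 * p.α ^ 2 * (p.τ m * T.regBar p H D m ω f g + 4 * (p.τ m * T.errBar p H D m ω g)) +
      2 * Real.log (p.τ m) * (2 * p.α ^ 2 * p.η * (p.τ m * T.Delta p H m ω) +
        p.η / (288 * X) * (p.τ m * T.regBar p H D m ω f g) * (p.τ m * T.Delta p H m ω) +
        p.η ^ 2 / (576 * X) * (p.τ m * T.Delta p H m ω) ^ 2 +
        1 / (4 * X) * (p.τ m * T.Delta p H m ω) ^ 2) := by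
  have hX0 : 0 < X := hX ▸ hp.scale_pos hL
  have hη := hp.η_ge
  have hα : 1 ≤ p.α ^ 2 := one_le_pow₀ hp.α_ge
  have hΔ := Delta_nonneg (T := T) hp hL hm ω
  set C := 2 * p.α ^ 2 * p.η * (p.τ m * T.Delta p H m ω) +
        p.η / (288 * X) * (p.τ m * T.regBar p H D m ω f g) * (p.τ m * T.Delta p H m ω) +
        p.η ^ 2 / (576 * X) * (p.τ m * T.Delta p H m ω) ^ 2 +
        1 / (4 * X) * (p.τ m * T.Delta p H m ω) ^ 2 with hC
  have hrb : ∀ {f}, f ∈ H → ∀ i, 1 ≤ i → i ≤ m → 0 ≤ T.regBar p H D i ω f g := fun hf i hi1 him =>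
    (sub_nonneg.2 (hbest.2 _ hf)).trans (hT.err_sub_le_regBar hp hL hH hf hi1 (him.trans hm)
      fun j hj1 hj2 => hA j hj1 (hj2.trans him))
  have hC0 : 0 ≤ C := by
    have := hrb hf m h1 le_rfl
    positivity
  have key : ∀ j ∈ Finset.Icc 1 m, T.moment p H D (testFun g f true true) j ω ≤
      2 * p.α ^ 2 * (T.regEpoch p H D j ω f g + 4 * T.errEpoch p H D j ω g) +
      (if j ≤ 1 then 0 else 1 / (p.τ (j - 1) : ℝ)) * C := by
    intro j hj
    obtain ⟨hj1, hj2⟩ := Finset.mem_Icc.1 hj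
    by_cases hj : j ≤ 1
    · obtain rfl : j = 1 := by omega
      rw [if_pos le_rfl, zero_mul, add_zero]
      have h := hT.moment_diff_one_le (ω := ω) hp hL hH hf hbest.1
      have h2 := hT.regEpoch_nonneg hp hL hH hbest hf le_rfl (h1.trans hm) (hA 1 le_rfl h1)
      have h3 := errEpoch_nonneg (T := T) (p := p) (H := H) (D := D) (ω := ω) 1 g
      nlinarith
    · rw [if_neg hj]
      obtain ⟨i, rfl⟩ : ∃ i, j = i + 1 := ⟨j - 1, by omega⟩
      have hi1 : 1 ≤ i := by omega
      have him : i < m := by omega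
      have hiM : i < p.M := by omega
      rw [Nat.add_sub_cancel]
      obtain ⟨hc1, hc2, -⟩ := ih i hi1 him
      have hh := hT.erm_mem i hiM.le ω
      -- As the empirical regret of `h_{i+1}` is nonpositive, the induction hypothesis bounds half
      -- its population regret by `η Δ_i / 4`. Its excess error is therefore at most `η Δ_i / 2`.
      have hle : empReg (T.h (i + 1) ω) g (T.Z p H ω i) ≤ 0 :=
        sub_nonpos.2 (hT.erm_le i hiM.le ω g hbest.1)
      have hE1 := hT.err_sub_le_regBar hp hL hH hh hi1 hiM.le
        fun j hj1 hj2 => hA j hj1 (hj2.trans him.le)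
      have hE2 := (abs_le.1 (hc1 _ hh)).1
      have hF2 := (abs_le.1 (hc1 _ hf)).2
      -- The regrets of `f` and `g` to `h_{i+1}` sum to `reg(f, g) + 2 reg(g, h_{i+1})`, at most `3
      -- / 2` of the population regret plus `η Δ_i / 4 + 2 (η Δ_i / 4)`.
      have hdecomp : empReg f (T.h (i + 1) ω) (T.Z p H ω i) =
          empReg f g (T.Z p H ω i) + empReg g (T.h (i + 1) ω) (T.Z p H ω i) := by
        unfold empReg
        ring
      refine (hT.moment_diff_le hp hL hH hf hi1 hiM (hA _ hj1 hj2)).trans ?_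
      refine epoch_moment_le hX0 (by linarith) (mul_nonneg (sq_nonneg _) hp.γ_pos.le)
        (hX ▸ hp.βγ_le hL) (hX ▸ hp.ξ_le') (by linarith [hp.three_le hi1 hiM.le])
        (Delta_nonneg hp hL hiM.le ω) (hrb hf i hi1 him.le) ?_ ?_
        (hT.tau_mul_Delta_mono hp hL hi1 him.le hm ω)
        (hT.tau_mul_regBar_mono hp hL hH hbest hf hi1 him.le hm hA)
      · rw [hdecomp]
        linarith
      · linarith
  calc _ ≤ ∑ j ∈ Finset.Icc 1 m, ((p.τ j : ℝ) - (p.τ (j - 1) : ℝ)) *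
        (2 * p.α ^ 2 * (T.regEpoch p H D j ω f g + 4 * T.errEpoch p H D j ω g) +
        (if j ≤ 1 then 0 else 1 / (p.τ (j - 1) : ℝ)) * C) :=
        Finset.sum_le_sum fun j hj => mul_le_mul_of_nonneg_left (key j hj)
          (hp.width_nonneg ((Finset.mem_Icc.1 hj).2.trans hm))
    _ = 2 * p.α ^ 2 * (p.τ m * T.regBar p H D m ω f g + 4 * (p.τ m * T.errBar p H D m ω g)) +
        (∑ j ∈ Finset.Icc 1 m, ((p.τ j : ℝ) - (p.τ (j - 1) : ℝ)) *
          (if j ≤ 1 then 0 else 1 / (p.τ (j - 1) : ℝ))) * C := by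
        rw [tau_mul_regBar hp h1 hm, tau_mul_errBar hp h1 hm, Finset.mul_sum,
          ← Finset.sum_add_distrib, Finset.mul_sum, Finset.sum_mul, ← Finset.sum_add_distrib]
        refine Finset.sum_congr rfl fun j _ => ?_
        ring
    _ ≤ _ := by
        have := mul_le_mul_of_nonneg_right (hp.sum_ratio_le h1 hm) hC0
        linarith

omit [IsProbabilityMeasure D] in
/-- The range term of the deviation bound is dominated by the threshold. -/
lemma eps_mul_maxWeight_le (hT : IsRun μ ℱ D p H T) (hp : p.Admissible H.card)
    (hL : 1 ≤ Real.log (H.card / p.δ)) {m : ℕ} (h1 : 1 ≤ m) (hm : m ≤ p.M) (ω : Ω) :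
    p.eps H.card m * T.maxWeight p H m ω ≤ T.Delta p H m ω / 4 := by
  have hε := hp.eps_pos hL h1 hm
  have h3 := hp.three_le h1 hm
  have hlog := hp.one_le_log h1 hm
  have h := mul_sqrt_div_le hε (by linarith : (0 : ℝ) < p.τ m)
    (hT.empErr_nonneg (ω := ω) (f := T.h (m + 1) ω) hp hm) (hp.tau_mul_eps_le hL h1 hm)
  rw [tau_mul_empErr_h hp h1 hm] at h
  rw [Delta_eq h1, Trace.maxWeight, mul_add]
  have hα := hp.α_ge
  have hη := hp.η_ge
  have hα2 : 1 ≤ p.α ^ 2 := one_le_pow₀ hα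
  -- The values `4` and `8` are four times the coefficients `1` and `2` in `maxWeight`.
  have hc1 : 4 ≤ p.c₁ := by linarith [hp.four_mul_le_c₁]
  have hc2 : 8 ≤ p.c₂ := by nlinarith [hp.c₂_ge']
  have hs := Real.sqrt_nonneg (p.eps H.card m * empErr (T.h (m + 1) ω) (T.Z p H ω m))
  have e1 := mul_le_mul_of_nonneg_right hc1 hs
  have e2 := mul_le_mul_of_nonneg_right hc2 (by positivity : 0 ≤ p.eps H.card m * Real.log (p.τ m))
  linarith

/-- The deviation bound contains the unknown `r = reg(g, h_{m+1})` with coefficient `1 / 4`. Applied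
to `h_{m+1}` it reads `r + regBar ≤ (r + regBar) / 4 + …`, which bounds `r`; the other claims follow
by substitution. -/
lemma conclusion_step (hT : IsRun μ ℱ D p H T) (hp : p.Admissible H.card)
    (hL : 1 ≤ Real.log (H.card / p.δ)) (hH : ∀ f ∈ H, Measurable f) (hbest : IsBest D H g)
    (hgood : T.Good p H D g ω) {m : ℕ} (h1 : 1 ≤ m) (hm : m ≤ p.M)
    (hA : ∀ j, 1 ≤ j → j ≤ m → g ∈ T.A p H j ω)
    (ih : ∀ i, 1 ≤ i → i < m → Conclusion T p H D g ω i) : Conclusion T p H D g ω m := by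
  have hε := hp.eps_pos hL h1 hm
  have h3 := hp.three_le h1 hm
  have hη := hp.η_ge
  have hΔ0 := Delta_nonneg (T := T) hp hL hm ω
  have hεR := hT.eps_mul_maxWeight_le hp hL h1 hm ω
  have herr := hT.abs_empErr_sub_le hp hL hH hgood h1 hm hA
  have hr : 0 ≤ empReg g (T.h (m + 1) ω) (T.Z p H ω m) :=
    sub_nonneg.2 (hT.erm_le m hm ω g hbest.1)
  have hrb : ∀ {f}, f ∈ H → 0 ≤ T.regBar p H D m ω f g := fun hf =>
    (sub_nonneg.2 (hbest.2 _ hf)).trans (hT.err_sub_le_regBar hp hL hH hf h1 hm hA)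
  have heq : empErr g (T.Z p H ω m) = empErr (T.h (m + 1) ω) (T.Z p H ω m) +
      empReg g (T.h (m + 1) ω) (T.Z p H ω m) := by
    unfold empReg
    ring
  have heb : T.errBar p H D m ω g ≤ 2 * (empErr (T.h (m + 1) ω) (T.Z p H ω m) +
      empReg g (T.h (m + 1) ω) (T.Z p H ω m)) +
      3 / 4 * (p.eps H.card m * T.maxWeight p H m ω) := by
    rw [← heq]
    linarith [(abs_le.1 herr).1]
  have hdev : ∀ {f}, f ∈ H → |empReg f g (T.Z p H ω m) - T.regBar p H D m ω f g| ≤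
      (T.regBar p H D m ω f g + empReg g (T.h (m + 1) ω) (T.Z p H ω m)) / 4 +
        p.η * T.Delta p H m ω / 10 + 3 / 64 * T.Delta p H m ω := fun {f} hf => by
    have h := sqrt_variance_le hp.α_ge hη hε (hp.one_le_log h1 hm)
      (by linarith [hp.four_mul_le_c₁, hp.α_ge]) hp.sq_c₁_ge hp.c₂_ge'
      (hT.empErr_nonneg (ω := ω) (f := T.h (m + 1) ω) hp hm) (Delta_eq h1 ω)
      (by linarith : (0 : ℝ) < p.τ m) (hp.tau_eps_log_le hL h1 hm) (hrb hf) hr hεR heb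
      (hT.sum_moment_le hp hL hH hbest hf h1 hm hA ih rfl)
    have h' := hT.abs_empReg_sub_le hp hL hH hgood hbest.1 hf h1 hm
    linarith
  have hηΔ : 864 * T.Delta p H m ω ≤ p.η * T.Delta p H m ω :=
    mul_le_mul_of_nonneg_right hη hΔ0
  have hneg : empReg (T.h (m + 1) ω) g (T.Z p H ω m) =
      - empReg g (T.h (m + 1) ω) (T.Z p H ω m) := by
    unfold empReg
    ring
  have hh := hT.erm_mem m hm ω
  have hd := (abs_le.1 (hdev hh)).1
  have hrbh := hrb hh
  rw [hneg] at hd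
  refine ⟨fun f hf => ?_, by linarith, ?_⟩
  · have := hrb hf
    refine (hdev hf).trans ?_
    linarith
  · obtain ⟨e1, e2⟩ := abs_le.1 herr
    rw [heq] at e1 e2
    rw [abs_le]
    constructor <;> linarith

/-- All the conclusions hold on the good event. -/
theorem conclusion_of_good (hT : IsRun μ ℱ D p H T) (hp : p.Admissible H.card)
    (hL : 1 ≤ Real.log (H.card / p.δ)) (hH : ∀ f ∈ H, Measurable f) (hbest : IsBest D H g)
    (hgood : T.Good p H D g ω) : ∀ m, m ≤ p.M →
      (∀ i, 1 ≤ i → i ≤ m → Conclusion T p H D g ω i) ∧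
      ∀ j, 1 ≤ j → j ≤ m + 1 → g ∈ T.A p H j ω := by
  intro m
  induction m with
  | zero =>
    refine fun _ => ⟨fun i h1 h2 => by omega, fun j h1 h2 => ?_⟩
    obtain rfl : j = 1 := by omega
    exact mem_A_one hp hL hbest.1 ω
  | succ m ih =>
    intro hm
    obtain ⟨ihC, ihA⟩ := ih (by omega)
    have hstep := hT.conclusion_step hp hL hH hbest hgood (by omega) hm ihA
      fun i h1 h2 => ihC i h1 (by omega)
    refine ⟨fun i h1 h2 => ?_, fun j h1 h2 => ?_⟩
    · rcases h2.lt_or_eq with h | rfl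
      · exact ihC i h1 (by omega)
      · exact hstep
    · rcases h2.lt_or_eq with h | rfl
      · exact ihA j h1 (by omega)
      -- The bound `η Δ_m / 4` on the empirical regret lies within the tolerance `γ Δ_m` defining
      -- the next good set.
      · refine ⟨hbest.1, hstep.2.1.trans ?_⟩
        have h := mul_le_mul_of_nonneg_right hp.γ_ge (Delta_nonneg (T := T) hp hL hm ω)
        refine le_trans (le_of_eq ?_) h
        ring

end IsRun

end Pathwise

end ActiveCover

theorem mainTheorem2 {Ω 𝒳 : Type*} [mΩ : MeasurableSpace Ω] [MeasurableSpace 𝒳]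
    (μ : Measure Ω) [IsProbabilityMeasure μ] (ℱ : Filtration ℕ mΩ)
    (D : Measure (𝒳 × Bool)) [IsProbabilityMeasure D]
    (H : Finset (𝒳 → Bool)) (hH : ∀ f ∈ H, Measurable f)
    (p : ActiveCover.Params) (hp : p.Admissible H.card)
    (hδ_pos : 0 < p.δ) (hδ_lt : p.δ < 1 / Real.exp 1) (hδ_card : √192 < (H.card : ℝ) / p.δ)
    (T : ActiveCover.Trace Ω 𝒳) (hT : ActiveCover.IsRun μ ℱ D p H T)
    (hstar : 𝒳 → Bool) (hstar_best : ActiveCover.IsBest D H hstar) :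
    1 - p.δ ≤ μ.real {ω | ∀ m, 1 ≤ m → m ≤ p.M →
      (∀ h ∈ H,
        |ActiveCover.empReg h hstar (T.Z p H ω m) - T.regBar p H D m ω h hstar|
          ≤ 1 / 2 * T.regBar p H D m ω h hstar + p.η / 4 * T.Delta p H m ω) ∧
      ActiveCover.empReg hstar (T.h (m + 1) ω) (T.Z p H ω m) ≤ p.η * T.Delta p H m ω / 4 ∧
      (∀ i, 1 ≤ i → i ≤ m + 1 → hstar ∈ T.A p H i ω) ∧
      |T.errBar p H D m ω hstar - ActiveCover.empErr (T.h (m + 1) ω) (T.Z p H ω m)|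
        ≤ T.errBar p H D m ω hstar / 2 + p.η / 2 * T.Delta p H m ω} := by
  -- The condition `δ < 1 / e` is needed only for this lower bound on the logarithm.
  have hL : 1 ≤ Real.log (H.card / p.δ) :=
    ActiveCover.one_le_log_div (Finset.card_pos.2 ⟨hstar, hstar_best.1⟩) hδ_pos hδ_lt
  refine (hT.good hp hH hδ_pos hδ_card hstar_best.1).trans
    (measureReal_mono (fun ω hω m h1 hm => ?_) (measure_ne_top _ _))
  obtain ⟨hC, hA⟩ := hT.conclusion_of_good hp hL hH hstar_best hω m hm
  obtain ⟨c1, c2, c3⟩ := hC m h1 le_rfl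
  exact ⟨c1, c2, hA, c3⟩
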